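/- **Theorem (KAM reducibility).** *Notation.* Let $d\ge 1$, $\mathrm m>0$, $\tau>0$, $s\in\mathbb R$, $C_0\ge 0$. Put $\langle x\rangle=\max\{1,|x|\}$, $s_0=[\frac{d+1}{2}]+1$, $\mathrm a=6\tau+4$, $b=\mathrm a+1$, and, for $N_0\in\mathbb N$, $N_{-1}=1$, $N_n=N_0^{(3/2)^n}$ ($n\ge 0$). For $\tau_0>0$ put $\mathrm s=s-\tau_0-11$, and for $\gamma\in(0,1)$ $$\mathcal O_\gamma=\Big\{\omega\in[1,2]^d:\ |\omega\cdot\ell+j|\ge \gamma\langle\ell\rangle^{-\tau_0}\ \ \forall(\ell,j)\in\mathbb Z^{d+1}\setminus\{0\}\Big\}.$$ A $\theta$-dependent operator $\mathcal A$ on $L^2(\mathbb T)$, $\theta\in\mathbb T^d$, is identified with the matrix elements $\hat{\mathcal A}(\ell)_j^k$ ($\ell\in\mathbb Z^d$, from $e^{\mathrm ijx}$ to $e^{\mathrm ikx}$) of its Fourier coefficients in $\theta$; $[\hat{\mathcal A}(\ell)]_\alpha^\beta$ is the block from $\mathbb E_\alpha=\mathrm{span}\{e^{\mathrm ijx}:|j|=\alpha\}$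 to $\mathbb E_\beta$, $\|\cdot\|_0$ is the $L^2$ operator norm, $\langle D\rangle e^{\mathrm ijx}=\langle j\rangle e^{\mathrm ijx}$, $\bar{\mathcal A}u=\overline{\mathcal A\bar u}$, and $$|\mathcal A|_r=\sup_{\alpha\in\mathbb N}\Big(\sum_{\ell\in\mathbb Z^d,\beta\in\mathbb N}\max\{1,|\ell|,|\beta-\alpha|\}^{2r}\|[\hat{\mathcal A}(\ell)]^\beta_\alpha\|_0^2\Big)^{1/2}.$$ $\mathcal N_r(\rho,o)$ is the set of operator matrices $\mathbf A=\begin{pmatrix}\mathcal A^d&\mathcal A^a\\-\overline{\mathcal A^a}&-\overline{\mathcal A^d}\end{pmatrix}$ with $(\mathcal A^d)^*=\mathcal A^d$, $(\mathcal A^a)^*=\overline{\mathcal A^a}$ and finite norm $$|||\mathbf A|||_{r,\rho,o}=|\langle D\rangle^\rho\mathcal A^d|_r+|\mathcal A^d\langle D\rangle^\rho|_r+|\langle D\rangle^o\mathcal A^a|_r+|\mathcal A^a\langle D\rangle^o|_r+\sum_{\sigma\in\{\pm\rho,0\},\ \delta\in\{d,a\}}|\langle D\rangle^\sigma\mathcal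 A^\delta\langle D\rangle^{-\sigma}|_r .$$ For a norm $\|\cdot\|$ and a function $f$ on a set $O$ of frequencies, $\|f\|^{\gamma,O}=\sup_{O}\|f(\omega)\|+\gamma\sup_{\omega_1\ne\omega_2\in O}\|f(\omega_1)-f(\omega_2)\|/|\omega_1-\omega_2|$; $\mathrm{Lip}(O,\mathcal N_r(\rho,o))$ is the set of $\mathbf A:O\to\mathcal N_r(\rho,o)$ with $|||\mathbf A|||^{\gamma,O}_{r,\rho,o}<\infty$. *Statement.* There is $\bar N=\bar N(s,\tau,d,\mathrm m,C_0)$ such that for every integer $N_0\ge\bar N$ there is $\delta_0=\delta_0(s,\tau,d,\mathrm m,C_0,N_0)\in(0,1)$ with the following property. Let $\tau_0>0$ with $\mathrm s-b>s_0$, $\gamma\in(0,1)$, $\varepsilon\ge 0$, let $\kappa_j:\mathcal O_\gamma\to\mathbb R$ ($j\in\mathbb Z$) satisfy $|\kappa_j|^{\gamma,\mathcal O_\gamma}\le C_0\varepsilon$, let $\mathbf P^0\in\mathrm{Lip}(\mathcal O_\gamma,\mathcal N_{\mathrm s}(1,0))$ satisfy $|||\mathbf P^0|||^{\gamma,\mathcal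 O_\gamma}_{\mathrm s,1,0}\le\varepsilon$, and consider $\mathrm i\partial_t\mathbf v=\widetilde{\mathbf H}^0(\omega t)\mathbf v$ with $$\widetilde{\mathbf H}^0=\mathbf H^0_0+\mathbf P^0,\quad \mathbf H_0^0=\begin{pmatrix}\mathcal H_0^0&0\\0&-\overline{\mathcal H_0^0}\end{pmatrix},\quad \mathcal H^0_0e^{\mathrm ijx}=\big(\sqrt{j^2+\mathrm m}+\kappa_j(\omega)\big)e^{\mathrm ijx}.$$ If $\varepsilon\gamma^{-1}\le\delta_0$, then there are $\mathbf H^n_0(\omega)$, $\mathbf P^n(\omega t,\omega)$ ($n\ge0$, extending the given data at $n=0$) and $\mathbf U^n(\omega t,\omega)$ ($n\ge 1$) such that: **I.** Let $\mathcal O^0_\gamma=\mathcal O_\gamma$ and, recursively, let $\mathcal O^{n+1}_\gamma$ be the set of $\omega\in\mathcal O^n_\gamma$ such that for all $(\ell,i,j)\in\mathbb Z^d\times\mathbb N\times\mathbb N$ with $|\ell|\le N_n$, $(\ell,i,j)\ne(0,j,j)$, and all eigenvalues $\lambda^n_{i,\mathfrak a}$ of $\mathbf h^n_i$ and $\lambda^n_{j,\mathfrak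 a'}$ of $\mathbf h^n_j$ (see III) $$|\omega\cdot\ell+\lambda^n_{i,\mathfrak a}-\lambda^n_{j,\mathfrak a'}|\ge\frac{\gamma\langle i-j\rangle}{N_n^\tau},\qquad |\omega\cdot\ell+\lambda^n_{i,\mathfrak a}+\lambda^n_{j,\mathfrak a'}|\ge\frac{\gamma\langle i+j\rangle}{N_n^\tau}.$$ **II.** For $n\ge1$, $\mathbf U^n\in\mathrm{Lip}(\mathcal O^n_\gamma,\mathcal N_{\mathrm s}(1,1))$ and $$|||\mathbf U^n|||^{\gamma,\mathcal O^n_\gamma}_{\mathrm s-b,1,1}\le|||\mathbf P^0|||^{\gamma,\mathcal O_\gamma}_{\mathrm s,1,0}\,\gamma^{-1}N_{n-1}^{2\tau+1}N_{n-2}^{-\mathrm a}.$$ For $\omega\in\mathcal O^n_\gamma$ the change of coordinates $e^{-\mathrm i\mathbf U^n}$ conjugates $\widetilde{\mathbf H}^{n-1}$ to $\widetilde{\mathbf H}^n=\mathbf H^n_0+\mathbf P^n$, that is, $\widetilde{\mathbf H}^{n-1}e^{-\mathrm i\mathbf U^n}-\mathrm i\,\omega\cdot\partial_\theta e^{-\mathrm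 i\mathbf U^n}=e^{-\mathrm i\mathbf U^n}\widetilde{\mathbf H}^n$. **III.** $\mathbf H^n_0$ is block diagonal, self-adjoint and time independent: $\mathbf H_0^n=\begin{pmatrix}\mathcal H_0^n&0\\0&-\overline{\mathcal H_0^n}\end{pmatrix}$, $\mathcal H^n_0=\mathrm{diag}\{\mathbf h^n_j\mid j\in\mathbb N\}$ with self-adjoint $\mathbf h^n_j:\mathbb E_j\to\mathbb E_j$ defined for all $\omega\in\mathcal O_\gamma$, and for $n\ge1$, $j\in\mathbb N$ $$\|\mathbf h^n_j-\mathbf h^{n-1}_j\|_0^{\gamma,\mathcal O_\gamma}\le N_{n-2}^{-\mathrm a}\,\varepsilon\,\langle j\rangle^{-1}.$$ **IV.** For $n\ge0$, $\mathbf P^n\in\mathrm{Lip}(\mathcal O^n_\gamma,\mathcal N_{\mathrm s}(1,0))$ and $$|||\mathbf P^n|||^{\gamma,\mathcal O^n_\gamma}_{\mathrm s,1,0}\le|||\mathbf P^0|||^{\gamma,\mathcal O_\gamma}_{\mathrm s,1,0}N_{n-1},\qquad |||\mathbf P^n|||^{\gamma,\mathcal O^n_\gamma}_{\mathrm s-b,1,0}\le|||\mathbf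 P^0|||^{\gamma,\mathcal O_\gamma}_{\mathrm s,1,0}N_{n-1}^{-\mathrm a}.$$ -/

import Mathlib

open scoped ENNReal

namespace WaveKAM

noncomputable section

/-- Frequency vectors, with the Euclidean norm. -/
abbrev Freq (d : ℕ) := EuclideanSpace ℝ (Fin d)

/-- Fourier coefficients of a `θ`-dependent operator on `L²(𝕋)`, `θ ∈ 𝕋^d`:
`A ℓ j k` is the matrix element of `Â(ℓ)` from `e^{ijx}` to `e^{ikx}`. -/
abbrev Coef (d : ℕ) := (Fin d → ℤ) → ℤ → ℤ → ℂ

/-- A pair `(A.1, A.2)` stands for the operator matrix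
`[[A.1, A.2], [-conj A.2, -conj A.1]]` (see `full`). -/
abbrev BlockOp (d : ℕ) := Coef d × Coef d

/-- `⟨x⟩ = max {1, |x|}`. -/
def jap (x : ℝ) : ℝ := max 1 |x|

/-- Euclidean norm of an integer vector. -/
def len {d : ℕ} (l : Fin d → ℤ) : ℝ := Real.sqrt (∑ i, (l i : ℝ) ^ 2)

/-- The scalar product `ω · ℓ`. -/
def dotZ {d : ℕ} (ω : Freq d) (l : Fin d → ℤ) : ℝ := ∑ i, ω i * (l i : ℝ)

/-- `s₀ = [(d+1)/2] + 1`. -/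
def sZero (d : ℕ) : ℕ := (d + 1) / 2 + 1

/-- The exponent `a = 6τ + 4`. -/
def aExp (τ : ℝ) : ℝ := 6 * τ + 4

/-- The exponent `b = a + 1`. -/
def bExp (τ : ℝ) : ℝ := aExp τ + 1

/-- The scales `N_n = N₀ ^ ((3/2) ^ n)` for `n ≥ 0`, and `N_{-1} = 1`. -/
def scale (N₀ : ℕ) (n : ℤ) : ℝ :=
  if n < 0 then 1 else (N₀ : ℝ) ^ ((3 / 2 : ℝ) ^ n.toNat)

/-! ### Blocks and norms -/

/-- The integers `j` with `|j| = α`, indexing the basis of `𝔼_α`. -/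
def shell (α : ℕ) : Finset ℤ := {(α : ℤ), -(α : ℤ)}

/-- The block `𝔼_α → 𝔼_β` of an infinite matrix (`M j k` maps `e^{ijx}` to `e^{ikx}`);
rows are indexed by the target. -/
def block (M : ℤ → ℤ → ℂ) (α β : ℕ) : Matrix (shell β) (shell α) ℂ :=
  Matrix.of fun k j => M j k

open scoped Matrix.Norms.L2Operator in
/-- The `L²` operator norm of a block. -/
def blockNorm (M : ℤ → ℤ → ℂ) (α β : ℕ) : ℝ := ‖block M α β‖

/-- The block decay norm
`sup_α (∑_{ℓ, β} ⟨ℓ, β - α⟩^{2s} ‖[Â(ℓ)]_α^β‖²)^{1/2}`, with values in `[0, ∞]`. -/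
def decayNorm {d : ℕ} (s : ℝ) (A : Coef d) : ℝ≥0∞ :=
  ⨆ α : ℕ, (∑' p : (Fin d → ℤ) × ℕ,
    ENNReal.ofReal ((max (jap ((p.2 : ℝ) - α)) (len p.1)) ^ (2 * s)
      * blockNorm (A p.1) α p.2 ^ 2)) ^ (1 / 2 : ℝ)

/-- `⟨D⟩^σ A ⟨D⟩^σ'`. -/
def weight {d : ℕ} (σ σ' : ℝ) (A : Coef d) : Coef d := fun l j k =>
  ((jap k ^ σ : ℝ) : ℂ) * A l j k * ((jap j ^ σ' : ℝ) : ℂ)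

/-- The conjugate operator `u ↦ conj (A (conj u))`. -/
def conjOp {d : ℕ} (A : Coef d) : Coef d := fun l j k => star (A (-l) (-j) (-k))

/-- The adjoint operator. -/
def adjOp {d : ℕ} (A : Coef d) : Coef d := fun l j k => star (A (-l) k j)

/-- The norm `⦀A⦀_{s,ρ,o}`. -/
def blockOpNorm {d : ℕ} (s ρ o : ℝ) (A : BlockOp d) : ℝ≥0∞ :=
  decayNorm s (weight ρ 0 A.1) + decayNorm s (weight 0 ρ A.1)
    + decayNorm s (weight o 0 A.2) + decayNorm s (weight 0 o A.2)
    + ∑ σ ∈ ({ρ, -ρ, 0} : Finset ℝ),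
        (decayNorm s (weight σ (-σ) A.1) + decayNorm s (weight σ (-σ) A.2))

/-- The class `𝒩_s(ρ, o)`. -/
def MemN {d : ℕ} (s ρ o : ℝ) (A : BlockOp d) : Prop :=
  adjOp A.1 = A.1 ∧ adjOp A.2 = conjOp A.2 ∧ blockOpNorm s ρ o A < ⊤

/-- The weighted Lipschitz norm `sup_O N(f) + γ sup N(f ω₁ - f ω₂) / |ω₁ - ω₂|` built on a
norm `N` with values in `[0, ∞]`. -/
def lipNorm {d : ℕ} {E : Type*} [Sub E] (γ : ℝ) (O : Set (Freq d)) (N : E → ℝ≥0∞)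
    (f : Freq d → E) : ℝ≥0∞ :=
  (⨆ ω ∈ O, N (f ω)) + ENNReal.ofReal γ *
    ⨆ ω₁ ∈ O, ⨆ ω₂ ∈ O, ⨆ _ : ω₁ ≠ ω₂, N (f ω₁ - f ω₂) / ENNReal.ofReal ‖ω₁ - ω₂‖

/-- The Lipschitz norm `⦀A⦀^{γ,O}_{s,ρ,o}`. -/
def lipN {d : ℕ} (γ : ℝ) (O : Set (Freq d)) (s ρ o : ℝ) (A : Freq d → BlockOp d) : ℝ≥0∞ :=
  lipNorm γ O (blockOpNorm s ρ o) A

/-- The class `Lip(O, 𝒩_s(ρ, o))`. -/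
def MemLipN {d : ℕ} (γ : ℝ) (O : Set (Freq d)) (s ρ o : ℝ) (A : Freq d → BlockOp d) : Prop :=
  (∀ ω ∈ O, MemN s ρ o (A ω)) ∧ lipN γ O s ρ o A < ⊤

/-! ### Conjugation -/

/-- Fourier coefficients of a `θ`-dependent operator on `L²(𝕋) × L²(𝕋)`; the index `(c, j)` is
the function `e^{ijx}` in the first (`c = false`) or second (`c = true`) component, and
`A ℓ p q` is the matrix element from `p` to `q`. -/
abbrev FullOp (d : ℕ) := (Fin d → ℤ) → Bool × ℤ → Bool × ℤ → ℂ

/-- The operator matrix `[[A.1, A.2], [-conj A.2, -conj A.1]]`. -/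
def full {d : ℕ} (A : BlockOp d) : FullOp d := fun l p q =>
  match q.1, p.1 with
  | false, false => A.1 l p.2 q.2
  | false, true => A.2 l p.2 q.2
  | true, false => -conjOp A.2 l p.2 q.2
  | true, true => -conjOp A.1 l p.2 q.2

/-- The identity operator. -/
def fullOne (d : ℕ) : FullOp d := fun l p q => if l = 0 ∧ p = q then 1 else 0

/-- `C` is the composition `A ∘ B`, all the series for the matrix elements being convergent. -/
def IsComp {d : ℕ} (A B C : FullOp d) : Prop :=
  ∀ l p q, HasSum (fun r : (Fin d → ℤ) × (Bool × ℤ) => A (l - r.1) r.2 q * B r.1 p r.2) (C l p q)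

/-- `Φ = e^{-iA} = ∑ₙ (-i)ⁿ Aⁿ / n!`. -/
def IsExpNegI {d : ℕ} (A Φ : FullOp d) : Prop :=
  ∃ pw : ℕ → FullOp d, pw 0 = fullOne d ∧ (∀ n, IsComp A (pw n) (pw (n + 1))) ∧
    ∀ l p q, HasSum (fun n : ℕ => (-Complex.I) ^ n / (n.factorial : ℂ) * pw n l p q) (Φ l p q)

/-- The change of coordinates `v = e^{-iU(ωt)} v⁺` conjugates `i ∂ₜ v = H(ωt) v` to
`i ∂ₜ v⁺ = H⁺(ωt) v⁺`, that is `H⁺ = e^{iU} H e^{-iU} - i e^{iU} (ω·∂_θ e^{-iU})`.  With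
`Φ = e^{-iU}` this reads `H Φ - i ω·∂_θ Φ = Φ H⁺`, here written for the Fourier coefficients,
where `-i ω·∂_θ` is multiplication by `ω·ℓ`. -/
def Conjugates {d : ℕ} (ω : Freq d) (U H Hplus : BlockOp d) : Prop :=
  ∃ Φ L R : FullOp d, IsExpNegI (full U) Φ ∧ IsComp (full H) Φ L ∧ IsComp Φ (full Hplus) R ∧
    ∀ l p q, L l p q + (dotZ ω l : ℂ) * Φ l p q = R l p q

/-! ### Normal forms and frequency sets -/

/-- The time-independent operator matrix `[[M, 0], [0, -conj M]]`. -/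
def constOp {d : ℕ} (M : ℤ → ℤ → ℂ) : BlockOp d :=
  (fun l j k => if l = 0 then M j k else 0, 0)

/-- `M` is block diagonal with respect to the decomposition `L²(𝕋) = ⊕ 𝔼_α`; its diagonal
blocks are `block M j j`. -/
def IsBlockDiag (M : ℤ → ℤ → ℂ) : Prop := ∀ j k : ℤ, j.natAbs ≠ k.natAbs → M j k = 0

/-- The Fourier multiplier with eigenvalues `(j² + m)^{1/2} + κ_j`, `j ∈ ℤ`. -/
def initialDiag (m : ℝ) (κ : ℤ → ℝ) : ℤ → ℤ → ℂ := fun j k =>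
  if j = k then ((Real.sqrt ((j : ℝ) ^ 2 + m) + κ j : ℝ) : ℂ) else 0

/-- The Diophantine set `O_γ ⊆ [1,2]^d`. -/
def baseSet (d : ℕ) (γ τ₀ : ℝ) : Set (Freq d) :=
  {ω | (∀ i, ω i ∈ Set.Icc (1 : ℝ) 2) ∧
    ∀ (l : Fin d → ℤ) (j : ℤ), (l, j) ≠ 0 → γ / jap (len l) ^ τ₀ ≤ |dotZ ω l + j|}

/-- The second-order Melnikov conditions with threshold `γ⟨i ∓ j⟩ / N^τ` for `|ℓ| ≤ N`,
`(ℓ, i, j) ≠ (0, j, j)`, where `lam`, `mu` run over the eigenvalues of the blocks of index `i`, `j`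
of `M`. -/
def Melnikov {d : ℕ} (γ τ N : ℝ) (M : ℤ → ℤ → ℂ) (ω : Freq d) : Prop :=
  ∀ (l : Fin d → ℤ) (i j : ℕ), len l ≤ N → ¬(l = 0 ∧ i = j) →
    ∀ lam mu : ℝ, (lam : ℂ) ∈ spectrum ℂ (block M i i) → (mu : ℂ) ∈ spectrum ℂ (block M j j) →
      γ * jap ((i : ℝ) - j) / N ^ τ ≤ |dotZ ω l + lam - mu| ∧
      γ * jap ((i : ℝ) + j) / N ^ τ ≤ |dotZ ω l + lam + mu|

/-- The nested sets `O_γ^n`: `O_γ^0 = O_γ`, and `O_γ^{n+1}` is the set of `ω ∈ O_γ^n` that satisfy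
the Melnikov conditions at scale `N_n` for the `n`-th normal form `M n`. -/
def freqSet (d : ℕ) (γ τ₀ τ : ℝ) (N₀ : ℕ) (M : ℕ → Freq d → ℤ → ℤ → ℂ) : ℕ → Set (Freq d)
  | 0 => baseSet d γ τ₀
  | n + 1 => {ω | ω ∈ freqSet d γ τ₀ τ N₀ M n ∧ Melnikov γ τ (scale N₀ n) (M n ω) ω}

end

end WaveKAM

namespace WaveKAM

noncomputable section

/-! ### Square sums in `[0, ∞]` -/

/-- The `ℓ²` norm of a family with values in `[0, ∞]`. -/
def l2 {ι : Type*} (f : ι → ℝ≥0∞) : ℝ≥0∞ := (∑' i, f i ^ 2) ^ (1 / 2 : ℝ)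

theorem l2_sq {ι : Type*} (f : ι → ℝ≥0∞) : l2 f ^ 2 = ∑' i, f i ^ 2 := by
  rw [l2, ← ENNReal.rpow_natCast, ← ENNReal.rpow_mul]; norm_num

theorem le_l2_iff {ι : Type*} {f : ι → ℝ≥0∞} {c : ℝ≥0∞} : l2 f ≤ c ↔ ∑' i, f i ^ 2 ≤ c ^ 2 := by
  rw [← l2_sq]
  exact ((ENNReal.pow_right_strictMono two_ne_zero).le_iff_le).symm

theorem l2_mono {ι : Type*} {f g : ι → ℝ≥0∞} (h : ∀ i, f i ≤ g i) : l2 f ≤ l2 g := by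
  rw [le_l2_iff, l2_sq]
  exact ENNReal.tsum_le_tsum fun i => pow_le_pow_left' (h i) 2

theorem le_l2 {ι : Type*} (f : ι → ℝ≥0∞) (i : ι) : f i ≤ l2 f := by
  refine ((ENNReal.pow_right_strictMono two_ne_zero).le_iff_le).1 ?_
  rw [l2_sq]
  exact ENNReal.le_tsum (f := fun i => f i ^ 2) i

theorem l2_const_mul {ι : Type*} (c : ℝ≥0∞) (f : ι → ℝ≥0∞) :
    l2 (fun i => c * f i) = c * l2 f := by
  refine (ENNReal.pow_right_strictMono two_ne_zero).injective ?_
  rw [l2_sq, mul_pow, l2_sq, ← ENNReal.tsum_mul_left]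
  simp_rw [mul_pow]

theorem tsum_mul_le_l2 {ι : Type*} (f g : ι → ℝ≥0∞) : ∑' i, f i * g i ≤ l2 f * l2 g := by
  rw [ENNReal.tsum_eq_iSup_sum]
  refine iSup_le fun s => ?_
  refine (ENNReal.inner_le_Lp_mul_Lq s f g Real.HolderConjugate.two_two).trans ?_
  refine mul_le_mul' ?_ ?_ <;>
  · rw [l2]
    refine ENNReal.rpow_le_rpow ?_ (by norm_num)
    simp only [ENNReal.rpow_ofNat]
    exact ENNReal.sum_le_tsum _

theorem l2_tsum_le {ι κ : Type*} (f : κ → ι → ℝ≥0∞) :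
    l2 (fun i => ∑' n, f n i) ≤ ∑' n, l2 (f n) := by
  rw [le_l2_iff]
  calc ∑' i, (∑' n, f n i) ^ 2 = ∑' i, ∑' n, ∑' m, f n i * f m i := by
        refine tsum_congr fun i => ?_
        rw [sq, ← ENNReal.tsum_mul_right]
        exact tsum_congr fun n => (ENNReal.tsum_mul_left).symm
    _ = ∑' n, ∑' m, ∑' i, f n i * f m i := by
        rw [ENNReal.tsum_comm]
        exact tsum_congr fun n => ENNReal.tsum_comm
    _ ≤ ∑' n, ∑' m, l2 (f n) * l2 (f m) :=
        ENNReal.tsum_le_tsum fun n => ENNReal.tsum_le_tsum fun m => tsum_mul_le_l2 _ _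
    _ = (∑' n, l2 (f n)) ^ 2 := by
        rw [sq, ← ENNReal.tsum_mul_right]
        exact tsum_congr fun n => ENNReal.tsum_mul_left

theorem l2_add_le {ι : Type*} (f g : ι → ℝ≥0∞) : l2 (fun i => f i + g i) ≤ l2 f + l2 g := by
  have := l2_tsum_le (fun (b : Bool) i => if b then f i else g i)
  simpa [tsum_fintype] using this

/-! ### The algebra of convolution kernels -/

/-- Kernels that are of convolution type in the first variable. -/
abbrev Ker (G K : Type*) := G → K → K → ℂ

variable {G K : Type*} [AddCommGroup G]

/-- The composition of two kernels. -/
def comp (X Y : Ker G K) : Ker G K := fun l p q =>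
  ∑' r : G × K, X (l - r.1) r.2 q * Y r.1 p r.2

/-- The identity kernel. -/
def kone (G K : Type*) [AddCommGroup G] : Ker G K := by
  classical exact fun l p q => if l = 0 ∧ p = q then 1 else 0

/-- The supremum over the columns of the `ℓ¹` norm. -/
def colOne (X : Ker G K) : ℝ≥0∞ := ⨆ p, ∑' r : G × K, ‖X r.1 p r.2‖ₑ

theorem summable_of_tsum_enorm {ι : Type*} {f : ι → ℂ} (h : ∑' i, ‖f i‖ₑ ≠ ⊤) : Summable f :=
  (tsum_enorm_ne_top_iff_summable_norm.1 h).of_norm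

theorem tsum_sub_fst {K : Type*} (f : G → K → ℝ≥0∞) (a : G) :
    ∑' r : G × K, f (r.1 - a) r.2 = ∑' r : G × K, f r.1 r.2 :=
  ((Equiv.subRight a).prodCongr (Equiv.refl K)).tsum_eq (fun r : G × K => f r.1 r.2)

section Col

variable {G K : Type*}

theorem tsum_enorm_le_colOne (X : Ker G K) (p : K) :
    ∑' r : G × K, ‖X r.1 p r.2‖ₑ ≤ colOne X :=
  le_iSup (fun p => ∑' r : G × K, ‖X r.1 p r.2‖ₑ) p

theorem enorm_le_colOne (X : Ker G K) (l : G) (p q : K) : ‖X l p q‖ₑ ≤ colOne X :=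
  (ENNReal.le_tsum (f := fun r : G × K => ‖X r.1 p r.2‖ₑ) (l, q)).trans (tsum_enorm_le_colOne X p)

theorem colOne_mono {X Y : Ker G K} (h : ∀ l p q, ‖X l p q‖ₑ ≤ ‖Y l p q‖ₑ) :
    colOne X ≤ colOne Y :=
  iSup_mono fun _ => ENNReal.tsum_le_tsum fun _ => h _ _ _

theorem colOne_add_le (X Y : Ker G K) : colOne (X + Y) ≤ colOne X + colOne Y := by
  refine iSup_le fun p => ?_
  refine le_trans ?_ (add_le_add (tsum_enorm_le_colOne X p) (tsum_enorm_le_colOne Y p))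
  rw [← ENNReal.tsum_add]
  exact ENNReal.tsum_le_tsum fun r => enorm_add_le _ _

theorem colOne_smul (c : ℂ) (X : Ker G K) : colOne (c • X) = ‖c‖ₑ * colOne X := by
  simp only [colOne, Pi.smul_apply, smul_eq_mul, enorm_mul, ENNReal.tsum_mul_left, ENNReal.mul_iSup]

theorem colOne_zero : colOne (0 : Ker G K) = 0 := by simp [colOne]

theorem colOne_tsum_le {ι : Type*} (X : ι → Ker G K) :
    colOne (fun l p q => ∑' n, X n l p q) ≤ ∑' n, colOne (X n) := by
  refine iSup_le fun p => ?_
  calc ∑' r : G × K, ‖∑' n, X n r.1 p r.2‖ₑ ≤ ∑' r : G × K, ∑' n, ‖X n r.1 p r.2‖ₑ :=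
        ENNReal.tsum_le_tsum fun r => enorm_tsum_le_tsum_enorm
    _ = ∑' n, ∑' r : G × K, ‖X n r.1 p r.2‖ₑ := ENNReal.tsum_comm
    _ ≤ _ := ENNReal.tsum_le_tsum fun n => tsum_enorm_le_colOne _ p

end Col

theorem tsum_comp_enorm_le (X Y : Ker G K) (l : G) (p q : K) :
    ∑' r : G × K, ‖X (l - r.1) r.2 q * Y r.1 p r.2‖ₑ ≤ colOne X * colOne Y := by
  calc _ ≤ ∑' r : G × K, colOne X * ‖Y r.1 p r.2‖ₑ :=
        ENNReal.tsum_le_tsum fun r => by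
          rw [enorm_mul]
          exact mul_le_mul_left (enorm_le_colOne X _ _ _) _
    _ ≤ _ := by
        rw [ENNReal.tsum_mul_left]
        exact mul_le_mul_right (tsum_enorm_le_colOne Y p) _

theorem summable_comp {X Y : Ker G K} (hX : colOne X ≠ ⊤) (hY : colOne Y ≠ ⊤) (l : G) (p q : K) :
    Summable fun r : G × K => X (l - r.1) r.2 q * Y r.1 p r.2 :=
  summable_of_tsum_enorm
    ((tsum_comp_enorm_le X Y l p q).trans_lt (ENNReal.mul_lt_top hX.lt_top hY.lt_top)).ne

theorem colOne_comp_le (X Y : Ker G K) : colOne (comp X Y) ≤ colOne X * colOne Y := by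
  refine iSup_le fun p => ?_
  calc ∑' r : G × K, ‖comp X Y r.1 p r.2‖ₑ
      ≤ ∑' r : G × K, ∑' t : G × K, ‖X (r.1 - t.1) t.2 r.2‖ₑ * ‖Y t.1 p t.2‖ₑ :=
        ENNReal.tsum_le_tsum fun r => by
          refine enorm_tsum_le_tsum_enorm.trans (le_of_eq ?_)
          exact tsum_congr fun t => enorm_mul _ _
    _ = ∑' t : G × K, (∑' r : G × K, ‖X (r.1 - t.1) t.2 r.2‖ₑ) * ‖Y t.1 p t.2‖ₑ := by
        rw [ENNReal.tsum_comm]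
        exact tsum_congr fun t => ENNReal.tsum_mul_right
    _ ≤ ∑' t : G × K, colOne X * ‖Y t.1 p t.2‖ₑ :=
        ENNReal.tsum_le_tsum fun t => by
          refine mul_le_mul_left ?_ _
          rw [tsum_sub_fst (fun l q => ‖X l t.2 q‖ₑ)]
          exact tsum_enorm_le_colOne X _
    _ ≤ _ := by
        rw [ENNReal.tsum_mul_left]
        exact mul_le_mul_right (tsum_enorm_le_colOne Y p) _

theorem comp_add {X Y Z : Ker G K} (hX : colOne X ≠ ⊤) (hY : colOne Y ≠ ⊤) (hZ : colOne Z ≠ ⊤) :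
    comp X (Y + Z) = comp X Y + comp X Z := by
  funext l p q
  simp only [comp, Pi.add_apply, mul_add]
  exact (summable_comp hX hY l p q).tsum_add (summable_comp hX hZ l p q)

theorem add_comp {X Y Z : Ker G K} (hX : colOne X ≠ ⊤) (hY : colOne Y ≠ ⊤) (hZ : colOne Z ≠ ⊤) :
    comp (X + Y) Z = comp X Z + comp Y Z := by
  funext l p q
  simp only [comp, Pi.add_apply, add_mul]
  exact (summable_comp hX hZ l p q).tsum_add (summable_comp hY hZ l p q)

theorem comp_smul (c : ℂ) (X Y : Ker G K) : comp X (c • Y) = c • comp X Y := by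
  funext l p q
  simp only [comp, Pi.smul_apply, smul_eq_mul, mul_left_comm _ c]
  exact tsum_mul_left

theorem smul_comp (c : ℂ) (X Y : Ker G K) : comp (c • X) Y = c • comp X Y := by
  funext l p q
  simp only [comp, Pi.smul_apply, smul_eq_mul, mul_assoc c]
  exact tsum_mul_left

theorem comp_kone (X : Ker G K) : comp X (kone G K) = X := by
  funext l p q
  rw [comp, tsum_eq_single ((0 : G), p)]
  · simp [kone]
  · rintro ⟨a, b⟩ h
    have : ¬(a = 0 ∧ p = b) := fun h' => h (by rw [h'.1, h'.2])
    simp [kone, this]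

theorem kone_comp (X : Ker G K) : comp (kone G K) X = X := by
  funext l p q
  rw [comp, tsum_eq_single (l, q)]
  · simp [kone]
  · rintro ⟨a, b⟩ h
    have : ¬(l - a = 0 ∧ b = q) := fun h' => h (by rw [h'.2, sub_eq_zero.1 h'.1])
    simp [kone, this]

theorem colOne_kone_le : colOne (kone G K) ≤ 1 := by
  refine iSup_le fun p => ?_
  rw [tsum_eq_single ((0 : G), p)]
  · simp [kone]
  · rintro ⟨a, b⟩ h
    have : ¬(a = 0 ∧ p = b) := fun h' => h (by rw [h'.1, h'.2])
    simp [kone, this]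

theorem comp_assoc {X Y Z : Ker G K} (hX : colOne X ≠ ⊤) (hY : colOne Y ≠ ⊤)
    (hZ : colOne Z ≠ ⊤) : comp (comp X Y) Z = comp X (comp Y Z) := by
  funext l p q
  have h1 : ∀ r : G × K, comp X Y (l - r.1) r.2 q * Z r.1 p r.2 =
      ∑' t : G × K, X (l - t.1) t.2 q * Y (t.1 - r.1) r.2 t.2 * Z r.1 p r.2 := by
    intro r
    rw [comp, ← tsum_mul_right]
    refine (((Equiv.subRight r.1).prodCongr (Equiv.refl K)).tsum_eq _).symm.trans ?_
    refine tsum_congr fun t => ?_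
    simp
  have h2 : ∀ t : G × K, X (l - t.1) t.2 q * comp Y Z t.1 p t.2 =
      ∑' r : G × K, X (l - t.1) t.2 q * Y (t.1 - r.1) r.2 t.2 * Z r.1 p r.2 := by
    intro t
    rw [comp, ← tsum_mul_left]
    exact tsum_congr fun r => by ring
  rw [comp, comp, tsum_congr h1, tsum_congr h2]
  refine Eq.symm (Summable.tsum_comm ?_)
  refine summable_of_tsum_enorm (ne_of_lt ?_)
  rw [ENNReal.tsum_prod' (f := fun x : (G × K) × (G × K) => ‖_‖ₑ)]
  calc _ ≤ ∑' r : G × K, colOne X * colOne Y * ‖Z r.1 p r.2‖ₑ := by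
        refine ENNReal.tsum_le_tsum fun r => ?_
        simp only [Function.uncurry, enorm_mul]
        refine (ENNReal.tsum_mul_right (f := fun t : G × K =>
          ‖X (l - t.1) t.2 q‖ₑ * ‖Y (t.1 - r.1) r.2 t.2‖ₑ)).le.trans (mul_le_mul_left ?_ _)
        calc _ ≤ ∑' t : G × K, colOne X * ‖Y (t.1 - r.1) r.2 t.2‖ₑ :=
              ENNReal.tsum_le_tsum fun t => mul_le_mul_left (enorm_le_colOne X _ _ _) _
          _ ≤ _ := by
              rw [ENNReal.tsum_mul_left, tsum_sub_fst (fun l q => ‖Y l r.2 q‖ₑ)]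
              exact mul_le_mul_right (tsum_enorm_le_colOne Y _) _
    _ < ⊤ := by
        rw [ENNReal.tsum_mul_left]
        exact ENNReal.mul_lt_top (ENNReal.mul_lt_top hX.lt_top hY.lt_top)
          ((tsum_enorm_le_colOne Z p).trans_lt hZ.lt_top)

/-- The submodule of kernels with finite `colOne`. -/
def bddKer (G K : Type*) : Submodule ℂ (Ker G K) where
  carrier := {X | colOne X ≠ ⊤}
  add_mem' {X Y} hX hY := ne_top_of_le_ne_top (ENNReal.add_ne_top.2 ⟨hX, hY⟩) (colOne_add_le X Y)
  zero_mem' := by simp [colOne_zero]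
  smul_mem' c X hX := by
    simp only [Set.mem_ofPred_eq, colOne_smul]
    exact ENNReal.mul_ne_top enorm_ne_top hX

/-- The Banach algebra of kernels with finite `colOne`. -/
def KerAlg (G K : Type*) : Type _ := bddKer G K

namespace KerAlg

instance {G K : Type*} : AddCommGroup (KerAlg G K) := inferInstanceAs (AddCommGroup (bddKer G K))

instance {G K : Type*} : Module ℂ (KerAlg G K) := inferInstanceAs (Module ℂ (bddKer G K))

/-- The kernel of an element of `KerAlg`. -/
def ker {G K : Type*} : KerAlg G K →ₗ[ℂ] Ker G K := (bddKer G K).subtype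

/-- A kernel with finite `colOne` as an element of `KerAlg`. -/
def mk {G K : Type*} (X : Ker G K) (h : colOne X ≠ ⊤) : KerAlg G K := ⟨X, h⟩

section

variable {G K : Type*}

@[simp] theorem ker_mk (X : Ker G K) (h : colOne X ≠ ⊤) : ker (mk X h) = X := rfl

theorem bdd (x : KerAlg G K) : colOne (ker x) ≠ ⊤ := x.2

theorem ker_injective : Function.Injective (ker : KerAlg G K → Ker G K) := Subtype.val_injective

instance : Norm (KerAlg G K) := ⟨fun x => (colOne (ker x)).toReal⟩

theorem norm_def (x : KerAlg G K) : ‖x‖ = (colOne (ker x)).toReal := rfl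

theorem core : NormedSpace.Core ℂ (KerAlg G K) where
  norm_nonneg x := ENNReal.toReal_nonneg
  norm_smul c x := by
    rw [norm_def, norm_def, map_smul, colOne_smul, ENNReal.toReal_mul, toReal_enorm]
  norm_triangle x y := by
    rw [norm_def, norm_def, norm_def, map_add, ← ENNReal.toReal_add x.bdd y.bdd]
    exact ENNReal.toReal_mono (ENNReal.add_ne_top.2 ⟨x.bdd, y.bdd⟩) (colOne_add_le _ _)
  norm_eq_zero_iff x := by
    rw [norm_def, ENNReal.toReal_eq_zero_iff, or_iff_left x.bdd]
    constructor
    · intro h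
      refine ker_injective ?_
      funext l p q
      have := (enorm_le_colOne (ker x) l p q).trans h.le
      simpa using this
    · rintro rfl
      rw [map_zero, colOne_zero]

instance : NormedAddCommGroup (KerAlg G K) := NormedAddCommGroup.ofCore core

instance : NormedSpace ℂ (KerAlg G K) := NormedSpace.ofCore core

theorem ofReal_norm (x : KerAlg G K) : ENNReal.ofReal ‖x‖ = colOne (ker x) :=
  ENNReal.ofReal_toReal x.bdd

theorem norm_ker_le (x : KerAlg G K) (l : G) (p q : K) : ‖ker x l p q‖ ≤ ‖x‖ := by
  rw [norm_def, ← toReal_enorm]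
  exact ENNReal.toReal_mono x.bdd (enorm_le_colOne _ _ _ _)

/-- The matrix element as a continuous linear functional. -/
def entry (l : G) (p q : K) : KerAlg G K →L[ℂ] ℂ :=
  LinearMap.mkContinuous
    { toFun := fun x => ker x l p q
      map_add' := fun x y => by simp
      map_smul' := fun c x => by simp } 1 (fun x => by simpa using norm_ker_le x l p q)

@[simp] theorem entry_apply (l : G) (p q : K) (x : KerAlg G K) : entry l p q x = ker x l p q := rfl

theorem tendsto_sum {u : ℕ → KerAlg G K} (hu : Summable fun n => ‖u n‖) :
    ∃ a, Filter.Tendsto (fun n => ∑ i ∈ Finset.range n, u i) Filter.atTop (nhds a) := by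
  have hs : ∀ k, ∑' n, colOne (ker (u (n + k))) = ENNReal.ofReal (∑' n, ‖u (n + k)‖) := by
    intro k
    rw [ENNReal.ofReal_tsum_of_nonneg (fun _ => norm_nonneg _) ((summable_nat_add_iff k).2 hu)]
    exact tsum_congr fun n => (ofReal_norm _).symm
  have hf : colOne (fun l p q => ∑' n, ker (u n) l p q) ≠ ⊤ := by
    refine ne_top_of_le_ne_top ?_ (colOne_tsum_le _)
    have := hs 0
    simp only [add_zero] at this
    rw [this]
    exact ENNReal.ofReal_ne_top
  have hsum : ∀ l p q, Summable fun n => ker (u n) l p q := fun l p q =>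
    Summable.of_norm_bounded hu fun n => norm_ker_le _ _ _ _
  refine ⟨mk _ hf, ?_⟩
  rw [tendsto_iff_norm_sub_tendsto_zero]
  refine squeeze_zero (fun _ => norm_nonneg _) (fun k => ?_) (tendsto_sum_nat_add fun n => ‖u n‖)
  rw [← ENNReal.ofReal_le_ofReal_iff (tsum_nonneg fun _ => norm_nonneg _), ← hs, ofReal_norm]
  refine le_trans (colOne_mono fun l p q => ?_)
    (colOne_tsum_le fun n => ker (u (n + k)))
  rw [map_sub, map_sum, ker_mk]
  simp only [Pi.sub_apply, Finset.sum_apply]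
  rw [← (hsum l p q).sum_add_tsum_nat_add k, sub_add_cancel_left, enorm_neg]

instance : CompleteSpace (KerAlg G K) :=
  NormedAddCommGroup.completeSpace_of_summable_imp_tendsto fun _ hu => tendsto_sum hu

end

instance : Mul (KerAlg G K) :=
  ⟨fun x y => mk (comp (ker x) (ker y))
    (ne_top_of_le_ne_top (ENNReal.mul_ne_top x.bdd y.bdd) (colOne_comp_le _ _))⟩

instance : One (KerAlg G K) :=
  ⟨mk (kone G K) (ne_top_of_le_ne_top ENNReal.one_ne_top colOne_kone_le)⟩

theorem ker_mul (x y : KerAlg G K) : ker (x * y) = comp (ker x) (ker y) := rfl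

theorem ker_one : ker (1 : KerAlg G K) = kone G K := rfl

instance : Ring (KerAlg G K) :=
  { (inferInstance : AddCommGroup (KerAlg G K)) with
    left_distrib := fun x y z => ker_injective (comp_add x.bdd y.bdd z.bdd)
    right_distrib := fun x y z => ker_injective (add_comp x.bdd y.bdd z.bdd)
    zero_mul := fun x => ker_injective (by funext l p q; simp [ker_mul, comp])
    mul_zero := fun x => ker_injective (by funext l p q; simp [ker_mul, comp])
    mul_assoc := fun x y z => ker_injective (comp_assoc x.bdd y.bdd z.bdd)
    one_mul := fun x => ker_injective (kone_comp _)
    mul_one := fun x => ker_injective (comp_kone _)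
    neg_add_cancel := neg_add_cancel }

instance : NormedRing (KerAlg G K) :=
  { (inferInstance : NormedAddCommGroup (KerAlg G K)), (inferInstance : Ring (KerAlg G K)) with
    norm_mul_le := fun x y => by
      rw [norm_def, norm_def, norm_def, ← ENNReal.toReal_mul]
      exact ENNReal.toReal_mono (ENNReal.mul_ne_top x.bdd y.bdd) (colOne_comp_le _ _) }

instance : Algebra ℂ (KerAlg G K) :=
  Algebra.ofModule (fun c _ _ => ker_injective (smul_comp c _ _))
    (fun c _ _ => ker_injective (comp_smul c _ _))

instance : NormedAlgebra ℂ (KerAlg G K) :=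
  { (inferInstance : Algebra ℂ (KerAlg G K)) with
    norm_smul_le := fun c x => (norm_smul c x).le }

end KerAlg

/-! ### Exponentials and commutators in a Banach algebra -/

section ExpCommutator

variable {A : Type*} [NormedRing A] [NormedAlgebra ℂ A]

/-- The commutator map `x ↦ x u - u x`. -/
def comm (u : A) : A →ₗ[ℂ] A := LinearMap.mulRight ℂ u - LinearMap.mulLeft ℂ u

theorem comm_apply (u x : A) : comm u x = x * u - u * x := rfl

/-- The values at `u ^ n` of the derivation that maps `u` to `g`. -/
def derPow (u g : A) : ℕ → A
  | 0 => 0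
  | n + 1 => g * u ^ n + u * derPow u g n

theorem commute_mulLeft_comm (u : A) : Commute (LinearMap.mulLeft ℂ u) (comm u) := by
  refine LinearMap.ext fun x => ?_
  simp only [Module.End.mul_apply, LinearMap.mulLeft_apply, comm_apply]
  noncomm_ring

theorem mulRight_pow_eq (u : A) (n : ℕ) :
    LinearMap.mulRight ℂ u ^ n = ∑ k ∈ Finset.range (n + 1),
      (n.choose k) • (LinearMap.mulLeft ℂ u ^ (n - k) * comm u ^ k) := by
  have h : LinearMap.mulRight ℂ u = comm u + LinearMap.mulLeft ℂ u := by simp [comm]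
  rw [h, (commute_mulLeft_comm u).symm.add_pow]
  refine Finset.sum_congr rfl fun k _ => ?_
  rw [((commute_mulLeft_comm u).symm.pow_pow k (n - k)).eq, nsmul_eq_mul, Nat.cast_comm]

theorem mul_pow_eq_sum (u x : A) (n : ℕ) :
    x * u ^ n = ∑ k ∈ Finset.range (n + 1), (n.choose k) • (u ^ (n - k) * (comm u ^ k) x) := by
  have := LinearMap.congr_fun (mulRight_pow_eq u n) x
  simpa [LinearMap.pow_mulRight, LinearMap.pow_mulLeft] using this

theorem derPow_eq_sum (u g : A) (n : ℕ) :
    derPow u g (n + 1) = ∑ k ∈ Finset.range (n + 1),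
      ((n + 1).choose (k + 1)) • (u ^ (n - k) * (comm u ^ k) g) := by
  induction n with
  | zero => simp [derPow]
  | succ n ih =>
    rw [derPow, ih, mul_pow_eq_sum]
    simp only [Nat.choose_succ_succ' (n + 1), add_smul, Finset.sum_add_distrib]
    congr 1
    rw [Finset.sum_range_succ _ (n + 1), Nat.choose_succ_self, zero_smul, add_zero, Finset.mul_sum]
    refine Finset.sum_congr rfl fun k hk => ?_
    have : n + 1 - k = (n - k) + 1 := by have := Finset.mem_range.1 hk; omega
    rw [this, pow_succ', mul_smul_comm, mul_assoc]

theorem norm_comm_pow_le (u x : A) (k : ℕ) : ‖(comm u ^ k) x‖ ≤ (2 * ‖u‖) ^ k * ‖x‖ := by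
  induction k with
  | zero => simp
  | succ k ih =>
    rw [pow_succ', Module.End.mul_apply, comm_apply]
    calc _ ≤ ‖(comm u ^ k) x * u‖ + ‖u * (comm u ^ k) x‖ := norm_sub_le _ _
      _ ≤ ‖(comm u ^ k) x‖ * ‖u‖ + ‖u‖ * ‖(comm u ^ k) x‖ :=
          add_le_add (norm_mul_le _ _) (norm_mul_le _ _)
      _ = 2 * ‖u‖ * ‖(comm u ^ k) x‖ := by ring
      _ ≤ 2 * ‖u‖ * ((2 * ‖u‖) ^ k * ‖x‖) := by gcongr
      _ = _ := by ring

theorem summable_norm_comm_pow (u x : A) (c : ℕ) :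
    Summable fun k => ‖(((k + c).factorial : ℂ)⁻¹) • (comm u ^ k) x‖ := by
  refine Summable.of_nonneg_of_le (fun _ => norm_nonneg _) (fun k => ?_)
    ((Real.summable_pow_div_factorial (2 * ‖u‖)).mul_right ‖x‖)
  rw [norm_smul, norm_inv, Complex.norm_natCast, div_mul_eq_mul_div, inv_mul_eq_div]
  have h1 : (0 : ℝ) < k.factorial := by exact_mod_cast k.factorial_pos
  have h2 : (k.factorial : ℝ) ≤ (k + c).factorial := by
    exact_mod_cast Nat.factorial_le (Nat.le_add_right k c)
  exact div_le_div₀ (by positivity) (norm_comm_pow_le u x k) h1 h2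

theorem sum_range_pow_mul_comm (u x : A) (n : ℕ) :
    ∑ k ∈ Finset.range (n + 1), (((k.factorial : ℂ)⁻¹) • u ^ k) *
      ((((n - k).factorial : ℂ)⁻¹) • (comm u ^ (n - k)) x) =
    ((n.factorial : ℂ)⁻¹) • (x * u ^ n) := by
  rw [mul_pow_eq_sum, Finset.smul_sum, ← Finset.sum_range_reflect]
  refine Finset.sum_congr rfl fun k hk => ?_
  have hk : k ≤ n := Nat.lt_succ_iff.1 (Finset.mem_range.1 hk)
  have h : n + 1 - 1 - k = n - k := by omega
  rw [h, Nat.sub_sub_self hk, ← Nat.cast_smul_eq_nsmul ℂ, smul_smul, smul_mul_smul_comm]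
  congr 1
  rw [Nat.cast_choose ℂ hk]
  have h1 : (n.factorial : ℂ) ≠ 0 := by exact_mod_cast n.factorial_ne_zero
  field_simp

theorem sum_range_pow_mul_comm_succ (u g : A) (n : ℕ) :
    ∑ k ∈ Finset.range (n + 1), (((k.factorial : ℂ)⁻¹) • u ^ k) *
      ((((n - k + 1).factorial : ℂ)⁻¹) • (comm u ^ (n - k)) g) =
    (((n + 1).factorial : ℂ)⁻¹) • derPow u g (n + 1) := by
  rw [derPow_eq_sum, Finset.smul_sum, ← Finset.sum_range_reflect]
  refine Finset.sum_congr rfl fun k hk => ?_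
  have hk : k ≤ n := Nat.lt_succ_iff.1 (Finset.mem_range.1 hk)
  have h : n + 1 - 1 - k = n - k := by omega
  rw [h, Nat.sub_sub_self hk, ← Nat.cast_smul_eq_nsmul ℂ, smul_smul, smul_mul_smul_comm]
  congr 1
  rw [Nat.cast_choose ℂ (Nat.succ_le_succ hk), Nat.succ_sub_succ]
  have h1 : ((n + 1).factorial : ℂ) ≠ 0 := by exact_mod_cast (n + 1).factorial_ne_zero
  field_simp

variable [CompleteSpace A]

theorem summable_exp (u : A) : Summable fun n => ((n.factorial : ℂ)⁻¹) • u ^ n :=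
  (NormedSpace.norm_expSeries_summable' (𝕂 := ℂ) u).of_norm

theorem exp_mul_tsum_comm (u x : A) :
    (∑' n : ℕ, ((n.factorial : ℂ)⁻¹) • u ^ n) * ∑' k : ℕ, ((k.factorial : ℂ)⁻¹) • (comm u ^ k) x =
      x * ∑' n : ℕ, ((n.factorial : ℂ)⁻¹) • u ^ n := by
  have he := NormedSpace.norm_expSeries_summable' (𝕂 := ℂ) u
  have hg := summable_norm_comm_pow u x 0
  simp only [add_zero] at hg
  rw [tsum_mul_tsum_eq_tsum_sum_range_of_summable_norm he hg, ← (summable_exp u).tsum_mul_left]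
  refine tsum_congr fun n => ?_
  rw [sum_range_pow_mul_comm, mul_smul_comm]

theorem summable_derPow (u g : A) : Summable fun n => ((n.factorial : ℂ)⁻¹) • derPow u g n := by
  rw [← summable_nat_add_iff 1]
  simp only [← sum_range_pow_mul_comm_succ]
  exact (summable_norm_sum_mul_range_of_summable_norm
    (NormedSpace.norm_expSeries_summable' (𝕂 := ℂ) u) (summable_norm_comm_pow u g 1)).of_norm

theorem exp_mul_tsum_comm_succ (u g : A) :
    (∑' n : ℕ, ((n.factorial : ℂ)⁻¹) • u ^ n) *
        ∑' k : ℕ, (((k + 1).factorial : ℂ)⁻¹) • (comm u ^ k) g =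
      ∑' n : ℕ, ((n.factorial : ℂ)⁻¹) • derPow u g n := by
  rw [(summable_derPow u g).tsum_eq_zero_add, tsum_mul_tsum_eq_tsum_sum_range_of_summable_norm
    (NormedSpace.norm_expSeries_summable' (𝕂 := ℂ) u) (summable_norm_comm_pow u g 1)]
  simp only [derPow.eq_1, smul_zero, zero_add]
  exact tsum_congr fun n => sum_range_pow_mul_comm_succ u g n

end ExpCommutator

/-! ### The derivation given by an unbounded band matrix and a frequency -/

section Derivation

variable {G K : Type*} [AddCommGroup G] (sh : K → Finset K) (H : K → K → ℂ) (φ : G →+ ℂ)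

/-- The composition `H X` with a constant matrix `H`. -/
def lact (X : Ker G K) : Ker G K := fun l p q => ∑ r ∈ sh q, H r q * X l p r

/-- The composition `X H` with a constant matrix `H`. -/
def ract (X : Ker G K) : Ker G K := fun l p q => ∑ r ∈ sh p, X l r q * H p r

/-- Multiplication of the Fourier coefficients by an additive function. -/
def fmul (X : Ker G K) : Ker G K := fun l p q => φ l * X l p q

/-- `X ↦ H X - X H - i ω·∂ X`. -/
def der (X : Ker G K) : Ker G K := lact sh H X - ract sh H X + fmul φ X

/-- The constant kernel with matrix `H`. -/
def constKer (G : Type*) [AddCommGroup G] {K : Type*} (H : K → K → ℂ) : Ker G K := by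
  classical exact fun l p q => if l = 0 then H p q else 0

variable {sh H}

theorem hasSum_constKer_comp (hH : ∀ p q, p ∉ sh q → H p q = 0) (X : Ker G K) (l : G) (p q : K) :
    HasSum (fun r : G × K => constKer G H (l - r.1) r.2 q * X r.1 p r.2) (lact sh H X l p q) := by
  classical
  have := hasSum_sum_of_ne_finset_zero (L := .unconditional _) (f := fun r : G × K =>
    constKer G H (l - r.1) r.2 q * X r.1 p r.2) (s := ({l} : Finset G) ×ˢ sh q) ?_
  · simpa [Finset.sum_product, constKer, lact] using this
  · rintro ⟨a, b⟩ h
    simp only [Finset.mem_product, Finset.mem_singleton, not_and] at h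
    by_cases ha : a = l
    · simp [constKer, hH b q (h ha)]
    · have : l - a ≠ 0 := fun h => ha (sub_eq_zero.1 h).symm
      simp [constKer, this]

theorem hasSum_comp_constKer (hH : ∀ p q, q ∉ sh p → H p q = 0) (X : Ker G K) (l : G) (p q : K) :
    HasSum (fun r : G × K => X (l - r.1) r.2 q * constKer G H r.1 p r.2) (ract sh H X l p q) := by
  classical
  have := hasSum_sum_of_ne_finset_zero (L := .unconditional _) (f := fun r : G × K =>
    X (l - r.1) r.2 q * constKer G H r.1 p r.2) (s := ({0} : Finset G) ×ˢ sh p) ?_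
  · simpa [Finset.sum_product, constKer, ract] using this
  · rintro ⟨a, b⟩ h
    simp only [Finset.mem_product, Finset.mem_singleton, not_and] at h
    by_cases ha : a = 0
    · simp [constKer, hH p b (h ha)]
    · simp [constKer, ha]

theorem lact_comp {X Y : Ker G K} (hX : colOne X ≠ ⊤) (hY : colOne Y ≠ ⊤) :
    lact sh H (comp X Y) = comp (lact sh H X) Y := by
  funext l p q
  simp only [lact, comp, Finset.sum_mul, mul_assoc, ← tsum_mul_left]
  exact (Summable.tsum_finsetSum fun r _ => (summable_comp hX hY l p r).mul_left _).symm

theorem ract_comp {X Y : Ker G K} (hX : colOne X ≠ ⊤) (hY : colOne Y ≠ ⊤) :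
    ract sh H (comp X Y) = comp X (ract sh H Y) := by
  funext l p q
  simp only [ract, comp, Finset.mul_sum, ← mul_assoc, ← tsum_mul_right]
  exact (Summable.tsum_finsetSum fun r _ => (summable_comp hX hY l r q).mul_right _).symm

theorem ract_comp_eq_comp_lact (hH : ∀ p q, q ∉ sh p → H p q = 0)
    (hsh : ∀ p q, p ∈ sh q ↔ q ∈ sh p) (hcard : ∀ p, (sh p).card ≤ 2)
    {X Y : Ker G K} {c : ℝ≥0∞} (hc : c ≠ ⊤) (hX : ∀ l p q r, ‖X l r q * H p r‖ₑ ≤ c)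
    (hY : colOne Y ≠ ⊤) : comp (ract sh H X) Y = comp X (lact sh H Y) := by
  funext l p q
  set F : (G × K) × K → ℂ := fun x => X (l - x.1.1) x.2 q * H x.1.2 x.2 * Y x.1.1 p x.1.2
  have hF : Summable F := by
    refine summable_of_tsum_enorm (ne_of_lt ?_)
    rw [ENNReal.tsum_prod' (f := fun x => ‖F x‖ₑ)]
    calc _ ≤ ∑' r : G × K, 2 * c * ‖Y r.1 p r.2‖ₑ := by
          refine ENNReal.tsum_le_tsum fun r => ?_
          rw [tsum_eq_sum (s := sh r.2) fun b hb => by simp [F, hH _ _ hb]]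
          calc _ ≤ ∑ b ∈ sh r.2, c * ‖Y r.1 p r.2‖ₑ := by
                refine Finset.sum_le_sum fun b _ => ?_
                simp only [F]
                rw [enorm_mul]
                exact mul_le_mul_left (hX _ _ _ _) _
            _ ≤ _ := by
                rw [Finset.sum_const, nsmul_eq_mul, mul_assoc]
                exact mul_le_mul_left (by exact_mod_cast hcard _) _
      _ < ⊤ := by
          rw [ENNReal.tsum_mul_left]
          exact ENNReal.mul_lt_top (ENNReal.mul_lt_top (by simp) hc.lt_top)
            ((tsum_enorm_le_colOne Y p).trans_lt hY.lt_top)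
  let e : (G × K) × K ≃ (G × K) × K :=
    { toFun := fun x => ((x.1.1, x.2), x.1.2)
      invFun := fun x => ((x.1.1, x.2), x.1.2)
      left_inv := fun _ => rfl
      right_inv := fun _ => rfl }
  have h1 : comp (ract sh H X) Y l p q = ∑' x, F x := by
    rw [hF.tsum_prod]
    refine tsum_congr fun r => ?_
    rw [tsum_eq_sum (s := sh r.2) fun b hb => by simp [F, hH _ _ hb], ract, Finset.sum_mul]
  have h2 : comp X (lact sh H Y) l p q = ∑' x, F (e x) := by
    change _ = ∑' x, (F ∘ e) x
    rw [((e.summable_iff (f := F)).2 hF).tsum_prod]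
    refine tsum_congr fun r => ?_
    rw [tsum_eq_sum (s := sh r.2) fun b hb => by
      simp [F, e, hH b r.2 fun h => hb ((hsh _ _).2 h)], lact, Finset.mul_sum]
    exact Finset.sum_congr rfl fun b _ => by simp only [F, e, Equiv.coe_fn_mk, Function.comp_apply]; ring
  rw [h1, h2, e.tsum_eq]

theorem fmul_comp {X Y : Ker G K} (hX : colOne X ≠ ⊤) (hY : colOne Y ≠ ⊤)
    (hfX : colOne (fmul φ X) ≠ ⊤) :
    fmul φ (comp X Y) = comp (fmul φ X) Y + comp X (fmul φ Y) := by
  funext l p q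
  have h1 := (summable_comp hX hY l p q).mul_left (φ l)
  have h2 := summable_comp hfX hY l p q
  have h3 : ∀ r : G × K, X (l - r.1) r.2 q * fmul φ Y r.1 p r.2 =
      φ l * (X (l - r.1) r.2 q * Y r.1 p r.2) - fmul φ X (l - r.1) r.2 q * Y r.1 p r.2 := by
    intro r
    simp only [fmul, map_sub]
    ring
  simp only [Pi.add_apply]
  rw [comp, comp, tsum_congr h3, h1.tsum_sub h2, tsum_mul_left]
  simp [fmul, comp]

theorem sub_comp {X Y Z : Ker G K} (hX : colOne X ≠ ⊤) (hY : colOne Y ≠ ⊤) (hZ : colOne Z ≠ ⊤) :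
    comp (X - Y) Z = comp X Z - comp Y Z := by
  funext l p q
  simp only [comp, Pi.sub_apply, sub_mul]
  exact (summable_comp hX hZ l p q).tsum_sub (summable_comp hY hZ l p q)

theorem colOne_sub_le {G K : Type*} (X Y : Ker G K) : colOne (X - Y) ≤ colOne X + colOne Y := by
  have h : colOne (-Y) = colOne Y := by simp [colOne]
  rw [sub_eq_add_neg, ← h]
  exact colOne_add_le _ _

/-- The conditions under which `der` satisfies the Leibniz rule at `X`. -/
structure DerDomain (sh : K → Finset K) (H : K → K → ℂ) (φ : G →+ ℂ) (X : Ker G K) : Prop where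
  bdd : colOne X ≠ ⊤
  lact : colOne (lact sh H X) ≠ ⊤
  ract : colOne (ract sh H X) ≠ ⊤
  fmul : colOne (fmul φ X) ≠ ⊤
  band : ∃ c : ℝ≥0∞, c ≠ ⊤ ∧ ∀ l p q r, ‖X l r q * H p r‖ₑ ≤ c

variable {φ}

theorem der_comp (hH : ∀ p q, q ∉ sh p → H p q = 0)
    (hsh : ∀ p q, p ∈ sh q ↔ q ∈ sh p) (hcard : ∀ p, (sh p).card ≤ 2) {X Y : Ker G K}
    (hX : DerDomain sh H φ X) (hY : colOne Y ≠ ⊤) (hlY : colOne (lact sh H Y) ≠ ⊤)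
    (hdY : colOne (der sh H φ Y) ≠ ⊤) :
    der sh H φ (comp X Y) = comp (der sh H φ X) Y + comp X (der sh H φ Y) := by
  obtain ⟨c, hc, hXc⟩ := hX.band
  have h1 := lact_comp (sh := sh) (H := H) hX.bdd hY
  have h2 := ract_comp (sh := sh) (H := H) hX.bdd hY
  have h3 := fmul_comp φ hX.bdd hY hX.fmul
  have h4 := ract_comp_eq_comp_lact hH hsh hcard hc hXc hY
  have hsub : colOne (lact sh H X - ract sh H X) ≠ ⊤ :=
    ne_top_of_le_ne_top (ENNReal.add_ne_top.2 ⟨hX.lact, hX.ract⟩) (colOne_sub_le _ _)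
  have h5 : comp (der sh H φ X) Y =
      comp (lact sh H X) Y - comp (ract sh H X) Y + comp (fmul φ X) Y := by
    rw [der, add_comp hsub hX.fmul hY, sub_comp hX.lact hX.ract hY]
  have h6 : comp X (der sh H φ Y) =
      comp X (lact sh H Y) - comp X (ract sh H Y) + comp X (fmul φ Y) := by
    funext l p q
    have s1 := summable_comp hX.bdd hlY l p q
    have s2 : Summable fun r : G × K => X (l - r.1) r.2 q * ract sh H Y r.1 p r.2 := by
      simp only [ract, Finset.mul_sum, ← mul_assoc]
      exact summable_sum fun r _ => (summable_comp hX.bdd hY l r q).mul_right _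
    have s3 := summable_comp hX.bdd hdY l p q
    simp only [Pi.add_apply, Pi.sub_apply, comp]
    have : ∀ r : G × K, X (l - r.1) r.2 q * fmul φ Y r.1 p r.2 =
        X (l - r.1) r.2 q * der sh H φ Y r.1 p r.2 - X (l - r.1) r.2 q * lact sh H Y r.1 p r.2
          + X (l - r.1) r.2 q * ract sh H Y r.1 p r.2 := by
      intro r
      simp only [der, Pi.add_apply, Pi.sub_apply]
      ring
    rw [tsum_congr this, (s3.sub s1).tsum_add s2, s3.tsum_sub s1]
    ring
  rw [h5, h6, der, h1, h2, h3, h4]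
  abel

theorem der_kone (hH : ∀ p q, q ∉ sh p → H p q = 0) (hsh : ∀ p q, p ∈ sh q ↔ q ∈ sh p) :
    der sh H φ (kone G K) = 0 := by
  classical
  have h1 : lact sh H (kone G K) = constKer G H := by
    rw [← comp_kone (lact sh H (kone G K))]
    funext l p q
    by_cases hl : l = 0 <;> simp [comp_kone, lact, kone, constKer, hl]
    intro h
    exact (hH _ _ fun h' => h ((hsh _ _).2 h')).symm
  have h2 : ract sh H (kone G K) = constKer G H := by
    funext l p q
    by_cases hl : l = 0 <;> simp [ract, kone, constKer, hl]
    intro h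
    exact (hH _ _ h).symm
  have h3 : fmul φ (kone G K) = 0 := by
    funext l p q
    by_cases hl : l = 0 <;> simp [fmul, kone, hl]
  rw [der, h1, h2, h3]
  simp

theorem der_pow (hH : ∀ p q, q ∉ sh p → H p q = 0)
    (hsh : ∀ p q, p ∈ sh q ↔ q ∈ sh p) (hcard : ∀ p, (sh p).card ≤ 2) {u g : KerAlg G K}
    (hu : DerDomain sh H φ (KerAlg.ker u)) (hg : der sh H φ (KerAlg.ker u) = KerAlg.ker g) (n : ℕ) :
    der sh H φ (KerAlg.ker (u ^ n)) = KerAlg.ker (derPow u g n) := by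
  have key : ∀ n : ℕ, colOne (lact sh H (KerAlg.ker (u ^ (n + 1)))) ≠ ⊤ ∧
      der sh H φ (KerAlg.ker (u ^ (n + 1))) = KerAlg.ker (derPow u g (n + 1)) := by
    intro n
    induction n with
    | zero => simpa [derPow, hg] using hu.lact
    | succ n ih =>
      rw [pow_succ' u (n + 1), KerAlg.ker_mul]
      refine ⟨?_, ?_⟩
      · rw [lact_comp hu.bdd (KerAlg.bdd _)]
        exact ne_top_of_le_ne_top (ENNReal.mul_ne_top hu.lact (KerAlg.bdd _)) (colOne_comp_le _ _)
      · rw [der_comp hH hsh hcard hu (KerAlg.bdd _) ih.1 (by rw [ih.2]; exact KerAlg.bdd _), ih.2,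
          hg, show derPow u g (n + 1 + 1) = g * u ^ (n + 1) + u * derPow u g (n + 1) from rfl, map_add, KerAlg.ker_mul, KerAlg.ker_mul]
  cases n with
  | zero => simp [KerAlg.ker_one, der_kone hH hsh, derPow]
  | succ n => exact (key n).2

theorem der_exp (hH : ∀ p q, q ∉ sh p → H p q = 0)
    (hsh : ∀ p q, p ∈ sh q ↔ q ∈ sh p) (hcard : ∀ p, (sh p).card ≤ 2) {u g : KerAlg G K}
    (hu : DerDomain sh H φ (KerAlg.ker u)) (hg : der sh H φ (KerAlg.ker u) = KerAlg.ker g) :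
    der sh H φ (KerAlg.ker (∑' n : ℕ, ((n.factorial : ℂ)⁻¹) • u ^ n)) =
      KerAlg.ker (∑' n : ℕ, ((n.factorial : ℂ)⁻¹) • derPow u g n) := by
  have hx : ∀ l p q, HasSum (fun n : ℕ => ((n.factorial : ℂ)⁻¹) * KerAlg.ker (u ^ n) l p q)
      (KerAlg.ker (∑' n : ℕ, ((n.factorial : ℂ)⁻¹) • u ^ n) l p q) := fun l p q =>
    (summable_exp u).hasSum.mapL (KerAlg.entry l p q)
  have hy : ∀ l p q, HasSum (fun n : ℕ => ((n.factorial : ℂ)⁻¹) * KerAlg.ker (derPow u g n) l p q)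
      (KerAlg.ker (∑' n : ℕ, ((n.factorial : ℂ)⁻¹) • derPow u g n) l p q) := fun l p q =>
    (summable_derPow u g).hasSum.mapL (KerAlg.entry l p q)
  funext l p q
  refine HasSum.unique ?_ (hy l p q)
  have h := ((hasSum_sum fun r (_ : r ∈ sh q) => (hx l p r).mul_left (H r q)).sub
    (hasSum_sum fun r (_ : r ∈ sh p) => (hx l r q).mul_right (H p r))).add
    ((hx l p q).mul_left (φ l))
  refine (congrArg (fun f : ℕ → ℂ => HasSum f _) (funext fun n => ?_)).mpr h
  rw [← der_pow hH hsh hcard hu hg n]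
  simp only [der, lact, ract, fmul, Pi.add_apply, Pi.sub_apply, mul_add, mul_sub, Finset.mul_sum]
  congr 1
  · congr 1 <;> exact Finset.sum_congr rfl fun r _ => by ring
  · ring

end Derivation

/-! ### The conjugated operator as a Lie series -/

section Remainder

variable {G K : Type*} [AddCommGroup G]

/-- The commutator `X u - u X`. -/
def commKer (u X : Ker G K) : Ker G K := comp X u - comp u X

theorem ker_comm_pow (u x : KerAlg G K) (k : ℕ) :
    KerAlg.ker ((comm u ^ k) x) = (commKer (KerAlg.ker u))^[k] (KerAlg.ker x) := by
  induction k with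
  | zero => rfl
  | succ k ih =>
    rw [pow_succ', Module.End.mul_apply, comm_apply, map_sub, KerAlg.ker_mul, KerAlg.ker_mul, ih,
      Function.iterate_succ_apply']
    rfl

/-- The part of the conjugated operator that is at least quadratic. -/
def lieRemainder (u P g : Ker G K) : Ker G K := fun l p q =>
  ∑' k : ℕ, ((((k + 1).factorial : ℂ)⁻¹) * (commKer u)^[k + 1] P l p q +
    (((k + 2).factorial : ℂ)⁻¹) * (commKer u)^[k + 1] g l p q)

theorem exists_ker_lieRemainder (u P g : KerAlg G K) :
    ∃ Q : KerAlg G K, KerAlg.ker Q = lieRemainder (KerAlg.ker u) (KerAlg.ker P) (KerAlg.ker g) ∧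
      P + g + Q = ∑' k : ℕ, ((k.factorial : ℂ)⁻¹) • (comm u ^ k) P +
        ∑' k : ℕ, (((k + 1).factorial : ℂ)⁻¹) • (comm u ^ k) g := by
  have h0 := (summable_norm_comm_pow u P 0).of_norm
  have h1 := (summable_norm_comm_pow u g 1).of_norm
  simp only [add_zero] at h0
  have h0' := (summable_nat_add_iff 1).2 h0
  have h1' := (summable_nat_add_iff 1).2 h1
  refine ⟨∑' k : ℕ, (((k + 1).factorial : ℂ)⁻¹) • (comm u ^ (k + 1)) P +
    ∑' k : ℕ, (((k + 1 + 1).factorial : ℂ)⁻¹) • (comm u ^ (k + 1)) g, ?_, ?_⟩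
  rotate_left
  · rw [h0.tsum_eq_zero_add, h1.tsum_eq_zero_add]
    simp only [Nat.factorial_zero, pow_zero, Module.End.one_apply, zero_add, Nat.factorial_one,
      Nat.cast_one, inv_one, one_smul]
    rw [add_add_add_comm]
  · funext l p q
    rw [← h0'.tsum_add h1']
    refine ((h0'.add h1').hasSum.mapL (KerAlg.entry l p q)).tsum_eq.symm.trans ?_
    refine tsum_congr fun k => ?_
    rw [← ker_comm_pow, ← ker_comm_pow]
    simp

theorem exp_conjugation {sh : K → Finset K} {H : K → K → ℂ} {φ : G →+ ℂ}
    (hH : ∀ p q, q ∉ sh p → H p q = 0)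
    (hsh : ∀ p q, p ∈ sh q ↔ q ∈ sh p) (hcard : ∀ p, (sh p).card ≤ 2) {u P g : KerAlg G K}
    (hu : DerDomain sh H φ (KerAlg.ker u)) (hg : der sh H φ (KerAlg.ker u) = KerAlg.ker g) :
    ∃ Q Φ : KerAlg G K,
      KerAlg.ker Q = lieRemainder (KerAlg.ker u) (KerAlg.ker P) (KerAlg.ker g) ∧
      (∀ l p q, HasSum (fun n : ℕ => ((n.factorial : ℂ)⁻¹) * KerAlg.ker (u ^ n) l p q)
        (KerAlg.ker Φ l p q)) ∧
      der sh H φ (KerAlg.ker Φ) + KerAlg.ker (P * Φ) = KerAlg.ker (Φ * (P + g + Q)) := by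
  obtain ⟨Q, hQ, hQ'⟩ := exists_ker_lieRemainder u P g
  refine ⟨Q, ∑' n : ℕ, ((n.factorial : ℂ)⁻¹) • u ^ n, hQ,
    fun l p q => (summable_exp u).hasSum.mapL (KerAlg.entry l p q), ?_⟩
  rw [der_exp hH hsh hcard hu hg, hQ', mul_add, exp_mul_tsum_comm, exp_mul_tsum_comm_succ, map_add,
    add_comm]

end Remainder

/-! ### Conjugation of operator matrices -/

/-- The indices of the block of `p`. -/
def shellOf (p : Bool × ℤ) : Finset (Bool × ℤ) := {p, (p.1, -p.2)}

theorem mem_shellOf {p q : Bool × ℤ} : p ∈ shellOf q ↔ p.1 = q.1 ∧ p.2.natAbs = q.2.natAbs := by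
  obtain ⟨a, j⟩ := p
  obtain ⟨b, k⟩ := q
  simp only [shellOf, Finset.mem_insert, Finset.mem_singleton, Prod.mk.injEq,
    Int.natAbs_eq_natAbs_iff]
  tauto

theorem mem_shellOf_comm (p q : Bool × ℤ) : p ∈ shellOf q ↔ q ∈ shellOf p := by
  rw [mem_shellOf, mem_shellOf, eq_comm, @eq_comm ℕ]

theorem card_shellOf_le (p : Bool × ℤ) : (shellOf p).card ≤ 2 := Finset.card_le_two

/-- `ℓ ↦ ω · ℓ` as an additive map. -/
def dotHom {d : ℕ} (ω : Freq d) : (Fin d → ℤ) →+ ℂ where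
  toFun l := (dotZ ω l : ℂ)
  map_zero' := by simp [dotZ]
  map_add' x y := by simp [dotZ, mul_add, Finset.sum_add_distrib]

theorem fullOne_eq_kone (d : ℕ) : fullOne d = kone (Fin d → ℤ) (Bool × ℤ) := by
  funext l p q
  simp only [fullOne, kone]
  congr

theorem conjugates_of_der {d : ℕ} {ω : Freq d} {U H Hp : BlockOp d} {h : Bool × ℤ → Bool × ℤ → ℂ}
    {P g : FullOp d} (hh : ∀ p q, q ∉ shellOf p → h p q = 0)
    (hU : DerDomain shellOf h (dotHom ω) (full U)) (hP : colOne P ≠ ⊤) (hg : colOne g ≠ ⊤)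
    (hder : der shellOf h (dotHom ω) (full U) = Complex.I • g)
    (hH : full H = constKer (Fin d → ℤ) h + P)
    (hHp : full Hp = constKer (Fin d → ℤ) h +
      (P + g + lieRemainder ((-Complex.I) • full U) P g)) :
    Conjugates ω U H Hp := by
  let V : KerAlg (Fin d → ℤ) (Bool × ℤ) := KerAlg.mk (full U) hU.bdd
  let u : KerAlg (Fin d → ℤ) (Bool × ℤ) := (-Complex.I) • V
  have hl : lact shellOf h (KerAlg.ker u) = (-Complex.I) • lact shellOf h (full U) := by
    funext l p q
    simp only [u, V, lact, map_smul, KerAlg.ker_mk, Pi.smul_apply, smul_eq_mul, Finset.mul_sum]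
    exact Finset.sum_congr rfl fun r _ => by ring
  have hr : ract shellOf h (KerAlg.ker u) = (-Complex.I) • ract shellOf h (full U) := by
    funext l p q
    simp only [u, V, ract, map_smul, KerAlg.ker_mk, Pi.smul_apply, smul_eq_mul, Finset.mul_sum]
    exact Finset.sum_congr rfl fun r _ => by ring
  have hf : fmul (dotHom ω) (KerAlg.ker u) = (-Complex.I) • fmul (dotHom ω) (full U) := by
    funext l p q
    simp only [u, V, fmul, map_smul, KerAlg.ker_mk, Pi.smul_apply, smul_eq_mul]
    ring
  have hdu : DerDomain shellOf h (dotHom ω) (KerAlg.ker u) := by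
    refine ⟨u.bdd, ?_, ?_, ?_, ?_⟩
    · rw [hl, colOne_smul]; exact ENNReal.mul_ne_top enorm_ne_top hU.lact
    · rw [hr, colOne_smul]; exact ENNReal.mul_ne_top enorm_ne_top hU.ract
    · rw [hf, colOne_smul]; exact ENNReal.mul_ne_top enorm_ne_top hU.fmul
    · obtain ⟨c, hc, h⟩ := hU.band
      refine ⟨c, hc, fun l p q r => ?_⟩
      have := h l p q r
      simpa [u, V, enorm_eq_nnnorm] using this
  have hdg : der shellOf h (dotHom ω) (KerAlg.ker u) = KerAlg.ker (KerAlg.mk g hg) := by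
    rw [KerAlg.ker_mk, der, hl, hr, hf, ← smul_sub, ← smul_add]
    change (-Complex.I) • der shellOf h (dotHom ω) (full U) = g
    rw [hder, smul_smul]
    simp
  obtain ⟨Q, Φ, hQ, hΦ, hid⟩ := exp_conjugation hh mem_shellOf_comm card_shellOf_le
    (P := KerAlg.mk P hP) hdu hdg
  refine ⟨KerAlg.ker Φ, lact shellOf h (KerAlg.ker Φ) + comp P (KerAlg.ker Φ),
    ract shellOf h (KerAlg.ker Φ) + KerAlg.ker (Φ * (KerAlg.mk P hP + KerAlg.mk g hg + Q)),
    ⟨fun n => KerAlg.ker (V ^ n), ?_, ?_, ?_⟩, ?_, ?_, ?_⟩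
  · rw [fullOne_eq_kone]; rfl
  · intro n l p q
    dsimp only
    rw [pow_succ']
    exact (summable_comp V.bdd (KerAlg.bdd (V ^ n)) l p q).hasSum
  · intro l p q
    refine (congrArg (fun f : ℕ → ℂ => HasSum f _) (funext fun n => ?_)).mpr (hΦ l p q)
    simp only [u, smul_pow, map_smul, Pi.smul_apply, smul_eq_mul]
    ring
  · intro l p q
    rw [hH]
    simp only [Pi.add_apply, add_mul]
    exact (hasSum_constKer_comp (fun p q h => hh p q fun h' => h ((mem_shellOf_comm _ _).1 h'))
      _ l p q).add (summable_comp hP Φ.bdd l p q).hasSum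
  · intro l p q
    have : P + g + lieRemainder ((-Complex.I) • full U) P g =
        KerAlg.ker (KerAlg.mk P hP + KerAlg.mk g hg + Q) := by
      rw [map_add, map_add, hQ]; rfl
    rw [hHp, this]
    generalize KerAlg.mk P hP + KerAlg.mk g hg + Q = S
    simp only [Pi.add_apply, mul_add]
    exact (hasSum_comp_constKer hh _ l p q).add (summable_comp Φ.bdd (KerAlg.bdd _) l p q).hasSum
  · intro l p q
    have := congrFun (congrFun (congrFun hid l) p) q
    rw [Pi.add_apply, Pi.add_apply, Pi.add_apply, Pi.add_apply, Pi.add_apply, Pi.add_apply, ← this]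
    simp only [der, fmul, Pi.add_apply, Pi.sub_apply, KerAlg.ker_mul, KerAlg.ker_mk]
    simp only [dotHom, AddMonoidHom.coe_mk, ZeroHom.coe_mk]
    ring

/-! ### Weighted column norms -/

section ColN

variable {G K : Type*}

/-- The supremum over the columns of the weighted `ℓ²` norm. -/
def colN (W : G → K → K → ℝ≥0∞) (X : Ker G K) : ℝ≥0∞ :=
  ⨆ p, l2 fun r : G × K => W r.1 p r.2 * ‖X r.1 p r.2‖ₑ

theorem l2_le_colN (W : G → K → K → ℝ≥0∞) (X : Ker G K) (p : K) :
    l2 (fun r : G × K => W r.1 p r.2 * ‖X r.1 p r.2‖ₑ) ≤ colN W X :=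
  le_iSup (fun p => l2 fun r : G × K => W r.1 p r.2 * ‖X r.1 p r.2‖ₑ) p

theorem weight_mul_enorm_le_colN (W : G → K → K → ℝ≥0∞) (X : Ker G K) (l : G) (p q : K) :
    W l p q * ‖X l p q‖ₑ ≤ colN W X :=
  (le_l2 (fun r : G × K => W r.1 p r.2 * ‖X r.1 p r.2‖ₑ) (l, q)).trans (l2_le_colN W X p)

theorem colN_mono {W W' : G → K → K → ℝ≥0∞} {X Y : Ker G K}
    (h : ∀ l p q, W l p q * ‖X l p q‖ₑ ≤ W' l p q * ‖Y l p q‖ₑ) : colN W X ≤ colN W' Y :=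
  iSup_mono fun _ => l2_mono fun _ => h _ _ _

theorem colN_le_mul {W W' : G → K → K → ℝ≥0∞} {X Y : Ker G K} {c : ℝ≥0∞}
    (h : ∀ l p q, W l p q * ‖X l p q‖ₑ ≤ c * (W' l p q * ‖Y l p q‖ₑ)) :
    colN W X ≤ c * colN W' Y := by
  refine iSup_le fun p => ?_
  refine (l2_mono fun r : G × K => h r.1 p r.2).trans ?_
  rw [l2_const_mul]
  exact mul_le_mul_right (l2_le_colN W' Y p) c

theorem colN_le_add {W W₁ W₂ : G → K → K → ℝ≥0∞} {X Y Z : Ker G K}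
    (h : ∀ l p q, W l p q * ‖X l p q‖ₑ ≤ W₁ l p q * ‖Y l p q‖ₑ + W₂ l p q * ‖Z l p q‖ₑ) :
    colN W X ≤ colN W₁ Y + colN W₂ Z := by
  refine iSup_le fun p => ?_
  refine (l2_mono fun r : G × K => h r.1 p r.2).trans ((l2_add_le _ _).trans ?_)
  exact add_le_add (l2_le_colN _ _ p) (l2_le_colN _ _ p)

theorem colN_add_le (W : G → K → K → ℝ≥0∞) (X Y : Ker G K) :
    colN W (X + Y) ≤ colN W X + colN W Y :=
  colN_le_add fun l p q => by
    rw [← mul_add]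
    exact mul_le_mul_right (enorm_add_le _ _) _

theorem colN_neg (W : G → K → K → ℝ≥0∞) (X : Ker G K) : colN W (-X) = colN W X := by simp [colN]

theorem colN_sub_le (W : G → K → K → ℝ≥0∞) (X Y : Ker G K) :
    colN W (X - Y) ≤ colN W X + colN W Y := by
  rw [sub_eq_add_neg, ← colN_neg W Y]
  exact colN_add_le W _ _

theorem colN_smul (W : G → K → K → ℝ≥0∞) (c : ℂ) (X : Ker G K) :
    colN W (c • X) = ‖c‖ₑ * colN W X := by
  simp only [colN, Pi.smul_apply, smul_eq_mul, enorm_mul, mul_left_comm _ ‖c‖ₑ, l2_const_mul,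
    ENNReal.mul_iSup]

theorem colN_tsum_le {ι : Type*} (W : G → K → K → ℝ≥0∞) (X : ι → Ker G K) :
    colN W (fun l p q => ∑' n, X n l p q) ≤ ∑' n, colN W (X n) := by
  refine iSup_le fun p => ?_
  calc _ ≤ l2 fun r : G × K => ∑' n, W r.1 p r.2 * ‖X n r.1 p r.2‖ₑ :=
        l2_mono fun r => by
          rw [ENNReal.tsum_mul_left]
          exact mul_le_mul_right enorm_tsum_le_tsum_enorm _
    _ ≤ ∑' n, l2 fun r : G × K => W r.1 p r.2 * ‖X n r.1 p r.2‖ₑ := l2_tsum_le _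
    _ ≤ _ := ENNReal.tsum_le_tsum fun n => l2_le_colN W (X n) p

theorem colOne_le_mul_colN {W : G → K → K → ℝ≥0∞} {C : ℝ≥0∞} {κ : K → G × K → ℝ≥0∞}
    (h1 : ∀ p r, 1 ≤ κ p r * W r.1 p r.2) (h2 : ∀ p, l2 (κ p) ≤ C) (X : Ker G K) :
    colOne X ≤ C * colN W X := by
  refine iSup_le fun p => ?_
  calc ∑' r : G × K, ‖X r.1 p r.2‖ₑ
      ≤ ∑' r : G × K, κ p r * (W r.1 p r.2 * ‖X r.1 p r.2‖ₑ) :=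
        ENNReal.tsum_le_tsum fun r => by
          rw [← mul_assoc]
          exact le_mul_of_one_le_left' (h1 p r)
    _ ≤ _ := (tsum_mul_le_l2 _ _).trans (mul_le_mul' (h2 p) (l2_le_colN W X p))

theorem colN_comp_le {G K : Type*} [AddCommGroup G] {W W₁ W₂ : G → K → K → ℝ≥0∞} {C : ℝ≥0∞}
    {κ : G → K → K → G × K → ℝ≥0∞}
    (h1 : ∀ l p q r, W l p q ≤ κ l p q r * (W₁ (l - r.1) r.2 q * W₂ r.1 p r.2))
    (h2 : ∀ l p q, l2 (κ l p q) ≤ C) (X Y : Ker G K) :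
    colN W (comp X Y) ≤ C * colN W₁ X * colN W₂ Y := by
  refine iSup_le fun p => ?_
  have key : ∀ t : G × K, W t.1 p t.2 * ‖comp X Y t.1 p t.2‖ₑ ≤
      C * l2 fun r : G × K => (W₁ (t.1 - r.1) r.2 t.2 * ‖X (t.1 - r.1) r.2 t.2‖ₑ) *
        (W₂ r.1 p r.2 * ‖Y r.1 p r.2‖ₑ) := by
    intro t
    calc _ ≤ W t.1 p t.2 * ∑' r : G × K, ‖X (t.1 - r.1) r.2 t.2‖ₑ * ‖Y r.1 p r.2‖ₑ := by
          refine mul_le_mul_right (enorm_tsum_le_tsum_enorm.trans (le_of_eq ?_)) _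
          exact tsum_congr fun r => enorm_mul _ _
      _ ≤ ∑' r : G × K, κ t.1 p t.2 r * ((W₁ (t.1 - r.1) r.2 t.2 * ‖X (t.1 - r.1) r.2 t.2‖ₑ) *
            (W₂ r.1 p r.2 * ‖Y r.1 p r.2‖ₑ)) := by
          rw [← ENNReal.tsum_mul_left]
          refine ENNReal.tsum_le_tsum fun r => (mul_le_mul_left (h1 t.1 p t.2 r) _).trans
            (le_of_eq ?_)
          ring
      _ ≤ _ := (tsum_mul_le_l2 _ _).trans (mul_le_mul_left (h2 _ _ _) _)
  refine (l2_mono key).trans ?_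
  rw [l2_const_mul, mul_assoc]
  refine mul_le_mul_right ?_ C
  rw [le_l2_iff]
  simp only [l2_sq, mul_pow (_ * _) (_ * _) 2]
  rw [ENNReal.tsum_comm]
  simp only [ENNReal.tsum_mul_right, mul_pow (colN _ _)]
  calc _ ≤ ∑' r : G × K, colN W₁ X ^ 2 * (W₂ r.1 p r.2 * ‖Y r.1 p r.2‖ₑ) ^ 2 := by
        refine ENNReal.tsum_le_tsum fun r => mul_le_mul_left ?_ _
        rw [tsum_sub_fst (fun l q => (W₁ l r.2 q * ‖X l r.2 q‖ₑ) ^ 2), ← l2_sq]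
        exact pow_le_pow_left' (l2_le_colN W₁ X r.2) 2
    _ ≤ _ := by
        rw [ENNReal.tsum_mul_left, ← l2_sq]
        exact mul_le_mul_right (pow_le_pow_left' (l2_le_colN W₂ Y p) 2) _

end ColN

/-! ### Lipschitz norms -/

section Lip

variable {d : ℕ} {E E₁ E₂ : Type*} [Sub E] [Sub E₁] [Sub E₂] {γ : ℝ} {O : Set (Freq d)}

/-- The supremum part of `lipNorm`. -/
def lipSup {E : Type*} (O : Set (Freq d)) (N : E → ℝ≥0∞) (f : Freq d → E) : ℝ≥0∞ := ⨆ ω ∈ O, N (f ω)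

/-- The Lipschitz seminorm in `lipNorm`. -/
def lipSemi (O : Set (Freq d)) (N : E → ℝ≥0∞) (f : Freq d → E) : ℝ≥0∞ :=
  ⨆ ω₁ ∈ O, ⨆ ω₂ ∈ O, ⨆ _ : ω₁ ≠ ω₂, N (f ω₁ - f ω₂) / ENNReal.ofReal ‖ω₁ - ω₂‖

theorem lipNorm_eq (γ : ℝ) (O : Set (Freq d)) (N : E → ℝ≥0∞) (f : Freq d → E) :
    lipNorm γ O N f = lipSup O N f + ENNReal.ofReal γ * lipSemi O N f := rfl

theorem lipSup_le_iff {E : Type*} {N : E → ℝ≥0∞} {f : Freq d → E} {c : ℝ≥0∞} :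
    lipSup O N f ≤ c ↔ ∀ ω ∈ O, N (f ω) ≤ c := iSup₂_le_iff

theorem le_lipSup {E : Type*} {N : E → ℝ≥0∞} {f : Freq d → E} {ω : Freq d} (h : ω ∈ O) :
    N (f ω) ≤ lipSup O N f := lipSup_le_iff.1 le_rfl ω h

theorem ofReal_dist_pos {ω₁ ω₂ : Freq d} (h : ω₁ ≠ ω₂) : ENNReal.ofReal ‖ω₁ - ω₂‖ ≠ 0 := by
  rw [Ne, ENNReal.ofReal_eq_zero, not_le]
  exact norm_pos_iff.2 (sub_ne_zero.2 h)

theorem lipSemi_le_iff {N : E → ℝ≥0∞} {f : Freq d → E} {c : ℝ≥0∞} :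
    lipSemi O N f ≤ c ↔ ∀ ω₁ ∈ O, ∀ ω₂ ∈ O, ω₁ ≠ ω₂ →
      N (f ω₁ - f ω₂) ≤ c * ENNReal.ofReal ‖ω₁ - ω₂‖ := by
  simp only [lipSemi, iSup_le_iff]
  refine forall₅_congr fun ω₁ _ ω₂ _ h => ?_
  rw [ENNReal.div_le_iff (ofReal_dist_pos h) ENNReal.ofReal_ne_top]

theorem le_lipSemi {N : E → ℝ≥0∞} {f : Freq d → E} {ω₁ ω₂ : Freq d} (h₁ : ω₁ ∈ O) (h₂ : ω₂ ∈ O)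
    (h : ω₁ ≠ ω₂) : N (f ω₁ - f ω₂) ≤ lipSemi O N f * ENNReal.ofReal ‖ω₁ - ω₂‖ :=
  lipSemi_le_iff.1 le_rfl ω₁ h₁ ω₂ h₂ h

theorem lipSup_le_lipNorm {N : E → ℝ≥0∞} {f : Freq d → E} : lipSup O N f ≤ lipNorm γ O N f :=
  le_self_add

theorem le_lipNorm {N : E → ℝ≥0∞} {f : Freq d → E} {ω : Freq d} (h : ω ∈ O) :
    N (f ω) ≤ lipNorm γ O N f := (le_lipSup h).trans lipSup_le_lipNorm

theorem lipNorm_mono_set {N : E → ℝ≥0∞} {f : Freq d → E} {O' : Set (Freq d)} (h : O ⊆ O') :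
    lipNorm γ O N f ≤ lipNorm γ O' N f := by
  rw [lipNorm_eq, lipNorm_eq]
  refine add_le_add (lipSup_le_iff.2 fun ω hω => le_lipSup (h hω))
    (mul_le_mul_right (lipSemi_le_iff.2 fun ω₁ h₁ ω₂ h₂ h' => le_lipSemi (h h₁) (h h₂) h') _)

theorem lipNorm_le_mul {N : E → ℝ≥0∞} {N' : E₁ → ℝ≥0∞} {f : Freq d → E} {g : Freq d → E₁}
    {c : ℝ≥0∞} (h1 : ∀ ω ∈ O, N (f ω) ≤ c * N' (g ω))
    (h2 : ∀ ω₁ ∈ O, ∀ ω₂ ∈ O, ω₁ ≠ ω₂ → N (f ω₁ - f ω₂) ≤ c * N' (g ω₁ - g ω₂)) :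
    lipNorm γ O N f ≤ c * lipNorm γ O N' g := by
  rw [lipNorm_eq, lipNorm_eq, mul_add, mul_left_comm]
  refine add_le_add (lipSup_le_iff.2 fun ω hω => (h1 ω hω).trans
    (mul_le_mul_right (le_lipSup hω) _))
    (mul_le_mul_right (lipSemi_le_iff.2 fun ω₁ h₁ ω₂ h₂ h' => (h2 ω₁ h₁ ω₂ h₂ h').trans ?_) _)
  rw [mul_assoc]
  exact mul_le_mul_right (le_lipSemi h₁ h₂ h') _

theorem lipNorm_le_add {N : E → ℝ≥0∞} {N₁ : E₁ → ℝ≥0∞} {N₂ : E₂ → ℝ≥0∞} {f : Freq d → E}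
    {f₁ : Freq d → E₁} {f₂ : Freq d → E₂} (h1 : ∀ ω ∈ O, N (f ω) ≤ N₁ (f₁ ω) + N₂ (f₂ ω))
    (h2 : ∀ ω₁ ∈ O, ∀ ω₂ ∈ O, ω₁ ≠ ω₂ →
      N (f ω₁ - f ω₂) ≤ N₁ (f₁ ω₁ - f₁ ω₂) + N₂ (f₂ ω₁ - f₂ ω₂)) :
    lipNorm γ O N f ≤ lipNorm γ O N₁ f₁ + lipNorm γ O N₂ f₂ := by
  rw [lipNorm_eq, lipNorm_eq, lipNorm_eq, add_add_add_comm, ← mul_add]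
  refine add_le_add (lipSup_le_iff.2 fun ω hω => (h1 ω hω).trans
    (add_le_add (le_lipSup hω) (le_lipSup hω)))
    (mul_le_mul_right (lipSemi_le_iff.2 fun ω₁ h₁ ω₂ h₂ h' => (h2 ω₁ h₁ ω₂ h₂ h').trans ?_) _)
  rw [add_mul]
  exact add_le_add (le_lipSemi h₁ h₂ h') (le_lipSemi h₁ h₂ h')

theorem lipNorm_bilin_le {N : E → ℝ≥0∞} {N₁ : E₁ → ℝ≥0∞} {N₂ : E₂ → ℝ≥0∞} {f : Freq d → E}
    {f₁ : Freq d → E₁} {f₂ : Freq d → E₂} {c : ℝ≥0∞}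
    (h1 : ∀ ω ∈ O, N (f ω) ≤ c * N₁ (f₁ ω) * N₂ (f₂ ω))
    (h2 : ∀ ω₁ ∈ O, ∀ ω₂ ∈ O, ω₁ ≠ ω₂ → N (f ω₁ - f ω₂) ≤
      c * N₁ (f₁ ω₁ - f₁ ω₂) * N₂ (f₂ ω₁) + c * N₁ (f₁ ω₂) * N₂ (f₂ ω₁ - f₂ ω₂)) :
    lipNorm γ O N f ≤ c * lipNorm γ O N₁ f₁ * lipNorm γ O N₂ f₂ := by
  simp only [lipNorm_eq]
  set a := lipSup O N₁ f₁
  set b := lipSup O N₂ f₂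
  set a' := lipSemi O N₁ f₁
  set b' := lipSemi O N₂ f₂
  set g := ENNReal.ofReal γ
  have hs : lipSup O N f ≤ c * a * b := lipSup_le_iff.2 fun ω hω => (h1 ω hω).trans (by
    gcongr
    exacts [le_lipSup hω, le_lipSup hω])
  have hl : lipSemi O N f ≤ c * a' * b + c * a * b' :=
    lipSemi_le_iff.2 fun ω₁ h₁ ω₂ h₂ h' => (h2 ω₁ h₁ ω₂ h₂ h').trans (by
      calc _ ≤ c * (a' * ENNReal.ofReal ‖ω₁ - ω₂‖) * b +
            c * a * (b' * ENNReal.ofReal ‖ω₁ - ω₂‖) := by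
            gcongr
            exacts [le_lipSemi h₁ h₂ h', le_lipSup h₁, le_lipSup h₂, le_lipSemi h₁ h₂ h']
        _ = _ := by ring)
  calc lipSup O N f + g * lipSemi O N f ≤ c * a * b + g * (c * a' * b + c * a * b') := by gcongr
    _ ≤ c * a * b + g * (c * a' * b + c * a * b') + c * (g * a') * (g * b') := le_self_add
    _ = c * (a + g * a') * (b + g * b') := by ring

theorem lipNorm_tsum_le {G K ι : Type*} {W : G → K → K → ℝ≥0∞} (hW : ∀ l p q, W l p q ≠ 0)
    (f : ι → Freq d → Ker G K) :
    lipNorm γ O (colN W) (fun ω l p q => ∑' n, f n ω l p q) ≤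
      ∑' n, lipNorm γ O (colN W) (f n) := by
  by_cases htop : ∑' n, lipNorm γ O (colN W) (f n) = ⊤
  · rw [htop]; exact le_top
  have hs : ∀ ω ∈ O, ∀ l p q, Summable fun n => f n ω l p q := by
    intro ω hω l p q
    refine summable_of_tsum_enorm fun h => htop ?_
    refine top_unique ?_
    calc ⊤ = W l p q * ∑' n, ‖f n ω l p q‖ₑ := by rw [h, ENNReal.mul_top (hW _ _ _)]
      _ = ∑' n, W l p q * ‖f n ω l p q‖ₑ := ENNReal.tsum_mul_left.symm
      _ ≤ _ := ENNReal.tsum_le_tsum fun n =>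
        (weight_mul_enorm_le_colN W (f n ω) l p q).trans (le_lipNorm hω)
  simp only [lipNorm_eq]
  rw [ENNReal.tsum_add, ENNReal.tsum_mul_left]
  refine add_le_add (lipSup_le_iff.2 fun ω hω => (colN_tsum_le _ _).trans
    (ENNReal.tsum_le_tsum fun n => le_lipSup hω)) (mul_le_mul_right
    (lipSemi_le_iff.2 fun ω₁ h₁ ω₂ h₂ h' => ?_) _)
  have : ((fun l p q => ∑' n, f n ω₁ l p q) - fun l p q => ∑' n, f n ω₂ l p q) =
      fun l p q => ∑' n, (f n ω₁ - f n ω₂) l p q := by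
    funext l p q
    exact ((hs ω₁ h₁ l p q).tsum_sub (hs ω₂ h₂ l p q)).symm
  rw [this, ← ENNReal.tsum_mul_right]
  exact (colN_tsum_le _ _).trans (ENNReal.tsum_le_tsum fun n => le_lipSemi h₁ h₂ h')

end Lip

/-! ### Estimates for the Lie series -/

section LieEstimate

variable {G K : Type*} [AddCommGroup G]

/-- The weight `W` makes the kernels a two-sided module over those with weight `W₁`. -/
structure IsModuleWeight (W W₁ : G → K → K → ℝ≥0∞) (C : ℝ≥0∞) : Prop where
  ne_zero : ∀ l p q, W l p q ≠ 0
  left : ∀ X Y : Ker G K, colN W (comp X Y) ≤ C * colN W₁ X * colN W Y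
  right : ∀ X Y : Ker G K, colN W (comp Y X) ≤ C * colN W₁ X * colN W Y
  bdd : ∀ X : Ker G K, colOne X ≤ C * colN W X
  bdd₁ : ∀ X : Ker G K, colOne X ≤ C * colN W₁ X
  ne_top : C ≠ ⊤

theorem commKer_sub {u v X Y : Ker G K} (hu : colOne u ≠ ⊤) (hv : colOne v ≠ ⊤)
    (hX : colOne X ≠ ⊤) (hY : colOne Y ≠ ⊤) :
    commKer u X - commKer v Y = commKer (u - v) X + commKer v (X - Y) := by
  have h1 := sub_comp hu hv hX
  have h2 := sub_comp hX hY hv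
  have h3 : ∀ {A B C : Ker G K}, colOne A ≠ ⊤ → colOne B ≠ ⊤ → colOne C ≠ ⊤ →
      comp A (B - C) = comp A B - comp A C := by
    intro A B C hA hB hC
    funext l p q
    simp only [comp, Pi.sub_apply, mul_sub]
    exact (summable_comp hA hB l p q).tsum_sub (summable_comp hA hC l p q)
  simp only [commKer, h1, h2, h3 hX hu hv, h3 hv hX hY]
  abel

variable {W W₁ : G → K → K → ℝ≥0∞} {C : ℝ≥0∞} {d : ℕ} {γ : ℝ} {O : Set (Freq d)}

theorem IsModuleWeight.colN_commKer_le (hW : IsModuleWeight W W₁ C) (u X : Ker G K) :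
    colN W (commKer u X) ≤ 2 * C * colN W₁ u * colN W X := by
  refine (colN_sub_le _ _ _).trans ((add_le_add (hW.right u X) (hW.left u X)).trans (le_of_eq ?_))
  ring

theorem IsModuleWeight.colOne_ne_top (hW : IsModuleWeight W W₁ C) {f : Freq d → Ker G K}
    (hf : lipNorm γ O (colN W) f ≠ ⊤) {ω : Freq d} (h : ω ∈ O) : colOne (f ω) ≠ ⊤ :=
  ne_top_of_le_ne_top (ENNReal.mul_ne_top hW.ne_top (ne_top_of_le_ne_top hf (le_lipNorm h)))
    (hW.bdd _)

theorem IsModuleWeight.colOne_ne_top₁ (hW : IsModuleWeight W W₁ C) {f : Freq d → Ker G K}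
    (hf : lipNorm γ O (colN W₁) f ≠ ⊤) {ω : Freq d} (h : ω ∈ O) : colOne (f ω) ≠ ⊤ :=
  ne_top_of_le_ne_top (ENNReal.mul_ne_top hW.ne_top (ne_top_of_le_ne_top hf (le_lipNorm h)))
    (hW.bdd₁ _)

theorem IsModuleWeight.lipNorm_commKer_le (hW : IsModuleWeight W W₁ C) {u X : Freq d → Ker G K}
    (hu : lipNorm γ O (colN W₁) u ≠ ⊤) (hX : lipNorm γ O (colN W) X ≠ ⊤) :
    lipNorm γ O (colN W) (fun ω => commKer (u ω) (X ω)) ≤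
      2 * C * lipNorm γ O (colN W₁) u * lipNorm γ O (colN W) X := by
  refine lipNorm_bilin_le (fun ω _ => hW.colN_commKer_le _ _) fun ω₁ h₁ ω₂ h₂ _ => ?_
  rw [commKer_sub (hW.colOne_ne_top₁ hu h₁) (hW.colOne_ne_top₁ hu h₂) (hW.colOne_ne_top hX h₁)
    (hW.colOne_ne_top hX h₂)]
  exact (colN_add_le _ _ _).trans
    (add_le_add (hW.colN_commKer_le _ _) (hW.colN_commKer_le _ _))

theorem IsModuleWeight.lipNorm_iterate_le (hW : IsModuleWeight W W₁ C) {u X : Freq d → Ker G K}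
    (hu : lipNorm γ O (colN W₁) u ≠ ⊤) (hX : lipNorm γ O (colN W) X ≠ ⊤) (k : ℕ) :
    lipNorm γ O (colN W) (fun ω => (commKer (u ω))^[k] (X ω)) ≤
      (2 * C * lipNorm γ O (colN W₁) u) ^ k * lipNorm γ O (colN W) X := by
  induction k with
  | zero => simp
  | succ k ih =>
    have hfin : lipNorm γ O (colN W) (fun ω => (commKer (u ω))^[k] (X ω)) ≠ ⊤ :=
      ne_top_of_le_ne_top (ENNReal.mul_ne_top (ENNReal.pow_ne_top (ENNReal.mul_ne_top
        (ENNReal.mul_ne_top (by simp) hW.ne_top) hu)) hX) ih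
    simp only [Function.iterate_succ_apply']
    refine (hW.lipNorm_commKer_le hu hfin).trans ?_
    rw [pow_succ', mul_assoc _ (_ ^ k)]
    exact mul_le_mul_right ih _

theorem tsum_pow_succ_le {θ : ℝ≥0∞} (h : θ ≤ 1 / 2) : ∑' k : ℕ, θ ^ (k + 1) ≤ 2 * θ := by
  have h1 : ∑' k : ℕ, θ ^ k ≤ 2 := by
    rw [ENNReal.tsum_geometric]
    calc (1 - θ)⁻¹ ≤ (1 - 1 / 2)⁻¹ := ENNReal.inv_le_inv.2 (tsub_le_tsub_left h _)
      _ = 2 := by rw [one_div, ENNReal.one_sub_inv_two, inv_inv]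
  simp only [pow_succ]
  rw [ENNReal.tsum_mul_right]
  exact mul_le_mul_left h1 _

theorem enorm_inv_factorial_le (k : ℕ) : ‖((k.factorial : ℂ)⁻¹)‖ₑ ≤ 1 := by
  rw [enorm_eq_nnnorm]
  have : ‖((k.factorial : ℂ)⁻¹)‖ ≤ 1 := by
    rw [norm_inv, Complex.norm_natCast]
    exact inv_le_one_of_one_le₀ (by exact_mod_cast k.factorial_pos)
  exact_mod_cast this

theorem IsModuleWeight.lipNorm_lieRemainder_le (hW : IsModuleWeight W W₁ C)
    {u P g : Freq d → Ker G K} (hu : 2 * C * lipNorm γ O (colN W₁) u ≤ 1 / 2)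
    (hu' : lipNorm γ O (colN W₁) u ≠ ⊤)
    (hP : lipNorm γ O (colN W) P ≠ ⊤) (hg : lipNorm γ O (colN W) g ≠ ⊤) :
    lipNorm γ O (colN W) (fun ω => lieRemainder (u ω) (P ω) (g ω)) ≤
      2 * (2 * C * lipNorm γ O (colN W₁) u) *
        (lipNorm γ O (colN W) P + lipNorm γ O (colN W) g) := by
  set θ := 2 * C * lipNorm γ O (colN W₁) u
  have hterm : ∀ k : ℕ, lipNorm γ O (colN W) (fun ω =>
      (((k + 1).factorial : ℂ)⁻¹) • (commKer (u ω))^[k + 1] (P ω) +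
      (((k + 2).factorial : ℂ)⁻¹) • (commKer (u ω))^[k + 1] (g ω)) ≤
      θ ^ (k + 1) * (lipNorm γ O (colN W) P + lipNorm γ O (colN W) g) := by
    intro k
    have hsc : ∀ (n : ℕ) (X : Ker G K), colN W (((n.factorial : ℂ)⁻¹) • X) ≤ colN W X := by
      intro n X
      rw [colN_smul]
      exact mul_le_of_le_one_left' (enorm_inv_factorial_le n)
    refine (lipNorm_le_add (f₁ := fun ω => (commKer (u ω))^[k + 1] (P ω))
      (f₂ := fun ω => (commKer (u ω))^[k + 1] (g ω)) (N₁ := colN W) (N₂ := colN W)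
      (fun ω _ => ?_) fun ω₁ _ ω₂ _ _ => ?_).trans ?_
    · exact (colN_add_le _ _ _).trans (add_le_add (hsc _ _) (hsc _ _))
    · rw [add_sub_add_comm, ← smul_sub, ← smul_sub]
      exact (colN_add_le _ _ _).trans (add_le_add (hsc _ _) (hsc _ _))
    · rw [mul_add]
      exact add_le_add (hW.lipNorm_iterate_le hu' hP _) (hW.lipNorm_iterate_le hu' hg _)
  calc _ ≤ ∑' k : ℕ, θ ^ (k + 1) * (lipNorm γ O (colN W) P + lipNorm γ O (colN W) g) :=
        (lipNorm_tsum_le hW.ne_zero _).trans (ENNReal.tsum_le_tsum hterm)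
    _ ≤ _ := by
        rw [ENNReal.tsum_mul_right]
        exact mul_le_mul_left (tsum_pow_succ_le hu) _

end LieEstimate

/-! ### The weights -/

theorem one_le_jap (x : ℝ) : 1 ≤ jap x := le_max_left _ _

theorem jap_pos (x : ℝ) : 0 < jap x := zero_lt_one.trans_le (one_le_jap x)

theorem abs_le_jap (x : ℝ) : |x| ≤ jap x := le_max_right _ _

theorem jap_neg (x : ℝ) : jap (-x) = jap x := by simp [jap]

theorem jap_abs (x : ℝ) : jap |x| = jap x := by simp [jap]

theorem jap_add_le (x y : ℝ) : jap (x + y) ≤ jap x + jap y := by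
  refine max_le ?_ ((abs_add_le _ _).trans (add_le_add (abs_le_jap x) (abs_le_jap y)))
  linarith [one_le_jap x, jap_pos y]

theorem len_eq_norm {d : ℕ} (l : Fin d → ℤ) :
    len l = ‖(WithLp.toLp 2 (fun i => (l i : ℝ)) : EuclideanSpace ℝ (Fin d))‖ := by
  rw [EuclideanSpace.norm_eq, len]
  simp

theorem len_neg {d : ℕ} (l : Fin d → ℤ) : len (-l) = len l := by simp [len]

theorem len_add_le {d : ℕ} (l l' : Fin d → ℤ) : len (l + l') ≤ len l + len l' := by
  simp only [len_eq_norm]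
  refine le_trans (le_of_eq ?_) (norm_add_le _ _)
  congr 1
  ext i
  simp

theorem abs_apply_le_len {d : ℕ} (l : Fin d → ℤ) (i : Fin d) : |(l i : ℝ)| ≤ len l := by
  rw [len_eq_norm]
  exact PiLp.norm_apply_le (WithLp.toLp 2 (fun i => (l i : ℝ)) : EuclideanSpace ℝ (Fin d)) i

/-- The decay weight `⟨ℓ, |k| - |j|⟩`. -/
def wt {d : ℕ} (l : Fin d → ℤ) (j k : ℤ) : ℝ :=
  max (jap ((k.natAbs : ℝ) - j.natAbs)) (len l)

section

variable {d : ℕ} (l l' : Fin d → ℤ) (i j k : ℤ)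

theorem one_le_wt : 1 ≤ wt l j k := (one_le_jap _).trans (le_max_left _ _)

theorem wt_pos : 0 < wt l j k := zero_lt_one.trans_le (one_le_wt l j k)

theorem wt_comm : wt l j k = wt l k j := by
  rw [wt, wt, ← jap_neg, neg_sub]

theorem wt_neg : wt (-l) j k = wt l j k := by rw [wt, wt, len_neg]

theorem wt_neg_left : wt l (-j) k = wt l j k := by simp [wt]

theorem wt_neg_right : wt l j (-k) = wt l j k := by simp [wt]

theorem wt_triangle : wt l j k ≤ wt (l - l') i k + wt l' j i := by
  refine max_le ?_ ?_
  · have : (k.natAbs : ℝ) - j.natAbs = ((k.natAbs : ℝ) - i.natAbs) + ((i.natAbs : ℝ) - j.natAbs) := by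
      ring
    rw [this]
    exact (jap_add_le _ _).trans (add_le_add (le_max_left _ _) (le_max_left _ _))
  · have : l = (l - l') + l' := by simp
    conv_lhs => rw [this]
    exact (len_add_le _ _).trans (add_le_add (le_max_right _ _) (le_max_right _ _))

end

theorem tsum_pi_prod (f : ℤ → ℝ≥0∞) (n : ℕ) :
    ∑' l : Fin n → ℤ, ∏ i, f (l i) = (∑' k, f k) ^ n := by
  induction n with
  | zero => simp [tsum_fintype]
  | succ n ih =>
    rw [← (Fin.consEquiv fun _ => ℤ).tsum_eq, ENNReal.tsum_prod', pow_succ', ← ih,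
      ← ENNReal.tsum_mul_right]
    refine tsum_congr fun a => ?_
    rw [← ENNReal.tsum_mul_left]
    refine tsum_congr fun b => ?_
    simp [Fin.prod_univ_succ, Fin.consEquiv]

theorem tsum_jap_rpow_ne_top {e : ℝ} (he : 1 < e) :
    ∑' n : ℤ, ENNReal.ofReal (jap (n : ℝ) ^ (-e)) ≠ ⊤ := by
  have h : Summable fun n : ℤ => jap (n : ℝ) ^ (-e) := by
    refine Summable.of_nonneg_of_le (fun n => Real.rpow_nonneg (jap_pos _).le _) (fun n => ?_)
      ((Real.summable_abs_int_rpow he).add (summable_of_ne_finset_zero (s := {0})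
        (f := fun n : ℤ => if n = 0 then (1 : ℝ) else 0) (fun n hn => by simp_all)))
    by_cases hn : n = 0
    · subst hn
      simp only [jap, Int.cast_zero, abs_zero, if_true, zero_le_one, max_eq_left, Real.one_rpow]
      linarith [Real.rpow_nonneg (le_refl (0 : ℝ)) (-e)]
    · have : jap (n : ℝ) = |(n : ℝ)| := by
        refine max_eq_right ?_
        exact_mod_cast Int.one_le_abs hn
      simp [this, hn]
  exact h.tsum_ofReal_ne_top

theorem wt_rpow_le {d : ℕ} (l : Fin d → ℤ) (j k : ℤ) {t : ℝ} (ht : (sZero d : ℝ) ≤ t) :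
    (wt l j k ^ (-t)) ^ 2 ≤ (∏ i, jap (l i : ℝ) ^ (-((d + 2 : ℝ) / (d + 1)))) *
      jap ((k.natAbs : ℝ) - j.natAbs) ^ (-((d + 2 : ℝ) / (d + 1))) := by
  set e : ℝ := (d + 2 : ℝ) / (d + 1)
  have hd : (0 : ℝ) < d + 1 := by positivity
  have he : 0 ≤ e := by positivity
  have hw := wt_pos l j k
  have hexp : e * d + e ≤ 2 * t := by
    have h1 : e * d + e = d + 2 := by
      simp only [e]
      field_simp
    have h2 : d + 2 ≤ 2 * sZero d := by rw [sZero]; omega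
    have h3 : ((d + 2 : ℕ) : ℝ) ≤ ((2 * sZero d : ℕ) : ℝ) := by exact_mod_cast h2
    push_cast at h3
    linarith
  have hmono : ∀ x : ℝ, 1 ≤ x → x ≤ wt l j k → wt l j k ^ (-e) ≤ x ^ (-e) := fun x hx h =>
    Real.rpow_le_rpow_of_nonpos (by linarith) h (by linarith)
  calc (wt l j k ^ (-t)) ^ 2 = wt l j k ^ (-(2 * t)) := by
        rw [← Real.rpow_natCast, ← Real.rpow_mul hw.le]
        congr 1
        push_cast
        ring
    _ ≤ wt l j k ^ (-(e * d + e)) :=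
        Real.rpow_le_rpow_of_exponent_le (one_le_wt _ _ _) (by linarith)
    _ = (∏ _i : Fin d, wt l j k ^ (-e)) * wt l j k ^ (-e) := by
        rw [Finset.prod_const, Finset.card_univ, Fintype.card_fin, ← Real.rpow_natCast,
          ← Real.rpow_mul hw.le, ← Real.rpow_add hw]
        congr 1
        ring
    _ ≤ _ := by
        refine mul_le_mul (Finset.prod_le_prod (fun _ _ => Real.rpow_nonneg hw.le _) fun i _ =>
          hmono _ (one_le_jap _) ?_) (hmono _ (one_le_jap _) (le_max_left _ _))
          (Real.rpow_nonneg hw.le _)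
          (Finset.prod_nonneg fun i _ => Real.rpow_nonneg (jap_pos _).le _)
        exact max_le (one_le_wt _ _ _) ((abs_apply_le_len l i).trans (le_max_right _ _))

theorem exists_l2_wt_le (d : ℕ) : ∃ S : ℝ, 1 ≤ S ∧ ∀ t : ℝ, (sZero d : ℝ) ≤ t → ∀ j : ℤ,
    l2 (fun r : (Fin d → ℤ) × (Bool × ℤ) => ENNReal.ofReal (wt r.1 j r.2.2 ^ (-t))) ≤
      ENNReal.ofReal S := by
  set e : ℝ := (d + 2 : ℝ) / (d + 1) with hee
  have he : 1 < e := by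
    rw [hee, lt_div_iff₀ (by positivity)]
    linarith
  set F : ℤ → ℝ≥0∞ := fun n => ENNReal.ofReal (jap (n : ℝ) ^ (-e))
  have hF : ∑' n, F n ≠ ⊤ := tsum_jap_rpow_ne_top he
  set B : ℝ≥0∞ := (∑' n, F n) ^ d * (2 * (2 * ∑' n, F n))
  have hB : B ≠ ⊤ := ENNReal.mul_ne_top (ENNReal.pow_ne_top hF)
    (ENNReal.mul_ne_top (by simp) (ENNReal.mul_ne_top (by simp) hF))
  refine ⟨max 1 B.toReal, le_max_left _ _, fun t ht j => ?_⟩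
  have hcol : ∑' k : ℤ, ENNReal.ofReal (jap ((k.natAbs : ℝ) - j.natAbs) ^ (-e)) ≤
      2 * ∑' n, F n := by
    calc _ ≤ ∑' k : ℤ, (F (k - j.natAbs) + F (-k - j.natAbs)) := by
          refine ENNReal.tsum_le_tsum fun k => ?_
          rcases le_total 0 k with hk | hk
          · refine le_trans (le_of_eq ?_) le_self_add
            simp only [F]
            congr 3
            push_cast
            rw [Nat.cast_natAbs, abs_of_nonneg hk]
            simp
          · refine le_trans (le_of_eq ?_) le_add_self
            simp only [F]
            congr 3
            push_cast
            rw [Nat.cast_natAbs, abs_of_nonpos hk]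
            simp
      _ = 2 * ∑' n, F n := by
          have h1 := (Equiv.subRight (j.natAbs : ℤ)).tsum_eq F
          have h2 := ((Equiv.neg ℤ).trans (Equiv.subRight (j.natAbs : ℤ))).tsum_eq F
          simp only [Equiv.subRight_apply, Equiv.trans_apply, Equiv.neg_apply] at h1 h2
          rw [ENNReal.tsum_add, h1, h2, two_mul]
  have hsum : ∑' r : (Fin d → ℤ) × (Bool × ℤ), ENNReal.ofReal (wt r.1 j r.2.2 ^ (-t)) ^ 2 ≤ B := by
    calc _ ≤ ∑' r : (Fin d → ℤ) × (Bool × ℤ), (∏ i, F (r.1 i)) *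
          ENNReal.ofReal (jap ((r.2.2.natAbs : ℝ) - j.natAbs) ^ (-e)) := by
          refine ENNReal.tsum_le_tsum fun r => ?_
          rw [← ENNReal.ofReal_pow (Real.rpow_nonneg (wt_pos _ _ _).le _),
            ← ENNReal.ofReal_prod_of_nonneg (fun i _ => Real.rpow_nonneg (jap_pos _).le _),
            ← ENNReal.ofReal_mul (Finset.prod_nonneg fun i _ => Real.rpow_nonneg (jap_pos _).le _)]
          exact ENNReal.ofReal_le_ofReal (wt_rpow_le _ _ _ ht)
      _ ≤ _ := by
          rw [ENNReal.tsum_prod']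
          simp only [ENNReal.tsum_mul_left, ENNReal.tsum_mul_right, tsum_pi_prod]
          refine mul_le_mul_right ?_ _
          rw [ENNReal.tsum_prod' (f := fun q : Bool × ℤ =>
            ENNReal.ofReal (jap ((q.2.natAbs : ℝ) - j.natAbs) ^ (-e))), tsum_fintype]
          simp only [Fintype.sum_bool]
          rw [← two_mul]
          exact mul_le_mul_right hcol _
  rw [le_l2_iff]
  refine hsum.trans ?_
  calc B = ENNReal.ofReal B.toReal := (ENNReal.ofReal_toReal hB).symm
    _ ≤ ENNReal.ofReal (max 1 B.toReal) := ENNReal.ofReal_le_ofReal (le_max_right _ _)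
    _ ≤ ENNReal.ofReal (max 1 B.toReal) ^ 2 := by
        refine le_self_pow₀ ?_ two_ne_zero
        rw [ENNReal.one_le_ofReal]
        exact le_max_left _ _

/-- The smoothing weight of the class `𝒩(1, 1)`. -/
def vOne (p q : Bool × ℤ) : ℝ := max (jap p.2) (jap q.2)

/-- The smoothing weight of the class `𝒩(1, 0)`. -/
def vZero (p q : Bool × ℤ) : ℝ :=
  if p.1 = q.1 then max (jap p.2) (jap q.2) else max (jap q.2 / jap p.2) (jap p.2 / jap q.2)

theorem one_le_vOne (p q : Bool × ℤ) : 1 ≤ vOne p q := (one_le_jap _).trans (le_max_left _ _)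

theorem ratio_le_vZero (p q : Bool × ℤ) :
    jap q.2 / jap p.2 ≤ vZero p q ∧ jap p.2 / jap q.2 ≤ vZero p q := by
  rw [vZero]
  split_ifs
  · exact ⟨(div_le_self (jap_pos _).le (one_le_jap _)).trans (le_max_right _ _),
      (div_le_self (jap_pos _).le (one_le_jap _)).trans (le_max_left _ _)⟩
  · exact ⟨le_max_left _ _, le_max_right _ _⟩

theorem one_le_vZero (p q : Bool × ℤ) : 1 ≤ vZero p q := by
  obtain ⟨h1, h2⟩ := ratio_le_vZero p q
  rcases le_total (jap p.2) (jap q.2) with h | h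
  · exact ((one_le_div (jap_pos _)).2 h).trans h1
  · exact ((one_le_div (jap_pos _)).2 h).trans h2

theorem vZero_le_vOne (p q : Bool × ℤ) : vZero p q ≤ vOne p q := by
  rw [vZero, vOne]
  split_ifs
  · exact le_rfl
  · exact max_le ((div_le_self (jap_pos _).le (one_le_jap _)).trans (le_max_right _ _))
      ((div_le_self (jap_pos _).le (one_le_jap _)).trans (le_max_left _ _))

theorem vOne_le_left (p q r : Bool × ℤ) : vOne p q ≤ vOne r q * vZero p r := by
  have h1 := (ratio_le_vZero p r).2
  rw [div_le_iff₀ (jap_pos _)] at h1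
  have h0 := one_le_vZero p r
  have hr := jap_pos r.2
  have hq := jap_pos q.2
  refine max_le ?_ ?_
  · calc jap p.2 ≤ vZero p r * jap r.2 := h1
      _ ≤ vOne r q * vZero p r := by
        rw [mul_comm]
        exact mul_le_mul_of_nonneg_right (le_max_left _ _) (by linarith)
  · calc jap q.2 ≤ jap q.2 * vZero p r := le_mul_of_one_le_right hq.le h0
      _ ≤ _ := mul_le_mul_of_nonneg_right (le_max_right _ _) (by linarith)

theorem vOne_le_right (p q r : Bool × ℤ) : vOne p q ≤ vZero r q * vOne p r := by
  have h1 := (ratio_le_vZero r q).1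
  rw [div_le_iff₀ (jap_pos _)] at h1
  have h0 := one_le_vZero r q
  have hr := jap_pos r.2
  have hp := jap_pos p.2
  refine max_le ?_ ?_
  · calc jap p.2 ≤ vZero r q * jap p.2 := le_mul_of_one_le_left hp.le h0
      _ ≤ _ := mul_le_mul_of_nonneg_left (le_max_left _ _) (by linarith)
  · exact h1.trans (mul_le_mul_of_nonneg_left (le_max_right _ _) (by linarith))

/-- The weight `⟨ℓ, |k| - |j|⟩^lo + lam ⟨ℓ, |k| - |j|⟩^hi`. -/
def wtSum {d : ℕ} (lo hi lam : ℝ) (l : Fin d → ℤ) (j k : ℤ) : ℝ :=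
  wt l j k ^ lo + lam * wt l j k ^ hi

/-- The product of a smoothing weight and `wtSum`. -/
def Wgt {d : ℕ} (v : Bool × ℤ → Bool × ℤ → ℝ) (lo hi lam : ℝ) (l : Fin d → ℤ) (p q : Bool × ℤ) :
    ℝ≥0∞ := ENNReal.ofReal (v p q * wtSum lo hi lam l p.2 q.2)

theorem wtSum_pos {d : ℕ} {lo hi lam : ℝ} (hl : 0 ≤ lam) (l : Fin d → ℤ) (j k : ℤ) :
    0 < wtSum lo hi lam l j k :=
  add_pos_of_pos_of_nonneg (Real.rpow_pos_of_pos (wt_pos _ _ _) _)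
    (mul_nonneg hl (Real.rpow_nonneg (wt_pos _ _ _).le _))

theorem add_rpow_le {x y t s : ℝ} (hx : 0 < x) (hy : 0 < y) (ht : 0 ≤ t) (hts : t ≤ s) :
    (x + y) ^ t ≤ 2 ^ s * (x ^ t + y ^ t) := by
  have key : ∀ x y : ℝ, 0 < x → 0 < y → x ≤ y → (x + y) ^ t ≤ 2 ^ s * (x ^ t + y ^ t) := by
    intro x y hx hy h
    calc (x + y) ^ t ≤ (2 * y) ^ t := Real.rpow_le_rpow (by positivity) (by linarith) ht
      _ = 2 ^ t * y ^ t := Real.mul_rpow (by norm_num) hy.le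
      _ ≤ 2 ^ s * (x ^ t + y ^ t) := by
        refine mul_le_mul (Real.rpow_le_rpow_of_exponent_le (by norm_num) hts) ?_
          (Real.rpow_nonneg hy.le _) (by positivity)
        linarith [Real.rpow_nonneg hx.le t]
  rcases le_total x y with h | h
  · exact key x y hx hy h
  · rw [add_comm x y, add_comm (x ^ t)]
    exact key y x hy hx h

theorem wtSum_le {d : ℕ} {lo hi lam s : ℝ} (h0 : 0 ≤ lo) (h1 : lo ≤ hi) (hs : hi ≤ s)
    (hl : 0 ≤ lam) (l l' : Fin d → ℤ) (i j k : ℤ) :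
    wtSum lo hi lam l j k ≤ 2 ^ s * (wt (l - l') i k ^ (-lo) + wt l' j i ^ (-lo)) *
      (wtSum lo hi lam (l - l') i k * wtSum lo hi lam l' j i) := by
  set x := wt (l - l') i k
  set y := wt l' j i
  have hx : 0 < x := wt_pos _ _ _
  have hy : 0 < y := wt_pos _ _ _
  have hsx : wtSum lo hi lam (l - l') i k = x ^ lo + lam * x ^ hi := rfl
  have hsy : wtSum lo hi lam l' j i = y ^ lo + lam * y ^ hi := rfl
  have hpow : ∀ t, 0 ≤ t → t ≤ s → wt l j k ^ t ≤ 2 ^ s * (x ^ t + y ^ t) := fun t ht hts =>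
    (Real.rpow_le_rpow (wt_pos _ _ _).le (wt_triangle l l' i j k) ht).trans
      (add_rpow_le hx hy ht hts)
  have h2 : wtSum lo hi lam l j k ≤
      2 ^ s * (wtSum lo hi lam (l - l') i k + wtSum lo hi lam l' j i) := by
    have e1 := hpow lo h0 (h1.trans hs)
    have e2 := mul_le_mul_of_nonneg_left (hpow hi (h0.trans h1) hs) hl
    calc wtSum lo hi lam l j k = wt l j k ^ lo + lam * wt l j k ^ hi := rfl
      _ ≤ 2 ^ s * (x ^ lo + y ^ lo) + lam * (2 ^ s * (x ^ hi + y ^ hi)) := add_le_add e1 e2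
      _ = _ := by rw [hsx, hsy]; ring
  have hone : ∀ z : ℝ, 0 < z → 1 ≤ z ^ (-lo) * (z ^ lo + lam * z ^ hi) := by
    intro z hz
    rw [mul_add, ← Real.rpow_add hz]
    simp only [neg_add_cancel, Real.rpow_zero]
    have : 0 ≤ z ^ (-lo) * (lam * z ^ hi) := by positivity
    linarith
  have hX := wtSum_pos (lo := lo) (hi := hi) hl (l - l') i k
  have hY := wtSum_pos (lo := lo) (hi := hi) hl l' j i
  have e1 : wtSum lo hi lam l' j i ≤
      x ^ (-lo) * (wtSum lo hi lam (l - l') i k * wtSum lo hi lam l' j i) := by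
    rw [← mul_assoc]
    exact le_mul_of_one_le_left hY.le (hone x hx)
  have e2 : wtSum lo hi lam (l - l') i k ≤
      y ^ (-lo) * (wtSum lo hi lam (l - l') i k * wtSum lo hi lam l' j i) := by
    rw [mul_left_comm]
    exact le_mul_of_one_le_right hX.le (hone y hy)
  refine h2.trans ?_
  rw [mul_assoc]
  refine mul_le_mul_of_nonneg_left ?_ (by positivity)
  rw [add_mul, add_comm]
  exact add_le_add e1 e2

theorem colN_comp_le_of_weights {d : ℕ} {S s : ℝ} (hS : 1 ≤ S)
    (hsum : ∀ t : ℝ, (sZero d : ℝ) ≤ t → ∀ j : ℤ,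
      l2 (fun r : (Fin d → ℤ) × (Bool × ℤ) => ENNReal.ofReal (wt r.1 j r.2.2 ^ (-t))) ≤
        ENNReal.ofReal S)
    {lo hi lam : ℝ} (h0 : (sZero d : ℝ) ≤ lo) (h1 : lo ≤ hi) (hs : hi ≤ s) (hl : 0 ≤ lam)
    {v v₁ v₂ : Bool × ℤ → Bool × ℤ → ℝ} (hv₁ : ∀ p q, 0 ≤ v₁ p q) (hv₂ : ∀ p q, 0 ≤ v₂ p q)
    (hv : ∀ p q r, v p q ≤ v₁ r q * v₂ p r) (X Y : FullOp d) :
    colN (Wgt v lo hi lam) (comp X Y) ≤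
      ENNReal.ofReal (2 ^ s * (2 * S)) * colN (Wgt v₁ lo hi lam) X * colN (Wgt v₂ lo hi lam) Y := by
  have hlo : 0 ≤ lo := le_trans (Nat.cast_nonneg _) h0
  refine colN_comp_le (κ := fun l p q r =>
    ENNReal.ofReal (2 ^ s * (wt (l - r.1) r.2.2 q.2 ^ (-lo) + wt r.1 p.2 r.2.2 ^ (-lo))))
    (fun l p q r => ?_) (fun l p q => ?_) X Y
  · have e1 : 0 ≤ wt (l - r.1) r.2.2 q.2 ^ (-lo) := Real.rpow_nonneg (wt_pos _ _ _).le _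
    have e2 : 0 ≤ wt r.1 p.2 r.2.2 ^ (-lo) := Real.rpow_nonneg (wt_pos _ _ _).le _
    have e3 := (wtSum_pos (lo := lo) (hi := hi) hl (l - r.1) r.2.2 q.2).le
    have e4 := (wtSum_pos (lo := lo) (hi := hi) hl r.1 p.2 r.2.2).le
    have e5 := (wtSum_pos (lo := lo) (hi := hi) hl l p.2 q.2).le
    rw [Wgt, Wgt, Wgt, ← ENNReal.ofReal_mul (mul_nonneg (hv₁ _ _) e3), ← ENNReal.ofReal_mul
      (by positivity)]
    refine ENNReal.ofReal_le_ofReal ?_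
    calc v p q * wtSum lo hi lam l p.2 q.2
        ≤ (v₁ r.2 q * v₂ p r.2) * (2 ^ s * (wt (l - r.1) r.2.2 q.2 ^ (-lo) +
          wt r.1 p.2 r.2.2 ^ (-lo)) * (wtSum lo hi lam (l - r.1) r.2.2 q.2 *
            wtSum lo hi lam r.1 p.2 r.2.2)) :=
          mul_le_mul (hv p q r.2) (wtSum_le hlo h1 hs hl l r.1 r.2.2 p.2 q.2) e5
            (mul_nonneg (hv₁ _ _) (hv₂ _ _))
      _ = _ := by ring
  · have e : ∀ r : (Fin d → ℤ) × (Bool × ℤ),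
        ENNReal.ofReal (2 ^ s * (wt (l - r.1) r.2.2 q.2 ^ (-lo) + wt r.1 p.2 r.2.2 ^ (-lo))) =
        ENNReal.ofReal (2 ^ s) * (ENNReal.ofReal (wt (l - r.1) q.2 r.2.2 ^ (-lo)) +
          ENNReal.ofReal (wt r.1 p.2 r.2.2 ^ (-lo))) := fun r => by
      rw [ENNReal.ofReal_mul (by positivity), ENNReal.ofReal_add
        (Real.rpow_nonneg (wt_pos _ _ _).le _) (Real.rpow_nonneg (wt_pos _ _ _).le _),
        wt_comm _ r.2.2 q.2]
    simp only [e]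
    rw [l2_const_mul, ENNReal.ofReal_mul (by positivity)]
    refine mul_le_mul_right ((l2_add_le _ _).trans ?_) _
    have h3 : l2 (fun r : (Fin d → ℤ) × (Bool × ℤ) =>
        ENNReal.ofReal (wt (l - r.1) q.2 r.2.2 ^ (-lo))) ≤ ENNReal.ofReal S := by
      refine le_trans (le_of_eq ?_) (hsum lo h0 q.2)
      rw [l2, l2]
      congr 1
      exact ((Equiv.subLeft l).prodCongr (Equiv.refl (Bool × ℤ))).tsum_eq
        (fun r : (Fin d → ℤ) × (Bool × ℤ) => ENNReal.ofReal (wt r.1 q.2 r.2.2 ^ (-lo)) ^ 2)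
    rw [two_mul, ENNReal.ofReal_add (by linarith) (by linarith)]
    exact add_le_add h3 (hsum lo h0 p.2)

theorem exists_isModuleWeight (d : ℕ) (s : ℝ) : ∃ C : ℝ, 1 ≤ C ∧ ∀ lo hi lam : ℝ,
    (sZero d : ℝ) ≤ lo → lo ≤ hi → hi ≤ s → 0 ≤ lam →
    IsModuleWeight (Wgt (d := d) vZero lo hi lam) (Wgt vOne lo hi lam) (ENNReal.ofReal C) := by
  obtain ⟨S, hS, hsum⟩ := exists_l2_wt_le d
  refine ⟨2 ^ s * (2 * S) + S, by nlinarith [Real.rpow_pos_of_pos (show (0 : ℝ) < 2 by norm_num) s],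
    fun lo hi lam h0 h1 hs hl => ?_⟩
  have hC : ENNReal.ofReal (2 ^ s * (2 * S)) ≤ ENNReal.ofReal (2 ^ s * (2 * S) + S) :=
    ENNReal.ofReal_le_ofReal (by linarith)
  have hC' : ENNReal.ofReal S ≤ ENNReal.ofReal (2 ^ s * (2 * S) + S) :=
    ENNReal.ofReal_le_ofReal (by nlinarith [Real.rpow_pos_of_pos (show (0 : ℝ) < 2 by norm_num) s])
  have hb : ∀ v : Bool × ℤ → Bool × ℤ → ℝ, (∀ p q, 1 ≤ v p q) → ∀ X : FullOp d,
      colOne X ≤ ENNReal.ofReal (2 ^ s * (2 * S) + S) * colN (Wgt v lo hi lam) X := by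
    intro v hv X
    refine le_trans ?_ (mul_le_mul_left hC' _)
    refine colOne_le_mul_colN (κ := fun (p : Bool × ℤ) (r : (Fin d → ℤ) × (Bool × ℤ)) =>
      ENNReal.ofReal (wt r.1 p.2 r.2.2 ^ (-lo))) (fun p r => ?_) (fun p => hsum lo h0 p.2) X
    have e1 : 0 ≤ wt r.1 p.2 r.2.2 ^ (-lo) := Real.rpow_nonneg (wt_pos _ _ _).le _
    rw [Wgt, ← ENNReal.ofReal_mul e1, ENNReal.one_le_ofReal]
    have e2 : wt r.1 p.2 r.2.2 ^ (-lo) * wt r.1 p.2 r.2.2 ^ lo = 1 := by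
      rw [← Real.rpow_add (wt_pos _ _ _)]
      simp
    have e3 := wtSum_pos (lo := lo) (hi := hi) hl r.1 p.2 r.2.2
    calc 1 = wt r.1 p.2 r.2.2 ^ (-lo) * wt r.1 p.2 r.2.2 ^ lo := e2.symm
      _ ≤ wt r.1 p.2 r.2.2 ^ (-lo) * (v p r.2 * wtSum lo hi lam r.1 p.2 r.2.2) := by
        refine mul_le_mul_of_nonneg_left ?_ e1
        calc _ ≤ wtSum lo hi lam r.1 p.2 r.2.2 :=
              le_add_of_nonneg_right (mul_nonneg hl (Real.rpow_nonneg (wt_pos _ _ _).le _))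
          _ ≤ _ := le_mul_of_one_le_left e3.le (hv _ _)
  have hZ : ∀ p q, 0 ≤ vZero p q := fun p q => zero_le_one.trans (one_le_vZero p q)
  have hO : ∀ p q, 0 ≤ vOne p q := fun p q => zero_le_one.trans (one_le_vOne p q)
  refine ⟨fun l p q => ?_, fun X Y => ?_, fun X Y => ?_, hb _ one_le_vZero, hb _ one_le_vOne,
    ENNReal.ofReal_ne_top⟩
  · rw [Wgt, Ne, ENNReal.ofReal_eq_zero, not_le]
    exact mul_pos (zero_lt_one.trans_le (one_le_vZero p q)) (wtSum_pos hl _ _ _)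
  · refine (colN_comp_le_of_weights hS hsum h0 h1 hs hl hO hZ (fun p q r =>
      (vZero_le_vOne p q).trans (vOne_le_left p q r)) X Y).trans ?_
    gcongr
  · refine (colN_comp_le_of_weights hS hsum h0 h1 hs hl hZ hO (fun p q r =>
      (vZero_le_vOne p q).trans (vOne_le_right p q r)) Y X).trans ?_
    rw [mul_right_comm]
    gcongr

/-! ### Comparison of the block norms with the column norms -/

open scoped Matrix.Norms.L2Operator in
theorem norm_entry_le_l2_opNorm {m n : Type*} [Fintype m] [Fintype n] [DecidableEq m]
    [DecidableEq n] (M : Matrix m n ℂ) (i : m) (j : n) : ‖M i j‖ ≤ ‖M‖ := by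
  have h := M.l2_opNorm_mulVec (EuclideanSpace.single j (1 : ℂ))
  rw [PiLp.norm_single, norm_one, mul_one] at h
  refine le_trans (le_of_eq ?_) ((PiLp.norm_apply_le _ i).trans h)
  simp

open scoped Matrix.Norms.L2Operator in
theorem l2_opNorm_single_le {m n : Type*} [Fintype m] [Fintype n] [DecidableEq m]
    [DecidableEq n] (i : m) (j : n) (c : ℂ) : ‖Matrix.single i j c‖ ≤ ‖c‖ := by
  rw [Matrix.l2_opNorm_def]
  refine ContinuousLinearMap.opNorm_le_bound _ (norm_nonneg _) fun x => ?_
  have : (Matrix.toEuclideanLin (𝕜 := ℂ) (Matrix.single i j c)) x =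
      EuclideanSpace.single i (c * x j) := by
    ext k
    simp [Matrix.toLpLin_apply, Matrix.single_mulVec, Function.update_apply]
  change ‖(Matrix.toEuclideanLin (𝕜 := ℂ) (Matrix.single i j c)) x‖ ≤ _
  rw [this, PiLp.norm_single, norm_mul]
  exact mul_le_mul_of_nonneg_left (PiLp.norm_apply_le _ j) (norm_nonneg _)

open scoped Matrix.Norms.L2Operator in
theorem l2_opNorm_le_sum {m n : Type*} [Fintype m] [Fintype n] [DecidableEq m]
    [DecidableEq n] (M : Matrix m n ℂ) : ‖M‖ ≤ ∑ i, ∑ j, ‖M i j‖ := by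
  conv_lhs => rw [Matrix.matrix_eq_sum_single M]
  refine (norm_sum_le _ _).trans (Finset.sum_le_sum fun i _ => (norm_sum_le _ _).trans
    (Finset.sum_le_sum fun j _ => l2_opNorm_single_le _ _ _))

theorem mem_shell {j : ℤ} {α : ℕ} : j ∈ shell α ↔ j.natAbs = α := by
  simp only [shell, Finset.mem_insert, Finset.mem_singleton]
  omega

open scoped Matrix.Norms.L2Operator in
theorem blockNorm_nonneg (M : ℤ → ℤ → ℂ) (α β : ℕ) : 0 ≤ blockNorm M α β :=
  norm_nonneg (block M α β)

theorem norm_le_blockNorm (M : ℤ → ℤ → ℂ) (j k : ℤ) :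
    ‖M j k‖ ≤ blockNorm M j.natAbs k.natAbs :=
  norm_entry_le_l2_opNorm (block M j.natAbs k.natAbs) ⟨k, mem_shell.2 rfl⟩ ⟨j, mem_shell.2 rfl⟩

theorem sum_shell_le (f : ℤ → ℝ) (hf : ∀ k, 0 ≤ f k) (α : ℕ) :
    ∑ k : shell α, f k ≤ f α + f (-α) := by
  rw [Finset.sum_coe_sort (shell α) f, shell]
  by_cases h : (α : ℤ) = -α
  · rw [← h, Finset.pair_eq_singleton, Finset.sum_singleton]
    linarith [hf α]
  · rw [Finset.sum_pair h]

theorem blockNorm_le (M : ℤ → ℤ → ℂ) (α β : ℕ) :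
    blockNorm M α β ≤ ‖M α β‖ + ‖M α (-β)‖ + ‖M (-α) β‖ + ‖M (-α) (-β)‖ := by
  refine (l2_opNorm_le_sum _).trans ?_
  calc ∑ i : shell β, ∑ j : shell α, ‖block M α β i j‖
      ≤ ∑ i : shell β, (‖M α i‖ + ‖M (-α) i‖) :=
        Finset.sum_le_sum fun i _ => sum_shell_le (fun j => ‖M j i‖) (fun _ => norm_nonneg _) α
    _ ≤ (‖M α β‖ + ‖M (-α) β‖) + (‖M α (-β)‖ + ‖M (-α) (-β)‖) :=
        sum_shell_le (fun k => ‖M α k‖ + ‖M (-α) k‖) (fun _ => by positivity) β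
    _ = _ := by ring

theorem decayNorm_eq {d : ℕ} (s : ℝ) (A : Coef d) : decayNorm s A =
    ⨆ α : ℕ, l2 fun p : (Fin d → ℤ) × ℕ =>
      ENNReal.ofReal (wt p.1 α p.2 ^ s * blockNorm (A p.1) α p.2) := by
  rw [decayNorm]
  refine iSup_congr fun α => ?_
  rw [l2]
  congr 1
  refine tsum_congr fun p => ?_
  rw [← ENNReal.ofReal_pow (mul_nonneg (Real.rpow_nonneg (wt_pos _ _ _).le _)
    (blockNorm_nonneg _ _ _)), mul_pow, ← Real.rpow_natCast (_ ^ s), ← Real.rpow_mul (wt_pos _ _ _).le]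
  congr 3
  push_cast
  ring

theorem l2_comp_le {ι κ : Type*} {e : ι → κ} (he : Function.Injective e) (f : κ → ℝ≥0∞) :
    l2 (fun i => f (e i)) ≤ l2 f := by
  rw [le_l2_iff, l2_sq]
  exact ENNReal.tsum_comp_le_tsum_of_injective he (fun k => f k ^ 2)

theorem decayNorm_le_colN {d : ℕ} (s : ℝ) (A : Coef d) :
    decayNorm s A ≤ 4 * colN (fun l j k => ENNReal.ofReal (wt l j k ^ s)) A := by
  rw [decayNorm_eq]
  refine iSup_le fun α => ?_
  set N := colN (fun l j k => ENNReal.ofReal (wt l j k ^ s)) A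
  set F : ℤ → (Fin d → ℤ) × ℤ → ℝ≥0∞ := fun j r =>
    ENNReal.ofReal (wt r.1 j r.2 ^ s) * ‖A r.1 j r.2‖ₑ
  have hF : ∀ j, l2 (F j) ≤ N := fun j => l2_le_colN _ A j
  have hp : Function.Injective fun p : (Fin d → ℤ) × ℕ => (p.1, (p.2 : ℤ)) := by
    rintro ⟨a, b⟩ ⟨a', b'⟩ h
    simpa using h
  have hn : Function.Injective fun p : (Fin d → ℤ) × ℕ => (p.1, -(p.2 : ℤ)) := by
    rintro ⟨a, b⟩ ⟨a', b'⟩ h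
    simpa using h
  have key : ∀ p : (Fin d → ℤ) × ℕ,
      ENNReal.ofReal (wt p.1 α p.2 ^ s * blockNorm (A p.1) α p.2) ≤
      F α (p.1, (p.2 : ℤ)) + F α (p.1, -(p.2 : ℤ)) + F (-α) (p.1, (p.2 : ℤ)) +
        F (-α) (p.1, -(p.2 : ℤ)) := by
    intro p
    have hw : 0 ≤ wt p.1 α p.2 ^ s := Real.rpow_nonneg (wt_pos _ _ _).le _
    simp only [F, wt_neg_left, wt_neg_right, ← mul_add]
    rw [ENNReal.ofReal_mul hw]
    refine mul_le_mul_right ((ENNReal.ofReal_le_ofReal (blockNorm_le _ _ _)).trans (le_of_eq ?_)) _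
    rw [ENNReal.ofReal_add (by positivity) (by positivity), ENNReal.ofReal_add (by positivity)
      (by positivity), ENNReal.ofReal_add (by positivity) (by positivity)]
    simp only [ofReal_norm]
  refine (l2_mono key).trans ?_
  refine (l2_add_le _ _).trans ?_
  have e4 : (4 : ℝ≥0∞) * N = N + N + N + N := by ring
  rw [e4]
  refine add_le_add ((l2_add_le _ _).trans (add_le_add ((l2_add_le _ _).trans
    (add_le_add ?_ ?_)) ?_)) ?_
  · exact (l2_comp_le hp (F α)).trans (hF _)
  · exact (l2_comp_le hn (F α)).trans (hF _)
  · exact (l2_comp_le hp (F (-α))).trans (hF _)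
  · exact (l2_comp_le hn (F (-α))).trans (hF _)

theorem tsum_natAbs_le (g : ℕ → ℝ≥0∞) : ∑' k : ℤ, g k.natAbs ≤ 2 * ∑' n, g n := by
  rw [← Equiv.intEquivNatSumNat.symm.tsum_eq, ENNReal.summable.tsum_sum ENNReal.summable, two_mul]
  refine add_le_add (le_of_eq (tsum_congr fun n => rfl)) ?_
  exact ENNReal.tsum_comp_le_tsum_of_injective (add_left_injective 1) g

theorem colN_le_decayNorm {d : ℕ} (s : ℝ) (A : Coef d) :
    colN (fun l j k => ENNReal.ofReal (wt l j k ^ s)) A ≤ 2 * decayNorm s A := by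
  refine iSup_le fun j => ?_
  set g : (Fin d → ℤ) × ℕ → ℝ≥0∞ := fun p =>
    ENNReal.ofReal (wt p.1 j.natAbs p.2 ^ s * blockNorm (A p.1) j.natAbs p.2)
  have hg : l2 g ≤ decayNorm s A := by
    rw [decayNorm_eq]
    exact le_iSup (fun α : ℕ => l2 fun p : (Fin d → ℤ) × ℕ =>
      ENNReal.ofReal (wt p.1 α p.2 ^ s * blockNorm (A p.1) α p.2)) j.natAbs
  have h1 : ∀ r : (Fin d → ℤ) × ℤ,
      ENNReal.ofReal (wt r.1 j r.2 ^ s) * ‖A r.1 j r.2‖ₑ ≤ g (r.1, r.2.natAbs) := by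
    intro r
    have hw : 0 ≤ wt r.1 j r.2 ^ s := Real.rpow_nonneg (wt_pos _ _ _).le _
    have e : wt r.1 j.natAbs r.2.natAbs = wt r.1 j r.2 := by simp [wt]
    simp only [g, e]
    rw [← ofReal_norm, ← ENNReal.ofReal_mul hw]
    exact ENNReal.ofReal_le_ofReal (mul_le_mul_of_nonneg_left (norm_le_blockNorm _ _ _) hw)
  refine (l2_mono h1).trans (le_trans ?_ (mul_le_mul_right hg 2))
  rw [le_l2_iff, ENNReal.tsum_prod', mul_pow, l2_sq, ENNReal.tsum_prod', ← ENNReal.tsum_mul_left]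
  refine ENNReal.tsum_le_tsum fun l => (tsum_natAbs_le fun n => g (l, n) ^ 2).trans ?_
  gcongr
  norm_num

/-- The product of a smoothing weight and a decay weight. -/
def WR {d : ℕ} (v : Bool × ℤ → Bool × ℤ → ℝ) (r : ℝ) (l : Fin d → ℤ) (p q : Bool × ℤ) : ℝ≥0∞ :=
  ENNReal.ofReal (v p q * wt l p.2 q.2 ^ r)

theorem enorm_weight {d : ℕ} (σ σ' : ℝ) (A : Coef d) (l : Fin d → ℤ) (j k : ℤ) :
    ‖weight σ σ' A l j k‖ₑ = ENNReal.ofReal (jap k ^ σ * jap j ^ σ') * ‖A l j k‖ₑ := by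
  have h : ∀ (x : ℝ) (t : ℝ), ‖((jap x ^ t : ℝ) : ℂ)‖ₑ = ENNReal.ofReal (jap x ^ t) := by
    intro x t
    rw [← ofReal_norm, Complex.norm_of_nonneg (Real.rpow_nonneg (jap_pos _).le _)]
  rw [weight, enorm_mul, enorm_mul, h, h, ENNReal.ofReal_mul (Real.rpow_nonneg (jap_pos _).le _)]
  ring

theorem decayNorm_weight_le {d : ℕ} {σ σ' r : ℝ} {v : Bool × ℤ → Bool × ℤ → ℝ} {B : Coef d}
    {X : FullOp d} {c c' : Bool}
    (hv : ∀ j k : ℤ, jap k ^ σ * jap j ^ σ' ≤ v (c, j) (c', k))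
    (hB : ∀ l j k, B l j k = X l (c, j) (c', k)) :
    decayNorm r (weight σ σ' B) ≤ 4 * colN (WR v r) X := by
  refine (decayNorm_le_colN _ _).trans (mul_le_mul_right ?_ _)
  refine iSup_le fun j => ?_
  refine le_trans (l2_mono fun t => ?_) ((l2_comp_le (e := fun t : (Fin d → ℤ) × ℤ =>
    (t.1, ((c', t.2) : Bool × ℤ))) (fun a b h => ?_) _).trans (l2_le_colN (WR v r) X (c, j)))
  · rw [enorm_weight, hB, ← mul_assoc, ← ENNReal.ofReal_mul
      (Real.rpow_nonneg (wt_pos _ _ _).le _), WR, mul_comm (wt _ _ _ ^ r)]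
    refine mul_le_mul_left (ENNReal.ofReal_le_ofReal ?_) _
    exact mul_le_mul_of_nonneg_right (hv _ _) (Real.rpow_nonneg (wt_pos _ _ _).le _)
  · obtain ⟨a1, a2⟩ := a
    obtain ⟨b1, b2⟩ := b
    simpa using h

theorem colN_full_le {d : ℕ} {W : (Fin d → ℤ) → Bool × ℤ → Bool × ℤ → ℝ≥0∞}
    {Wd Wa : (Fin d → ℤ) → ℤ → ℤ → ℝ≥0∞}
    (hd : ∀ c l j k, W l (c, j) (c, k) ≤ Wd l j k) (ha : ∀ c l j k, W l (c, j) (!c, k) ≤ Wa l j k)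
    (hd' : ∀ l j k, Wd (-l) (-j) (-k) = Wd l j k) (ha' : ∀ l j k, Wa (-l) (-j) (-k) = Wa l j k)
    (A : BlockOp d) : colN W (full A) ≤ colN Wd A.1 + colN Wa A.2 := by
  have hconj : ∀ (V : (Fin d → ℤ) → ℤ → ℤ → ℝ≥0∞) (_ : ∀ l j k, V (-l) (-j) (-k) = V l j k)
      (B : Coef d) (j : ℤ), l2 (fun t : (Fin d → ℤ) × ℤ => V t.1 j t.2 * ‖conjOp B t.1 j t.2‖ₑ) ≤
        colN V B := by
    intro V hV B j
    refine le_trans (le_of_eq ?_) (l2_le_colN V B (-j))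
    rw [l2, l2]
    congr 1
    refine Eq.trans (tsum_congr fun t => ?_)
      (((Equiv.neg (Fin d → ℤ)).prodCongr (Equiv.neg ℤ)).tsum_eq _)
    simp [conjOp, hV, enorm_eq_nnnorm]
  have hsplit : ∀ f : (Fin d → ℤ) × (Bool × ℤ) → ℝ≥0∞, ∀ c : Bool,
      l2 f ≤ l2 (fun t : (Fin d → ℤ) × ℤ => f (t.1, (c, t.2))) +
        l2 (fun t : (Fin d → ℤ) × ℤ => f (t.1, (!c, t.2))) := by
    intro f c
    rw [le_l2_iff]
    calc _ = l2 (fun t : (Fin d → ℤ) × ℤ => f (t.1, (c, t.2))) ^ 2 +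
          l2 (fun t : (Fin d → ℤ) × ℤ => f (t.1, (!c, t.2))) ^ 2 := by
          rw [l2_sq, l2_sq, ENNReal.tsum_prod', ENNReal.tsum_prod', ENNReal.tsum_prod',
            ← ENNReal.tsum_add]
          refine tsum_congr fun l => ?_
          rw [ENNReal.tsum_prod' (f := fun q : Bool × ℤ => f (l, q) ^ 2), tsum_fintype,
            Fintype.sum_bool]
          cases c
          · exact add_comm _ _
          · rfl
      _ ≤ _ := by
          rw [add_sq, add_right_comm]
          exact le_self_add
  refine iSup_le fun p => ?_
  obtain ⟨c, j⟩ := p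
  refine (hsplit _ c).trans (add_le_add ?_ ?_)
  · refine (l2_mono fun t : (Fin d → ℤ) × ℤ => mul_le_mul_left (hd c t.1 j t.2) _).trans ?_
    cases c
    · exact l2_le_colN Wd A.1 j
    · simpa [full] using hconj Wd hd' A.1 j
  · refine (l2_mono fun t : (Fin d → ℤ) × ℤ => mul_le_mul_left (ha c t.1 j t.2) _).trans ?_
    cases c
    · simpa [full] using hconj Wa ha' A.2 j
    · exact l2_le_colN Wa A.2 j

theorem decayNorm_fst_le {d : ℕ} {σ σ' r : ℝ} {v : Bool × ℤ → Bool × ℤ → ℝ} {A : BlockOp d}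
    (hv : ∀ j k : ℤ, jap k ^ σ * jap j ^ σ' ≤ v (false, j) (false, k)) :
    decayNorm r (weight σ σ' A.1) ≤ 4 * colN (WR v r) (full A) :=
  decayNorm_weight_le hv fun _ _ _ => rfl

theorem decayNorm_snd_le {d : ℕ} {σ σ' r : ℝ} {v : Bool × ℤ → Bool × ℤ → ℝ} {A : BlockOp d}
    (hv : ∀ j k : ℤ, jap k ^ σ * jap j ^ σ' ≤ v (true, j) (false, k)) :
    decayNorm r (weight σ σ' A.2) ≤ 4 * colN (WR v r) (full A) :=
  decayNorm_weight_le hv fun _ _ _ => rfl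

theorem blockOpNorm_eq {d : ℕ} (r o : ℝ) (A : BlockOp d) : blockOpNorm r 1 o A =
    decayNorm r (weight 1 0 A.1) + decayNorm r (weight 0 1 A.1)
    + decayNorm r (weight o 0 A.2) + decayNorm r (weight 0 o A.2)
    + (decayNorm r (weight 1 (-1) A.1) + decayNorm r (weight 1 (-1) A.2)
    + (decayNorm r (weight (-1) 1 A.1) + decayNorm r (weight (-1) 1 A.2)
    + (decayNorm r (weight 0 0 A.1) + decayNorm r (weight 0 0 A.2)))) := by
  rw [blockOpNorm, Finset.sum_insert (by norm_num), Finset.sum_insert (by norm_num),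
    Finset.sum_singleton]
  simp

theorem blockOpNorm_le {d : ℕ} {r o : ℝ} {v : Bool × ℤ → Bool × ℤ → ℝ} {A : BlockOp d}
    (h1 : ∀ j k : ℤ, max (jap j) (jap k) ≤ v (false, j) (false, k))
    (h2 : ∀ j k : ℤ, max (jap k / jap j) (jap j / jap k) ≤ v (true, j) (false, k))
    (h3 : ∀ j k : ℤ, jap k ^ o ≤ v (true, j) (false, k))
    (h4 : ∀ j k : ℤ, jap j ^ o ≤ v (true, j) (false, k)) :
    blockOpNorm r 1 o A ≤ 40 * colN (WR v r) (full A) := by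
  have hdiv : ∀ j k : ℤ, jap k / jap j ≤ max (jap j) (jap k) := fun j k =>
    (div_le_self (jap_pos _).le (one_le_jap _)).trans (le_max_right _ _)
  have hdiv' : ∀ j k : ℤ, jap j / jap k ≤ max (jap j) (jap k) := fun j k =>
    (div_le_self (jap_pos _).le (one_le_jap _)).trans (le_max_left _ _)
  have hone : ∀ j k : ℤ, 1 ≤ v (true, j) (false, k) := fun j k => by
    refine le_trans ?_ (h2 j k)
    rcases le_total (jap j) (jap k) with h | h
    · exact ((one_le_div (jap_pos _)).2 h).trans (le_max_left _ _)
    · exact ((one_le_div (jap_pos _)).2 h).trans (le_max_right _ _)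
  rw [blockOpNorm_eq]
  set N := colN (WR v r) (full A)
  have e : (40 : ℝ≥0∞) * N = 4 * N + 4 * N + 4 * N + 4 * N + (4 * N + 4 * N + (4 * N + 4 * N +
    (4 * N + 4 * N))) := by ring
  rw [e]
  have d1 : decayNorm r (weight 1 0 A.1) ≤ 4 * N := decayNorm_fst_le fun j k => by
    simpa using (le_max_right _ _).trans (h1 j k)
  have d2 : decayNorm r (weight 0 1 A.1) ≤ 4 * N := decayNorm_fst_le fun j k => by
    simpa using (le_max_left _ _).trans (h1 j k)
  have d3 : decayNorm r (weight o 0 A.2) ≤ 4 * N := decayNorm_snd_le fun j k => by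
    simpa using h3 j k
  have d4 : decayNorm r (weight 0 o A.2) ≤ 4 * N := decayNorm_snd_le fun j k => by
    simpa using h4 j k
  have d5 : decayNorm r (weight 1 (-1) A.1) ≤ 4 * N := decayNorm_fst_le fun j k => by
    simpa [Real.rpow_neg_one, div_eq_mul_inv] using (hdiv j k).trans (h1 j k)
  have d6 : decayNorm r (weight 1 (-1) A.2) ≤ 4 * N := decayNorm_snd_le fun j k => by
    simpa [Real.rpow_neg_one, div_eq_mul_inv] using (le_max_left _ _).trans (h2 j k)
  have d7 : decayNorm r (weight (-1) 1 A.1) ≤ 4 * N := decayNorm_fst_le fun j k => by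
    simpa [Real.rpow_neg_one, div_eq_mul_inv, mul_comm] using (hdiv' j k).trans (h1 j k)
  have d8 : decayNorm r (weight (-1) 1 A.2) ≤ 4 * N := decayNorm_snd_le fun j k => by
    simpa [Real.rpow_neg_one, div_eq_mul_inv, mul_comm] using (le_max_right _ _).trans (h2 j k)
  have d9 : decayNorm r (weight 0 0 A.1) ≤ 4 * N := decayNorm_fst_le fun j k => by
    simpa using (one_le_jap j).trans ((le_max_left _ _).trans (h1 j k))
  have d10 : decayNorm r (weight 0 0 A.2) ≤ 4 * N := decayNorm_snd_le fun j k => by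
    simpa using hone j k
  gcongr

theorem blockOpNorm_one_zero_le {d : ℕ} (r : ℝ) (A : BlockOp d) :
    blockOpNorm r 1 0 A ≤ 40 * colN (WR vZero r) (full A) :=
  blockOpNorm_le (fun _ _ => by simp [vZero]) (fun _ _ => by simp [vZero])
    (fun _ _ => by simpa using one_le_vZero _ _) (fun _ _ => by simpa using one_le_vZero _ _)

theorem blockOpNorm_one_one_le {d : ℕ} (r : ℝ) (A : BlockOp d) :
    blockOpNorm r 1 1 A ≤ 40 * colN (WR vOne r) (full A) :=
  blockOpNorm_le (fun _ _ => by simp [vOne])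
    (fun j k => le_trans (by simp [vZero]) (vZero_le_vOne (true, j) (false, k)))
    (fun _ _ => by simp [vOne]) (fun _ _ => by simp [vOne])

theorem colN_weight_le {d : ℕ} {σ σ' σ₂ σ₂' r : ℝ} {V : ℤ → ℤ → ℝ} {A : Coef d}
    (h : ∀ j k : ℤ, V j k ≤ jap k ^ σ * jap j ^ σ' + jap k ^ σ₂ * jap j ^ σ₂') :
    colN (fun l j k => ENNReal.ofReal (V j k * wt l j k ^ r)) A ≤
      2 * (decayNorm r (weight σ σ' A) + decayNorm r (weight σ₂ σ₂' A)) := by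
  rw [mul_add]
  refine le_trans (colN_le_add fun l j k => ?_)
    (add_le_add (colN_le_decayNorm r (weight σ σ' A)) (colN_le_decayNorm r (weight σ₂ σ₂' A)))
  have hp : ∀ x t : ℝ, 0 ≤ jap x ^ t := fun x t => Real.rpow_nonneg (jap_pos _).le _
  have hw : 0 ≤ wt l j k ^ r := Real.rpow_nonneg (wt_pos _ _ _).le _
  rw [enorm_weight, enorm_weight, ← mul_assoc, ← mul_assoc, ← add_mul, ← mul_add,
    ← ENNReal.ofReal_add (mul_nonneg (hp _ _) (hp _ _)) (mul_nonneg (hp _ _) (hp _ _)),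
    ← ENNReal.ofReal_mul hw, mul_comm (wt l j k ^ r)]
  exact mul_le_mul_left (ENNReal.ofReal_le_ofReal (mul_le_mul_of_nonneg_right (h j k) hw)) _

theorem colN_full_le_blockOpNorm {d : ℕ} (r : ℝ) (A : BlockOp d) :
    colN (WR vZero r) (full A) ≤ 2 * blockOpNorm r 1 0 A := by
  refine (colN_full_le
    (Wd := fun l j k => ENNReal.ofReal (max (jap j) (jap k) * wt l j k ^ r))
    (Wa := fun l j k => ENNReal.ofReal (max (jap k / jap j) (jap j / jap k) * wt l j k ^ r))
    (fun c l j k => by simp [WR, vZero]) (fun c l j k => by simp [WR, vZero])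
    (fun l j k => by simp [jap_neg, wt_neg, wt_neg_left, wt_neg_right])
    (fun l j k => by simp [jap_neg, wt_neg, wt_neg_left, wt_neg_right]) A).trans ?_
  refine (add_le_add
    (colN_weight_le (V := fun j k => max (jap j) (jap k)) (σ := 1) (σ' := 0) (σ₂ := 0) (σ₂' := 1)
      fun j k => ?_)
    (colN_weight_le (V := fun j k => max (jap k / jap j) (jap j / jap k)) (σ := 1) (σ' := -1)
      (σ₂ := -1) (σ₂' := 1) fun j k => ?_)).trans ?_
  · simp only [Real.rpow_one, Real.rpow_zero, mul_one, one_mul]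
    exact max_le (le_add_of_nonneg_left (jap_pos _).le) (le_add_of_nonneg_right (jap_pos _).le)
  · simp only [Real.rpow_one, Real.rpow_neg_one, ← div_eq_mul_inv, inv_mul_eq_div]
    exact max_le (le_add_of_nonneg_right (div_nonneg (jap_pos _).le (jap_pos _).le))
      (le_add_of_nonneg_left (div_nonneg (jap_pos _).le (jap_pos _).le))
  · rw [← mul_add, blockOpNorm_eq]
    refine mul_le_mul_right ?_ 2
    set a := decayNorm r (weight 1 0 A.1)
    set b := decayNorm r (weight 0 1 A.1)
    set x := decayNorm r (weight 1 (-1) A.2)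
    set y := decayNorm r (weight (-1) 1 A.2)
    calc a + b + (x + y) ≤ a + b + (x + y) + (decayNorm r (weight 0 0 A.2) +
          decayNorm r (weight 0 0 A.2) + decayNorm r (weight 1 (-1) A.1) +
          decayNorm r (weight (-1) 1 A.1) + decayNorm r (weight 0 0 A.1) +
          decayNorm r (weight 0 0 A.2)) := le_self_add
      _ = _ := by ring

theorem full_add {d : ℕ} (A B : BlockOp d) : full (A + B) = full A + full B := by
  funext l p q
  obtain ⟨c, j⟩ := p
  obtain ⟨c', k⟩ := q
  cases c <;> cases c' <;> simp [full, conjOp] <;> ring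

theorem full_sub {d : ℕ} (A B : BlockOp d) : full (A - B) = full A - full B := by
  rw [eq_sub_iff_add_eq, ← full_add, sub_add_cancel]

section Wgt

variable {d : ℕ} {v : Bool × ℤ → Bool × ℤ → ℝ} {lo hi lam : ℝ}

theorem colN_WR_lo_le (hv : ∀ p q, 0 ≤ v p q) (hl : 0 ≤ lam) (X : FullOp d) :
    colN (WR v lo) X ≤ colN (Wgt v lo hi lam) X :=
  colN_mono fun _ _ _ => mul_le_mul_left (ENNReal.ofReal_le_ofReal (mul_le_mul_of_nonneg_left
    (le_add_of_nonneg_right (mul_nonneg hl (Real.rpow_nonneg (wt_pos _ _ _).le _))) (hv _ _))) _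

theorem colN_WR_hi_le (hv : ∀ p q, 0 ≤ v p q) (hl : 0 < lam) (X : FullOp d) :
    colN (WR v hi) X ≤ ENNReal.ofReal lam⁻¹ * colN (Wgt v lo hi lam) X :=
  colN_le_mul fun l p q => by
    rw [← mul_assoc, WR, Wgt, ← ENNReal.ofReal_mul (by positivity)]
    refine mul_le_mul_left (ENNReal.ofReal_le_ofReal ?_) _
    have h1 : 0 ≤ wt l p.2 q.2 ^ lo := Real.rpow_nonneg (wt_pos _ _ _).le _
    calc v p q * wt l p.2 q.2 ^ hi = v p q * (lam⁻¹ * (lam * wt l p.2 q.2 ^ hi)) := by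
          rw [inv_mul_cancel_left₀ hl.ne']
      _ ≤ v p q * (lam⁻¹ * wtSum lo hi lam l p.2 q.2) := by
          refine mul_le_mul_of_nonneg_left (mul_le_mul_of_nonneg_left ?_ (by positivity)) (hv _ _)
          exact le_add_of_nonneg_left h1
      _ = _ := by ring

theorem colN_Wgt_le (hv : ∀ p q, 0 ≤ v p q) (hl : 0 ≤ lam) (X : FullOp d) :
    colN (Wgt v lo hi lam) X ≤ colN (WR v lo) X + ENNReal.ofReal lam * colN (WR v hi) X := by
  have h : colN (fun l p q => ENNReal.ofReal lam * WR v hi l p q) X ≤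
      ENNReal.ofReal lam * colN (WR v hi) X := colN_le_mul fun l p q => (mul_assoc _ _ _).le
  refine le_trans (colN_le_add fun l p q => ?_) (add_le_add le_rfl h)
  rw [← add_mul, Wgt, WR, WR, wtSum, ← ENNReal.ofReal_mul hl, ← ENNReal.ofReal_add
    (mul_nonneg (hv _ _) (Real.rpow_nonneg (wt_pos _ _ _).le _))
    (mul_nonneg hl (mul_nonneg (hv _ _) (Real.rpow_nonneg (wt_pos _ _ _).le _)))]
  refine le_of_eq ?_
  congr 2
  ring

variable {γ : ℝ} {O : Set (Freq d)} (A : Freq d → BlockOp d)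

theorem lipN_one_lo_le (hl : 0 ≤ lam) : lipN γ O lo 1 1 A ≤
    40 * lipNorm γ O (colN (Wgt vOne lo hi lam)) (fun ω => full (A ω)) :=
  have h : ∀ B : BlockOp d, blockOpNorm lo 1 1 B ≤ 40 * colN (Wgt vOne lo hi lam) (full B) :=
    fun B => (blockOpNorm_one_one_le lo B).trans (mul_le_mul_right
      (colN_WR_lo_le (fun p q => zero_le_one.trans (one_le_vOne p q)) hl _) _)
  lipNorm_le_mul (fun _ _ => h _) fun _ _ _ _ _ => by rw [← full_sub]; exact h _

theorem lipN_one_hi_le (hl : 0 < lam) : lipN γ O hi 1 1 A ≤ 40 * ENNReal.ofReal lam⁻¹ *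
    lipNorm γ O (colN (Wgt vOne lo hi lam)) (fun ω => full (A ω)) :=
  have h : ∀ B : BlockOp d, blockOpNorm hi 1 1 B ≤ 40 * ENNReal.ofReal lam⁻¹ *
      colN (Wgt vOne lo hi lam) (full B) :=
    fun B => (blockOpNorm_one_one_le hi B).trans (by
      rw [mul_assoc]
      exact mul_le_mul_right
        (colN_WR_hi_le (fun p q => zero_le_one.trans (one_le_vOne p q)) hl _) _)
  lipNorm_le_mul (fun _ _ => h _) fun _ _ _ _ _ => by rw [← full_sub]; exact h _

theorem lipNorm_full_le (hl : 0 ≤ lam) :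
    lipNorm γ O (colN (Wgt vZero lo hi lam)) (fun ω => full (A ω)) ≤
      2 * (lipN γ O lo 1 0 A + ENNReal.ofReal lam * lipN γ O hi 1 0 A) := by
  have hv : ∀ p q, 0 ≤ vZero p q := fun p q => zero_le_one.trans (one_le_vZero p q)
  have h : ∀ B : BlockOp d, colN (Wgt vZero lo hi lam) (full B) ≤
      2 * blockOpNorm lo 1 0 B + 2 * ENNReal.ofReal lam * blockOpNorm hi 1 0 B := fun B => by
    refine (colN_Wgt_le hv hl _).trans (add_le_add (colN_full_le_blockOpNorm lo B) ?_)
    rw [mul_comm 2, mul_assoc]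
    exact mul_le_mul_right (colN_full_le_blockOpNorm hi B) _
  refine (lipNorm_le_add (N₁ := fun B => 2 * blockOpNorm lo 1 0 B)
    (N₂ := fun B => 2 * ENNReal.ofReal lam * blockOpNorm hi 1 0 B) (f₁ := A) (f₂ := A)
    (fun _ _ => h _) fun _ _ _ _ _ => by rw [← full_sub]; exact h _).trans ?_
  rw [mul_add, ← mul_assoc]
  exact add_le_add (lipNorm_le_mul (fun _ _ => le_rfl) fun _ _ _ _ _ => le_rfl)
    (lipNorm_le_mul (fun _ _ => le_rfl) fun _ _ _ _ _ => le_rfl)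

end Wgt

/-! ### The symmetries of the class of Hamiltonian operator matrices -/

section Symmetry

variable {d : ℕ}

/-- The index of the complex conjugate of a basis function in the other component. -/
def flip (p : Bool × ℤ) : Bool × ℤ := (!p.1, -p.2)

theorem flip_flip (p : Bool × ℤ) : flip (flip p) = p := by simp [flip]

/-- `flip` as a permutation. -/
def flipEquiv : Bool × ℤ ≃ Bool × ℤ := ⟨flip, flip, flip_flip, flip_flip⟩

/-- The sign of a component. -/
def sgn (p : Bool × ℤ) : ℂ := if p.1 then -1 else 1

theorem sgn_mul_self (p : Bool × ℤ) : sgn p * sgn p = 1 := by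
  rw [sgn]; split_ifs <;> simp

/-- The conjugation by the antilinear involution exchanging the components. -/
def conjFull (X : FullOp d) : FullOp d := fun l p q => star (X (-l) (flip p) (flip q))

/-- The adjoint with respect to the indefinite form `diag(1, -1)`. -/
def dag (X : FullOp d) : FullOp d := fun l p q => sgn p * sgn q * star (X (-l) q p)

theorem conjFull_comp (X Y : FullOp d) :
    conjFull (comp X Y) = comp (conjFull X) (conjFull Y) := by
  funext l p q
  simp only [conjFull, comp]
  rw [← ((Equiv.neg (Fin d → ℤ)).prodCongr flipEquiv).tsum_eq]
  refine (tsum_star).trans (tsum_congr fun r => ?_)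
  simp only [Equiv.prodCongr_apply, Prod.map, Equiv.neg_apply, flipEquiv, Equiv.coe_fn_mk,
    star_mul', neg_sub, sub_neg_eq_add]
  rw [neg_add_eq_sub]

theorem dag_comp (X Y : FullOp d) : dag (comp X Y) = comp (dag Y) (dag X) := by
  funext l p q
  simp only [dag, comp]
  rw [← ((Equiv.subRight l).prodCongr (Equiv.refl (Bool × ℤ))).tsum_eq]
  refine (congrArg (fun x => sgn p * sgn q * x) tsum_star).trans ?_
  rw [← tsum_mul_left]
  refine tsum_congr fun r => ?_
  simp only [Equiv.prodCongr_apply, Prod.map, Equiv.subRight_apply, Equiv.refl_apply, star_mul',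
    neg_sub]
  rw [show -l - (r.1 - l) = -r.1 by abel]
  linear_combination (-(sgn p * sgn q * star (X (-r.1) r.2 p) * star (Y (r.1 - l) q r.2))) *
    sgn_mul_self r.2

theorem conjFull_sub (X Y : FullOp d) : conjFull (X - Y) = conjFull X - conjFull Y := by
  funext l p q; simp [conjFull]

theorem dag_sub (X Y : FullOp d) : dag (X - Y) = dag X - dag Y := by
  funext l p q; simp [dag, mul_sub]

theorem conjFull_smul (c : ℂ) (X : FullOp d) : conjFull (c • X) = star c • conjFull X := by
  funext l p q; simp [conjFull]

theorem dag_smul (c : ℂ) (X : FullOp d) : dag (c • X) = star c • dag X := by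
  funext l p q; simp [dag, mul_left_comm]

/-- The operator matrices in the class, up to finiteness of the norm. -/
structure IsHam (X : FullOp d) : Prop where
  conj : conjFull X = -X
  dag : dag X = X

theorem neg_comp (X Y : FullOp d) : comp (-X) Y = -comp X Y := by
  have := smul_comp (-1) X Y
  simpa using this

theorem comp_neg (X Y : FullOp d) : comp X (-Y) = -comp X Y := by
  have := comp_smul (-1) X Y
  simpa using this

theorem IsHam.commKer {U X : FullOp d} (hU : IsHam U) (hX : IsHam X) :
    IsHam (commKer ((-Complex.I) • U) X) := by
  have hc : conjFull ((-Complex.I) • U) = (-Complex.I) • U := by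
    rw [conjFull_smul, hU.conj]; simp
  have hd : WaveKAM.dag ((-Complex.I) • U) = -((-Complex.I) • U) := by
    rw [dag_smul, hU.dag]; simp
  constructor
  · rw [WaveKAM.commKer, conjFull_sub, conjFull_comp, conjFull_comp, hc, hX.conj, neg_comp,
      comp_neg]
    abel
  · rw [WaveKAM.commKer, dag_sub, dag_comp, dag_comp, hd, hX.dag, neg_comp, comp_neg]
    abel

theorem IsHam.iterate {U X : FullOp d} (hU : IsHam U) (hX : IsHam X) (k : ℕ) :
    IsHam ((WaveKAM.commKer ((-Complex.I) • U))^[k] X) := by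
  induction k with
  | zero => exact hX
  | succ k ih =>
    rw [Function.iterate_succ_apply']
    exact hU.commKer ih

theorem IsHam.lieRemainder {U P g : FullOp d} (hU : IsHam U) (hP : IsHam P) (hg : IsHam g) :
    IsHam (lieRemainder ((-Complex.I) • U) P g) := by
  have e1 : ∀ (k n : ℕ) l p q, star (((n.factorial : ℂ)⁻¹) *
      (WaveKAM.commKer ((-Complex.I) • U))^[k] P l p q) =
      ((n.factorial : ℂ)⁻¹) * star ((WaveKAM.commKer ((-Complex.I) • U))^[k] P l p q) := by
    intro k n l p q; simp
  have e2 : ∀ (k n : ℕ) l p q, star (((n.factorial : ℂ)⁻¹) *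
      (WaveKAM.commKer ((-Complex.I) • U))^[k] g l p q) =
      ((n.factorial : ℂ)⁻¹) * star ((WaveKAM.commKer ((-Complex.I) • U))^[k] g l p q) := by
    intro k n l p q; simp
  constructor
  · funext l p q
    have h1 : ∀ k, star ((WaveKAM.commKer ((-Complex.I) • U))^[k] P (-l) (flip p) (flip q)) =
        -(WaveKAM.commKer ((-Complex.I) • U))^[k] P l p q := fun k =>
      congrFun (congrFun (congrFun (hU.iterate hP k).conj l) p) q
    have h2 : ∀ k, star ((WaveKAM.commKer ((-Complex.I) • U))^[k] g (-l) (flip p) (flip q)) =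
        -(WaveKAM.commKer ((-Complex.I) • U))^[k] g l p q := fun k =>
      congrFun (congrFun (congrFun (hU.iterate hg k).conj l) p) q
    simp only [conjFull, WaveKAM.lieRemainder, Pi.neg_apply]
    rw [tsum_star, ← tsum_neg]
    refine tsum_congr fun k => ?_
    rw [star_add, e1, e2, h1, h2]
    ring
  · funext l p q
    have h1 : ∀ k, sgn p * sgn q * star ((WaveKAM.commKer ((-Complex.I) • U))^[k] P (-l) q p) =
        (WaveKAM.commKer ((-Complex.I) • U))^[k] P l p q := fun k =>
      congrFun (congrFun (congrFun (hU.iterate hP k).dag l) p) q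
    have h2 : ∀ k, sgn p * sgn q * star ((WaveKAM.commKer ((-Complex.I) • U))^[k] g (-l) q p) =
        (WaveKAM.commKer ((-Complex.I) • U))^[k] g l p q := fun k =>
      congrFun (congrFun (congrFun (hU.iterate hg k).dag l) p) q
    simp only [WaveKAM.dag, WaveKAM.lieRemainder]
    rw [tsum_star, ← tsum_mul_left]
    refine tsum_congr fun k => ?_
    rw [star_add, e1, e2, mul_add, mul_left_comm, h1, mul_left_comm (sgn p * sgn q), h2]

/-- The pair of operators with a given operator matrix. -/
def unfull (X : FullOp d) : BlockOp d :=
  (fun l j k => X l (false, j) (false, k), fun l j k => X l (true, j) (false, k))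

theorem full_unfull {X : FullOp d} (h : conjFull X = -X) : full (unfull X) = X := by
  funext l p q
  obtain ⟨c, j⟩ := p
  obtain ⟨c', k⟩ := q
  have h1 := congrFun (congrFun (congrFun h l) (c, j)) (c', k)
  simp only [conjFull, flip, Pi.neg_apply] at h1
  cases c <;> cases c' <;> simp_all [full, unfull, conjOp]

theorem conjFull_full (A : BlockOp d) : conjFull (full A) = -full A := by
  funext l p q
  obtain ⟨c, j⟩ := p
  obtain ⟨c', k⟩ := q
  cases c <;> cases c' <;> simp [full, conjOp, conjFull, flip]

theorem isHam_full_iff (A : BlockOp d) :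
    IsHam (full A) ↔ adjOp A.1 = A.1 ∧ adjOp A.2 = conjOp A.2 := by
  constructor
  · intro h
    constructor
    · funext l j k
      have := congrFun (congrFun (congrFun h.dag l) (false, j)) (false, k)
      simpa [dag, full, sgn, adjOp] using this
    · funext l j k
      have := congrFun (congrFun (congrFun h.dag (-l)) (true, -j)) (false, -k)
      simp only [dag, full, sgn, conjOp] at this
      simp only [adjOp, conjOp]
      rw [← this]
      simp
  · rintro ⟨h1, h2⟩
    refine ⟨conjFull_full A, ?_⟩
    funext l p q
    obtain ⟨c, j⟩ := p
    obtain ⟨c', k⟩ := q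
    have e1 : ∀ l j k, star (A.1 (-l) k j) = A.1 l j k := fun l j k =>
      congrFun (congrFun (congrFun h1 l) j) k
    have e2 : ∀ l j k, star (A.2 (-l) k j) = star (A.2 (-l) (-j) (-k)) := fun l j k =>
      congrFun (congrFun (congrFun h2 l) j) k
    have e3 : ∀ l j k, A.2 l k j = A.2 l (-j) (-k) := fun l j k => by
      have := congrArg star (e2 (-l) j k)
      simpa using this
    cases c <;> cases c'
    · simpa [dag, full, sgn] using e1 l j k
    · simpa [dag, full, sgn, conjOp] using e2 l j k
    · simpa [dag, full, sgn, conjOp] using (e3 l k j).symm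
    · have := e1 (-l) (-j) (-k)
      simp only [neg_neg] at this
      simp [dag, full, sgn, conjOp, ← this]

theorem memN_iff {s ρ o : ℝ} (A : BlockOp d) :
    MemN s ρ o A ↔ IsHam (full A) ∧ blockOpNorm s ρ o A < ⊤ := by
  rw [isHam_full_iff, MemN, and_assoc]

/-- The matrix of the operator `[[M, 0], [0, -conj M]]`. -/
def hamMat (M : ℤ → ℤ → ℂ) (p q : Bool × ℤ) : ℂ :=
  if p.1 = q.1 then (if p.1 then -star (M (-p.2) (-q.2)) else M p.2 q.2) else 0

theorem full_constOp (M : ℤ → ℤ → ℂ) : full (constOp (d := d) M) = constKer (Fin d → ℤ) (hamMat M) := by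
  funext l p q
  obtain ⟨c, j⟩ := p
  obtain ⟨c', k⟩ := q
  by_cases hl : l = 0 <;> cases c <;> cases c' <;>
    simp [full, constOp, conjOp, constKer, hamMat, hl]

theorem hamMat_eq_zero {M : ℤ → ℤ → ℂ} (hM : IsBlockDiag M) (p q : Bool × ℤ)
    (h : q ∉ shellOf p) : hamMat M p q = 0 := by
  rw [mem_shellOf] at h
  rw [hamMat]
  split_ifs with h1 h2
  · rw [hM _ _ (by simpa using fun h3 => h ⟨h1.symm, h3.symm⟩), star_zero, neg_zero]
  · exact hM _ _ fun h3 => h ⟨h1.symm, h3.symm⟩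
  · rfl

theorem hamMat_flip (M : ℤ → ℤ → ℂ) (p q : Bool × ℤ) :
    star (hamMat M (flip p) (flip q)) = -hamMat M p q := by
  obtain ⟨c, j⟩ := p
  obtain ⟨c', k⟩ := q
  cases c <;> cases c' <;> simp [hamMat, flip]

theorem star_hamMat {M : ℤ → ℤ → ℂ} (hM : ∀ j k, star (M k j) = M j k) (p q : Bool × ℤ) :
    star (hamMat M q p) = hamMat M p q := by
  obtain ⟨c, j⟩ := p
  obtain ⟨c', k⟩ := q
  cases c <;> cases c' <;> simp [hamMat]
  · exact hM j k
  · have := hM (-j) (-k)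
    rw [← this]
    simp

end Symmetry

/-! ### The Sylvester equation with Hermitian coefficients -/

section Sylvester

open Matrix

variable {m n : Type*} [Fintype m] [Fintype n] [DecidableEq m] [DecidableEq n]

theorem sum_norm_sq_eq_trace {m n : Type*} [Fintype m] [Fintype n] (X : Matrix m n ℂ) :
    ((∑ i, ∑ j, ‖X i j‖ ^ 2 : ℝ) : ℂ) = (Xᴴ * X).trace := by
  simp only [trace, diag, mul_apply, conjTranspose_apply]
  rw [Finset.sum_comm]
  push_cast
  refine Finset.sum_congr rfl fun i _ => Finset.sum_congr rfl fun j _ => ?_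
  rw [← Complex.conj_mul']
  rfl

theorem sum_norm_sq_unitary {U : Matrix m m ℂ} {V : Matrix n n ℂ}
    (hU : U * star U = 1) (hV : V * star V = 1) (X : Matrix m n ℂ) :
    ∑ i, ∑ j, ‖(star U * X * V) i j‖ ^ 2 = ∑ i, ∑ j, ‖X i j‖ ^ 2 := by
  have h : ((∑ i, ∑ j, ‖(star U * X * V) i j‖ ^ 2 : ℝ) : ℂ) =
      ((∑ i, ∑ j, ‖X i j‖ ^ 2 : ℝ) : ℂ) := by
    rw [sum_norm_sq_eq_trace, sum_norm_sq_eq_trace]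
    simp only [conjTranspose_mul, star_eq_conjTranspose, conjTranspose_conjTranspose] at hU hV ⊢
    calc _ = (Vᴴ * (Xᴴ * (U * Uᴴ) * X * V)).trace := by simp only [Matrix.mul_assoc]
      _ = ((Xᴴ * (U * Uᴴ) * X * V) * Vᴴ).trace := trace_mul_comm _ _
      _ = (Xᴴ * (U * Uᴴ) * X * (V * Vᴴ)).trace := by simp only [Matrix.mul_assoc]
      _ = _ := by rw [hU, hV]; simp
  exact_mod_cast h

theorem sylvester_lower_bound {A : Matrix m m ℂ} {B : Matrix n n ℂ} (hA : A.IsHermitian)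
    (hB : B.IsHermitian) {c δ : ℝ} (hδ : 0 ≤ δ)
    (h : ∀ a b : ℝ, (a : ℂ) ∈ spectrum ℂ A → (b : ℂ) ∈ spectrum ℂ B → δ ≤ |c + a - b|)
    (X : Matrix m n ℂ) :
    δ ^ 2 * ∑ i, ∑ j, ‖X i j‖ ^ 2 ≤ ∑ i, ∑ j, ‖((c : ℂ) • X + A * X - X * B) i j‖ ^ 2 := by
  set U : Matrix m m ℂ := (hA.eigenvectorUnitary : Matrix m m ℂ)
  set V : Matrix n n ℂ := (hB.eigenvectorUnitary : Matrix n n ℂ)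
  have hU : U * star U = 1 := Unitary.mul_star_self_of_mem hA.eigenvectorUnitary.2
  have hV : V * star V = 1 := Unitary.mul_star_self_of_mem hB.eigenvectorUnitary.2
  have hU' : star U * U = 1 := Unitary.star_mul_self_of_mem hA.eigenvectorUnitary.2
  have hV' : star V * V = 1 := Unitary.star_mul_self_of_mem hB.eigenvectorUnitary.2
  have hA' : A = U * diagonal (fun i => (hA.eigenvalues i : ℂ)) * star U := by
    conv_lhs => rw [hA.spectral_theorem, Unitary.conjStarAlgAut_apply]
    rfl
  have hB' : B = V * diagonal (fun i => (hB.eigenvalues i : ℂ)) * star V := by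
    conv_lhs => rw [hB.spectral_theorem, Unitary.conjStarAlgAut_apply]
    rfl
  have e1 : star U * A = diagonal (fun i => (hA.eigenvalues i : ℂ)) * star U := by
    conv_lhs => rw [hA']
    rw [Matrix.mul_assoc U, ← Matrix.mul_assoc (star U), hU', Matrix.one_mul]
  have e2 : B * V = V * diagonal (fun i => (hB.eigenvalues i : ℂ)) := by
    conv_lhs => rw [hB']
    rw [Matrix.mul_assoc, hV', Matrix.mul_one]
  have key : star U * ((c : ℂ) • X + A * X - X * B) * V = (c : ℂ) • (star U * X * V) +
      diagonal (fun i => (hA.eigenvalues i : ℂ)) * (star U * X * V) -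
      (star U * X * V) * diagonal (fun i => (hB.eigenvalues i : ℂ)) := by
    rw [Matrix.mul_sub, Matrix.mul_add, Matrix.sub_mul, Matrix.add_mul, ← Matrix.mul_assoc (star U) A,
      e1]
    simp only [Matrix.mul_assoc, e2, Matrix.mul_smul, Matrix.smul_mul]
  rw [← sum_norm_sq_unitary hU hV X, ← sum_norm_sq_unitary hU hV (_ - _), key, Finset.mul_sum]
  refine Finset.sum_le_sum fun i _ => ?_
  rw [Finset.mul_sum]
  refine Finset.sum_le_sum fun j _ => ?_
  set y := (star U * X * V) i j with hy
  have hent : ((c : ℂ) • (star U * X * V) +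
      diagonal (fun i => (hA.eigenvalues i : ℂ)) * (star U * X * V) -
      (star U * X * V) * diagonal (fun i => (hB.eigenvalues i : ℂ))) i j =
      ((c + hA.eigenvalues i - hB.eigenvalues j : ℝ) : ℂ) * y := by
    rw [Matrix.sub_apply, Matrix.add_apply, Matrix.smul_apply, diagonal_mul, mul_diagonal, ← hy]
    push_cast
    rw [smul_eq_mul]
    ring
  rw [hent, norm_mul, mul_pow, Complex.norm_real, Real.norm_eq_abs]
  have hspecA : (hA.eigenvalues i : ℂ) ∈ spectrum ℂ A := by
    rw [hA.spectrum_eq_image_range]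
    exact ⟨_, ⟨i, rfl⟩, rfl⟩
  have hspecB : (hB.eigenvalues j : ℂ) ∈ spectrum ℂ B := by
    rw [hB.spectrum_eq_image_range]
    exact ⟨_, ⟨j, rfl⟩, rfl⟩
  exact mul_le_mul_of_nonneg_right (pow_le_pow_left₀ hδ (h _ _ hspecA hspecB) 2) (by positivity)

theorem sylvester_entry_le {A : Matrix m m ℂ} {B : Matrix n n ℂ} (hA : A.IsHermitian)
    (hB : B.IsHermitian) {c δ : ℝ} (hδ : 0 < δ)
    (h : ∀ a b : ℝ, (a : ℂ) ∈ spectrum ℂ A → (b : ℂ) ∈ spectrum ℂ B → δ ≤ |c + a - b|)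
    (X : Matrix m n ℂ) (i : m) (j : n) :
    δ * ‖X i j‖ ≤ ∑ i, ∑ j, ‖((c : ℂ) • X + A * X - X * B) i j‖ := by
  have h1 := sylvester_lower_bound hA hB hδ.le h X
  refine (pow_le_pow_iff_left₀ (by positivity) (by positivity) two_ne_zero).1 ?_
  rw [mul_pow]
  refine (mul_le_mul_of_nonneg_left ?_ (sq_nonneg δ)).trans (h1.trans ?_)
  · exact (Finset.single_le_sum (f := fun j => ‖X i j‖ ^ 2) (fun _ _ => by positivity)
      (Finset.mem_univ j)).trans (Finset.single_le_sum (f := fun i => ∑ j, ‖X i j‖ ^ 2)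
      (fun _ _ => by positivity) (Finset.mem_univ i))
  · exact (Finset.sum_le_sum fun i _ => Finset.sum_sq_le_sq_sum_of_nonneg fun _ _ => norm_nonneg _).trans
      (Finset.sum_sq_le_sq_sum_of_nonneg fun _ _ => by positivity)

theorem sylvester_surjective {A : Matrix m m ℂ} {B : Matrix n n ℂ} (hA : A.IsHermitian)
    (hB : B.IsHermitian) {c δ : ℝ} (hδ : 0 < δ)
    (h : ∀ a b : ℝ, (a : ℂ) ∈ spectrum ℂ A → (b : ℂ) ∈ spectrum ℂ B → δ ≤ |c + a - b|)
    (Y : Matrix m n ℂ) : ∃ X : Matrix m n ℂ, (c : ℂ) • X + A * X - X * B = Y := by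
  let L : Matrix m n ℂ →ₗ[ℂ] Matrix m n ℂ :=
    { toFun := fun X => (c : ℂ) • X + A * X - X * B
      map_add' := fun X Y => by rw [Matrix.mul_add, Matrix.add_mul, smul_add]; abel
      map_smul' := fun t X => by
        simp only [Matrix.mul_smul, Matrix.smul_mul, RingHom.id_apply, smul_add, smul_sub,
          smul_comm t] }
  have hinj : Function.Injective L := by
    rw [← LinearMap.ker_eq_bot, LinearMap.ker_eq_bot']
    intro X hX
    ext i j
    have := sylvester_entry_le hA hB hδ h X i j
    have hz : (c : ℂ) • X + A * X - X * B = 0 := hX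
    rw [hz] at this
    simp only [Matrix.zero_apply, norm_zero, Finset.sum_const_zero] at this
    have h0 : ‖X i j‖ ≤ 0 := nonpos_of_mul_nonpos_right this hδ
    simpa using h0
  exact LinearMap.injective_iff_surjective.1 hinj Y

end Sylvester

/-! ### The homological equation -/

section Homological

variable {d : ℕ} {M : ℤ → ℤ → ℂ} {ω : Freq d}

theorem shellOf_congr {p p' : Bool × ℤ} (h : p' ∈ shellOf p) : shellOf p' = shellOf p := by
  rw [mem_shellOf] at h
  ext r
  rw [mem_shellOf, mem_shellOf, h.1, h.2]

theorem self_mem_shellOf (p : Bool × ℤ) : p ∈ shellOf p := mem_shellOf.2 ⟨rfl, rfl⟩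

/-- The diagonal blocks of `hamMat M`. -/
def hamBlk (M : ℤ → ℤ → ℂ) (p : Bool × ℤ) : Matrix (shellOf p) (shellOf p) ℂ :=
  Matrix.of fun k j => hamMat M j k

theorem hamBlk_isHermitian (hM : ∀ j k, star (M k j) = M j k) (p : Bool × ℤ) :
    (hamBlk M p).IsHermitian := by
  ext k j
  exact star_hamMat hM _ _

/-- The divisors of the homological equation at `(p, q)` are at least `δ`. -/
def IsGap (M : ℤ → ℤ → ℂ) (x : ℝ) (p q : Bool × ℤ) (δ : ℝ) : Prop :=
  ∀ a b : ℝ, (a : ℂ) ∈ spectrum ℂ (hamBlk M q) → (b : ℂ) ∈ spectrum ℂ (hamBlk M p) →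
    δ ≤ |x + a - b|

theorem der_apply_eq_sylvester (X : FullOp d) (l : Fin d → ℤ) (p q : Bool × ℤ) (i : shellOf q)
    (j : shellOf p) :
    (((dotZ ω l : ℝ) : ℂ) • (Matrix.of fun (i : shellOf q) (j : shellOf p) => X l j i) +
      hamBlk M q * (Matrix.of fun (i : shellOf q) (j : shellOf p) => X l j i) -
      (Matrix.of fun (i : shellOf q) (j : shellOf p) => X l j i) * hamBlk M p) i j =
    der shellOf (hamMat M) (dotHom ω) X l j i := by
  rw [der, Pi.add_apply, Pi.add_apply, Pi.add_apply, Pi.sub_apply, Pi.sub_apply, Pi.sub_apply, lact,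
    ract, shellOf_congr i.2, shellOf_congr j.2, Matrix.sub_apply, Matrix.add_apply,
    Matrix.mul_apply, Matrix.mul_apply, Matrix.smul_apply]
  rw [← Finset.sum_coe_sort (shellOf q), ← Finset.sum_coe_sort (shellOf p), add_comm, add_sub_right_comm, add_comm, add_comm]
  rfl

theorem norm_le_of_isGap (hM : ∀ j k, star (M k j) = M j k) {δ : ℝ} (hδ : 0 < δ)
    {l : Fin d → ℤ} {p q : Bool × ℤ} (h : IsGap M (dotZ ω l) p q δ) (X : FullOp d) :
    δ * ‖X l p q‖ ≤ ∑ q' ∈ shellOf q, ∑ p' ∈ shellOf p,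
      ‖der shellOf (hamMat M) (dotHom ω) X l p' q'‖ := by
  have := sylvester_entry_le (hamBlk_isHermitian hM q) (hamBlk_isHermitian hM p) hδ h
    (Matrix.of fun (i : shellOf q) (j : shellOf p) => X l j i) ⟨q, self_mem_shellOf q⟩
    ⟨p, self_mem_shellOf p⟩
  refine this.trans (le_of_eq ?_)
  simp only [der_apply_eq_sylvester]
  rw [← Finset.sum_coe_sort (shellOf q)]
  exact Finset.sum_congr rfl fun i _ => Finset.sum_coe_sort (shellOf p) fun j =>
    ‖der shellOf (hamMat M) (dotHom ω) X l j i‖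

/-- The index set on which the homological equation is solved. -/
def act (cut : ℝ) (l : Fin d → ℤ) (p q : Bool × ℤ) : Prop :=
  len l ≤ cut ∧ ¬(l = 0 ∧ p.1 = q.1 ∧ p.2.natAbs = q.2.natAbs)

theorem act_congr {cut : ℝ} {l : Fin d → ℤ} {p q p' q' : Bool × ℤ} (hp : p' ∈ shellOf p)
    (hq : q' ∈ shellOf q) : act cut l p' q' ↔ act cut l p q := by
  rw [mem_shellOf] at hp hq
  rw [act, act, hp.1, hp.2, hq.1, hq.2]

theorem act_neg_flip {cut : ℝ} {l : Fin d → ℤ} {p q : Bool × ℤ} :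
    act cut (-l) (flip p) (flip q) ↔ act cut l p q := by
  simp [act, len_neg, flip]

theorem act_neg_swap {cut : ℝ} {l : Fin d → ℤ} {p q : Bool × ℤ} :
    act cut (-l) q p ↔ act cut l p q := by
  simp [act, len_neg, eq_comm]

theorem der_eq_zero_of_not_act {cut : ℝ} {X : FullOp d} (hX : ∀ l p q, ¬act cut l p q → X l p q = 0)
    {l : Fin d → ℤ} {p q : Bool × ℤ} (h : ¬act cut l p q) :
    der shellOf (hamMat M) (dotHom ω) X l p q = 0 := by
  simp only [der, lact, ract, fmul, Pi.add_apply, Pi.sub_apply]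
  rw [Finset.sum_eq_zero, Finset.sum_eq_zero, hX _ _ _ h]
  · simp
  · intro r hr
    rw [hX _ _ _ (by rwa [act_congr hr (self_mem_shellOf q)]), zero_mul]
  · intro r hr
    rw [hX _ _ _ (by rwa [act_congr (self_mem_shellOf p) hr]), mul_zero]

theorem exists_der_eq (hM : ∀ j k, star (M k j) = M j k) {cut : ℝ}
    {δ : Bool × ℤ → Bool × ℤ → ℝ} (hδ : ∀ p q, 0 < δ p q)
    (h : ∀ l p q, act cut l p q → IsGap M (dotZ ω l) p q (δ p q)) (Y : FullOp d)
    (hY : ∀ l p q, ¬act cut l p q → Y l p q = 0) :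
    ∃ X : FullOp d, (∀ l p q, ¬act cut l p q → X l p q = 0) ∧
      der shellOf (hamMat M) (dotHom ω) X = Y := by
  classical
  have loc : ∀ l p q, ∃ X : Bool × ℤ → Bool × ℤ → ℂ, act cut l p q →
      ∀ p' ∈ shellOf p, ∀ q' ∈ shellOf q,
        der shellOf (hamMat M) (dotHom ω) (fun _ => X) l p' q' = Y l p' q' := by
    intro l p q
    by_cases ha : act cut l p q
    · obtain ⟨X, hX⟩ := sylvester_surjective (hamBlk_isHermitian hM q) (hamBlk_isHermitian hM p)
        (hδ p q) (h l p q ha) (Matrix.of fun (i : shellOf q) (j : shellOf p) => Y l j i)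
      refine ⟨fun a b => if h : b ∈ shellOf q ∧ a ∈ shellOf p then X ⟨b, h.1⟩ ⟨a, h.2⟩ else 0,
        fun _ p' hp' q' hq' => ?_⟩
      rw [← der_apply_eq_sylvester _ l p q ⟨q', hq'⟩ ⟨p', hp'⟩]
      have : (Matrix.of fun (i : shellOf q) (j : shellOf p) =>
          (fun _ a b => if h : b ∈ shellOf q ∧ a ∈ shellOf p then X ⟨b, h.1⟩ ⟨a, h.2⟩ else 0 :
            FullOp d) l j i) = X := by
        ext i j
        simp
      rw [this, hX]
      rfl
    · exact ⟨0, fun h' => absurd h' ha⟩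
  choose S hS using loc
  set rep : Bool × ℤ → Bool × ℤ := fun p => (p.1, (p.2.natAbs : ℤ))
  have hrep : ∀ p, p ∈ shellOf (rep p) := fun p => mem_shellOf.2 ⟨rfl, by simp only [rep, Int.natAbs_natCast]⟩
  have hrep' : ∀ p, rep p ∈ shellOf p := fun p => mem_shellOf.2 ⟨rfl, by simp only [rep, Int.natAbs_natCast]⟩
  have hrepc : ∀ p, ∀ r ∈ shellOf p, rep r = rep p := fun p r hr => by
    rw [mem_shellOf] at hr
    simp only [rep, hr.1, hr.2]
  let X : FullOp d := fun l p q => if act cut l p q then S l (rep p) (rep q) p q else 0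
  have hX : ∀ l p q, ¬act cut l p q → X l p q = 0 := fun l p q hn => if_neg hn
  refine ⟨X, hX, ?_⟩
  funext l p q
  by_cases ha : act cut l p q
  · have ha' : act cut l (rep p) (rep q) := (act_congr (hrep' p) (hrep' q)).2 ha
    rw [← hS l (rep p) (rep q) ha' p (hrep p) q (hrep q)]
    simp only [der, lact, ract, fmul, Pi.add_apply, Pi.sub_apply]
    congr 1
    · congr 1
      · refine Finset.sum_congr rfl fun r hr => ?_
        simp only [X]
        rw [if_pos ((act_congr (self_mem_shellOf p) hr).2 ha), hrepc q r hr]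
      · refine Finset.sum_congr rfl fun r hr => ?_
        simp only [X]
        rw [if_pos ((act_congr hr (self_mem_shellOf q)).2 ha), hrepc p r hr]
    · simp only [X]
      rw [if_pos ha]
  · rw [hY _ _ _ ha, der_eq_zero_of_not_act hX ha]

theorem eq_of_der_eq (hM : ∀ j k, star (M k j) = M j k) {cut : ℝ}
    {δ : Bool × ℤ → Bool × ℤ → ℝ} (hδ : ∀ p q, 0 < δ p q)
    (h : ∀ l p q, act cut l p q → IsGap M (dotZ ω l) p q (δ p q)) {X Y : FullOp d}
    (hX : ∀ l p q, ¬act cut l p q → X l p q = 0) (hY : ∀ l p q, ¬act cut l p q → Y l p q = 0)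
    (hXY : der shellOf (hamMat M) (dotHom ω) X = der shellOf (hamMat M) (dotHom ω) Y) : X = Y := by
  funext l p q
  by_cases ha : act cut l p q
  · have h1 := norm_le_of_isGap hM (hδ p q) (h l p q ha) (X - Y)
    have h2 : der shellOf (hamMat M) (dotHom ω) (X - Y) = 0 := by
      have : der shellOf (hamMat M) (dotHom ω) (X - Y) =
          der shellOf (hamMat M) (dotHom ω) X - der shellOf (hamMat M) (dotHom ω) Y := by
        funext l p q
        simp only [der, lact, ract, fmul, Pi.add_apply, Pi.sub_apply, mul_sub, sub_mul,
          Finset.sum_sub_distrib]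
        ring
      rw [this, hXY, sub_self]
    rw [h2] at h1
    simp only [Pi.zero_apply, norm_zero, Finset.sum_const_zero] at h1
    have h3 : ‖(X - Y) l p q‖ ≤ 0 := nonpos_of_mul_nonpos_right h1 (hδ p q)
    exact sub_eq_zero.1 (norm_le_zero_iff.1 h3)
  · rw [hX _ _ _ ha, hY _ _ _ ha]

theorem sum_shellOf_flip (p : Bool × ℤ) (f : Bool × ℤ → ℂ) :
    ∑ r ∈ shellOf (flip p), f r = ∑ r ∈ shellOf p, f (flip r) := by
  refine (Finset.sum_bij (fun r _ => flip r) (fun r hr => ?_) (fun a _ b _ h => ?_)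
    (fun b hb => ⟨flip b, ?_, flip_flip b⟩) fun r _ => rfl).symm
  · rw [mem_shellOf] at hr ⊢
    simp [flip, hr.1, hr.2]
  · rw [← flip_flip a, h, flip_flip]
  · rw [mem_shellOf] at hb ⊢
    simp [flip] at hb ⊢
    simp [hb.1, hb.2]

theorem der_conjFull (X : FullOp d) : der shellOf (hamMat M) (dotHom ω) (conjFull X) =
    -conjFull (der shellOf (hamMat M) (dotHom ω) X) := by
  funext l p q
  simp only [der, lact, ract, fmul, Pi.add_apply, Pi.sub_apply, conjFull, Pi.neg_apply, star_add,
    star_sub, star_mul', star_sum, sum_shellOf_flip]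
  have e : ∀ a b, star (hamMat M (flip a) (flip b)) = -hamMat M a b := hamMat_flip M
  have e2 : star (dotHom ω (-l)) = -dotHom ω l := by
    rw [map_neg, star_neg]
    congr 1
    exact Complex.conj_ofReal _
  simp only [e, e2, mul_neg, neg_mul, Finset.sum_neg_distrib]
  ring

theorem sgn_eq_of_mem {p r : Bool × ℤ} (h : r ∈ shellOf p) : sgn r = sgn p := by
  rw [mem_shellOf] at h
  rw [sgn, sgn, h.1]

theorem der_dag (hM : ∀ j k, star (M k j) = M j k) (X : FullOp d) :
    der shellOf (hamMat M) (dotHom ω) (dag X) =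
    -dag (der shellOf (hamMat M) (dotHom ω) X) := by
  funext l p q
  simp only [der, lact, ract, fmul, Pi.add_apply, Pi.sub_apply, dag, Pi.neg_apply, star_add,
    star_sub, star_mul', star_sum]
  have e : ∀ a b, star (hamMat M a b) = hamMat M b a := fun a b => star_hamMat hM b a
  have e2 : star (dotHom ω (-l)) = -dotHom ω l := by
    rw [map_neg, star_neg]
    congr 1
    exact Complex.conj_ofReal _
  simp only [e, e2]
  have e3 : ∑ r ∈ shellOf q, hamMat M r q * (sgn p * sgn r * star (X (-l) r p)) =
      sgn p * sgn q * ∑ r ∈ shellOf q, star (X (-l) r p) * hamMat M r q := by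
    rw [Finset.mul_sum]
    refine Finset.sum_congr rfl fun r hr => ?_
    rw [sgn_eq_of_mem hr]
    ring
  have e4 : ∑ r ∈ shellOf p, sgn r * sgn q * star (X (-l) q r) * hamMat M p r =
      sgn p * sgn q * ∑ r ∈ shellOf p, hamMat M p r * star (X (-l) q r) := by
    rw [Finset.mul_sum]
    refine Finset.sum_congr rfl fun r hr => ?_
    rw [sgn_eq_of_mem hr]
    ring
  rw [e3, e4]
  ring

end Homological

/-! ### Estimates for the homological equation -/

section Estimates

variable {d : ℕ} {M M₁ M₂ : ℤ → ℤ → ℂ} {ω ω₁ ω₂ : Freq d}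

theorem sum_shellOf_le (f : Bool × ℤ → ℝ) (hf : ∀ k, 0 ≤ f k) (p : Bool × ℤ) :
    ∑ r ∈ shellOf p, f r ≤ f p + f (p.1, -p.2) := by
  classical
  have : shellOf p ⊆ {p, (p.1, -p.2)} := fun r hr => by
    rw [mem_shellOf] at hr
    obtain ⟨c, j⟩ := p
    obtain ⟨c', k⟩ := r
    simp only [Finset.mem_insert, Finset.mem_singleton, Prod.mk.injEq]
    simp only at hr
    obtain ⟨h1, h2⟩ := hr
    rcases Int.natAbs_eq_natAbs_iff.1 h2 with h | h
    · exact Or.inl ⟨h1, h⟩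
    · exact Or.inr ⟨h1, h⟩
  refine (Finset.sum_le_sum_of_subset_of_nonneg this fun i _ _ => hf i).trans ?_
  by_cases h : p = (p.1, -p.2)
  · rw [← h, Finset.pair_eq_singleton, Finset.sum_singleton]
    linarith [hf p]
  · rw [Finset.sum_pair h]

/-- Sum of the norms of the entries in a block. -/
def blkSum (X : FullOp d) (l : Fin d → ℤ) (p q : Bool × ℤ) : ℝ :=
  ∑ q' ∈ shellOf q, ∑ p' ∈ shellOf p, ‖X l p' q'‖

theorem blkSum_nonneg (X : FullOp d) (l : Fin d → ℤ) (p q : Bool × ℤ) : 0 ≤ blkSum X l p q :=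
  Finset.sum_nonneg fun _ _ => Finset.sum_nonneg fun _ _ => norm_nonneg _

theorem blkSum_le (X : FullOp d) (l : Fin d → ℤ) (p q : Bool × ℤ) : blkSum X l p q ≤
    (‖X l p q‖ + ‖X l (p.1, -p.2) q‖) + (‖X l p (q.1, -q.2)‖ + ‖X l (p.1, -p.2) (q.1, -q.2)‖) := by
  refine (sum_shellOf_le (fun q' => ∑ p' ∈ shellOf p, ‖X l p' q'‖)
    (fun _ => Finset.sum_nonneg fun _ _ => norm_nonneg _) q).trans ?_
  exact add_le_add (sum_shellOf_le (fun p' => ‖X l p' q‖) (fun _ => norm_nonneg _) p)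
    (sum_shellOf_le (fun p' => ‖X l p' (q.1, -q.2)‖) (fun _ => norm_nonneg _) p)

theorem colN_le_of_blkSum {W W' : (Fin d → ℤ) → Bool × ℤ → Bool × ℤ → ℝ≥0∞} {X Y : FullOp d}
    {c : ℝ≥0∞} (hW : ∀ l p q, W' l (p.1, -p.2) q = W' l p q)
    (hW' : ∀ l p q, W' l p (q.1, -q.2) = W' l p q)
    (h : ∀ l p q, W l p q * ‖Y l p q‖ₑ ≤ c * (W' l p q * ENNReal.ofReal (blkSum X l p q))) :
    colN W Y ≤ c * (4 * colN W' X) := by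
  let barEquiv : Bool × ℤ ≃ Bool × ℤ := (Equiv.refl Bool).prodCongr (Equiv.neg ℤ)
  have hp : ∀ Z : FullOp d, colN W' (fun l p q => Z l (p.1, -p.2) q) ≤ colN W' Z := fun Z => by
    refine iSup_le fun p => le_trans (le_of_eq ?_) (l2_le_colN W' Z (p.1, -p.2))
    exact congrArg l2 (funext fun r => by rw [hW])
  have hq : ∀ Z : FullOp d, colN W' (fun l p q => Z l p (q.1, -q.2)) ≤ colN W' Z := fun Z => by
    refine iSup_le fun p => le_trans ?_ (l2_le_colN W' Z p)
    have := l2_comp_le (e := (Equiv.refl (Fin d → ℤ)).prodCongr barEquiv) (Equiv.injective _)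
      (fun r : (Fin d → ℤ) × (Bool × ℤ) => W' r.1 p r.2 * ‖Z r.1 p r.2‖ₑ)
    refine le_trans (le_of_eq ?_) this
    exact congrArg l2 (funext fun r => by rw [← hW']; rfl)
  have e : ∀ Z Z' : FullOp d, colN W' (fun l p q => ((‖Z l p q‖ + ‖Z' l p q‖ : ℝ) : ℂ)) ≤
      colN W' Z + colN W' Z' := fun Z Z' => colN_le_add fun l p q => by
    rw [← mul_add]
    refine mul_le_mul_right ?_ _
    rw [← ofReal_norm, Complex.norm_real, Real.norm_of_nonneg (by positivity),
      ENNReal.ofReal_add (norm_nonneg _) (norm_nonneg _), ofReal_norm, ofReal_norm]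
  refine (colN_le_mul (W' := W') (Y := fun l p q => ((blkSum X l p q : ℝ) : ℂ)) (c := c)
    fun l p q => ?_).trans (mul_le_mul_right ?_ c)
  · rw [← ofReal_norm ((blkSum X l p q : ℝ) : ℂ), Complex.norm_real,
      Real.norm_of_nonneg (blkSum_nonneg _ _ _ _)]
    exact h l p q
  · set Z : FullOp d := fun l p q => ((‖X l p q‖ + ‖X l (p.1, -p.2) q‖ : ℝ) : ℂ) with hZ
    set Z' : FullOp d := fun l p q => ((‖X l p (q.1, -q.2)‖ + ‖X l (p.1, -p.2) (q.1, -q.2)‖ : ℝ) : ℂ)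
    have hZ1 : colN W' Z ≤ 2 * colN W' X := by
      rw [two_mul]
      exact (e _ (fun l p q => X l (p.1, -p.2) q)).trans (add_le_add le_rfl (hp X))
    have hZ2 : colN W' Z' ≤ 2 * colN W' X := (hq Z).trans hZ1
    calc _ ≤ colN W' Z + colN W' Z' := colN_le_add fun l p q => by
          rw [← mul_add]
          refine mul_le_mul_right ?_ _
          simp only [Z, Z']
          rw [← ofReal_norm, ← ofReal_norm, ← ofReal_norm, Complex.norm_real, Complex.norm_real,
            Complex.norm_real, Real.norm_of_nonneg (blkSum_nonneg _ _ _ _),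
            Real.norm_of_nonneg (by positivity), Real.norm_of_nonneg (by positivity),
            ← ENNReal.ofReal_add (by positivity) (by positivity)]
          exact ENNReal.ofReal_le_ofReal (blkSum_le X l p q)
      _ ≤ 2 * colN W' X + 2 * colN W' X := add_le_add hZ1 hZ2
      _ = 4 * colN W' X := by rw [← add_mul]; norm_num

/-- The lower bound for the divisors. -/
def gapFun (c : ℝ) (p q : Bool × ℤ) : ℝ :=
  c * if p.1 = q.1 then 1 else jap ((p.2.natAbs : ℝ) + q.2.natAbs)

theorem gapFun_pos {c : ℝ} (hc : 0 < c) (p q : Bool × ℤ) : 0 < gapFun c p q := by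
  rw [gapFun]
  split_ifs
  · simpa using hc
  · exact mul_pos hc (jap_pos _)

theorem jap_natAbs (j : ℤ) : jap (j.natAbs : ℝ) = jap j := by
  rw [Nat.cast_natAbs, Int.cast_abs, jap_abs]

theorem mul_vOne_le (c : ℝ) (hc : 0 ≤ c) (p q : Bool × ℤ) :
    c * vOne p q ≤ gapFun c p q * vZero p q := by
  rw [gapFun, mul_assoc]
  refine mul_le_mul_of_nonneg_left ?_ hc
  have h1 := one_le_vZero p q
  split_ifs with h
  · simp [vOne, vZero, h]
  · have h2 : vOne p q ≤ jap ((p.2.natAbs : ℝ) + q.2.natAbs) := by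
      have hp : (0 : ℝ) ≤ p.2.natAbs := Nat.cast_nonneg _
      have hq : (0 : ℝ) ≤ q.2.natAbs := Nat.cast_nonneg _
      rw [vOne, ← jap_natAbs p.2, ← jap_natAbs q.2]
      refine max_le (max_le_max le_rfl ?_) (max_le_max le_rfl ?_) <;>
      rw [abs_of_nonneg (by positivity), abs_of_nonneg (by positivity)] <;> linarith
    nlinarith [jap_pos ((p.2.natAbs : ℝ) + q.2.natAbs)]

theorem Wgt_neg_left {v : Bool × ℤ → Bool × ℤ → ℝ} (hv : ∀ p q, v (p.1, -p.2) q = v p q)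
    (lo hi lam : ℝ) (l : Fin d → ℤ) (p q : Bool × ℤ) :
    Wgt v lo hi lam l (p.1, -p.2) q = Wgt v lo hi lam l p q := by
  rw [Wgt, Wgt, hv, wtSum, wtSum, wt_neg_left]

theorem Wgt_neg_right {v : Bool × ℤ → Bool × ℤ → ℝ} (hv : ∀ p q, v p (q.1, -q.2) = v p q)
    (lo hi lam : ℝ) (l : Fin d → ℤ) (p q : Bool × ℤ) :
    Wgt v lo hi lam l p (q.1, -q.2) = Wgt v lo hi lam l p q := by
  rw [Wgt, Wgt, hv, wtSum, wtSum, wt_neg_right]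

theorem vZero_neg_left (p q : Bool × ℤ) : vZero (p.1, -p.2) q = vZero p q := by
  simp [vZero, jap_neg]

theorem vZero_neg_right (p q : Bool × ℤ) : vZero p (q.1, -q.2) = vZero p q := by
  simp [vZero, jap_neg]

theorem vOne_neg_left (p q : Bool × ℤ) : vOne (p.1, -p.2) q = vOne p q := by
  simp [vOne, jap_neg]

theorem vOne_neg_right (p q : Bool × ℤ) : vOne p (q.1, -q.2) = vOne p q := by
  simp [vOne, jap_neg]

variable {lo hi lam cut c : ℝ}

theorem colN_le_of_der (hl : 0 ≤ lam) (hc : 0 < c) (hM : ∀ j k, star (M k j) = M j k)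
    (h : ∀ l p q, act cut l p q → IsGap M (dotZ ω l) p q (gapFun c p q)) {X : FullOp d}
    (hX : ∀ l p q, ¬act cut l p q → X l p q = 0) :
    colN (Wgt vOne lo hi lam) X ≤ ENNReal.ofReal c⁻¹ * (4 * colN (Wgt vZero lo hi lam)
      (der shellOf (hamMat M) (dotHom ω) X)) := by
  refine colN_le_of_blkSum (Wgt_neg_left vZero_neg_left lo hi lam)
    (Wgt_neg_right vZero_neg_right lo hi lam) fun l p q => ?_
  by_cases ha : act cut l p q
  · have h1 := norm_le_of_isGap hM (gapFun_pos hc p q) (h l p q ha) X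
    change _ ≤ blkSum _ _ _ _ at h1
    have h2 := mul_vOne_le c hc.le p q
    have hw := wtSum_pos (lo := lo) (hi := hi) hl l p.2 q.2
    have hv0 := zero_lt_one.trans_le (one_le_vZero p q)
    have hv1 := zero_lt_one.trans_le (one_le_vOne p q)
    rw [Wgt, Wgt, ← ofReal_norm, ← ENNReal.ofReal_mul (by positivity),
      ← ENNReal.ofReal_mul (by positivity), ← ENNReal.ofReal_mul (by positivity)]
    refine ENNReal.ofReal_le_ofReal ?_
    rw [le_inv_mul_iff₀ hc]
    calc c * (vOne p q * wtSum lo hi lam l p.2 q.2 * ‖X l p q‖)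
        = (c * vOne p q) * (wtSum lo hi lam l p.2 q.2 * ‖X l p q‖) := by ring
      _ ≤ (gapFun c p q * vZero p q) * (wtSum lo hi lam l p.2 q.2 * ‖X l p q‖) := by gcongr
      _ = vZero p q * wtSum lo hi lam l p.2 q.2 * (gapFun c p q * ‖X l p q‖) := by ring
      _ ≤ _ := by gcongr
  · rw [hX _ _ _ ha]
    simp

theorem abs_dotZ_sub_le (l : Fin d → ℤ) : |dotZ ω₁ l - dotZ ω₂ l| ≤ ‖ω₁ - ω₂‖ * len l := by
  have : dotZ ω₁ l - dotZ ω₂ l =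
      inner ℝ (WithLp.toLp 2 (fun i => (l i : ℝ)) : EuclideanSpace ℝ (Fin d)) (ω₁ - ω₂) := by
    rw [PiLp.inner_apply, dotZ, dotZ, ← Finset.sum_sub_distrib]
    refine Finset.sum_congr rfl fun i _ => ?_
    simp
    ring
  rw [this, mul_comm, len_eq_norm]
  exact abs_real_inner_le_norm _ _

theorem colN_sub_le_of_der (hl : 0 ≤ lam) (hc : 0 < c) (hM₁ : ∀ j k, star (M₁ k j) = M₁ j k)
    (hM₂ : ∀ j k, star (M₂ k j) = M₂ j k)
    (h₁ : ∀ l p q, act cut l p q → IsGap M₁ (dotZ ω₁ l) p q (gapFun c p q))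
    (h₂ : ∀ l p q, act cut l p q → IsGap M₂ (dotZ ω₂ l) p q (gapFun c p q)) {η : ℝ}
    (hη : ∀ p q, ‖hamMat M₁ p q - hamMat M₂ p q‖ ≤ η) (hcut : 0 ≤ cut) {X₁ X₂ : FullOp d}
    (hX₁ : ∀ l p q, ¬act cut l p q → X₁ l p q = 0) (hX₂ : ∀ l p q, ¬act cut l p q → X₂ l p q = 0) :
    colN (Wgt vOne lo hi lam) (X₁ - X₂) ≤ ENNReal.ofReal c⁻¹ * (4 * (
      colN (Wgt vZero lo hi lam) (der shellOf (hamMat M₁) (dotHom ω₁) X₁ -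
        der shellOf (hamMat M₂) (dotHom ω₂) X₂) +
      ENNReal.ofReal (2 * η + ‖ω₁ - ω₂‖ * cut) * (4 * (ENNReal.ofReal c⁻¹ *
        (4 * colN (Wgt vZero lo hi lam) (der shellOf (hamMat M₂) (dotHom ω₂) X₂)))))) := by
  have hη0 : 0 ≤ η := (norm_nonneg _).trans (hη (true, 0) (true, 0))
  refine (colN_le_of_der hl hc hM₁ h₁ (X := X₁ - X₂) fun l p q ha => ?_).trans
    (mul_le_mul_right (mul_le_mul_right ?_ _) _)
  · simp [hX₁ _ _ _ ha, hX₂ _ _ _ ha]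
  set R : FullOp d := fun l p q => der shellOf (hamMat M₁) (dotHom ω₁) X₂ l p q -
    der shellOf (hamMat M₂) (dotHom ω₂) X₂ l p q with hR
  have e : der shellOf (hamMat M₁) (dotHom ω₁) (X₁ - X₂) =
      (der shellOf (hamMat M₁) (dotHom ω₁) X₁ - der shellOf (hamMat M₂) (dotHom ω₂) X₂) - R := by
    funext l p q
    simp only [hR, der, lact, ract, fmul, Pi.add_apply, Pi.sub_apply, mul_sub, sub_mul,
      Finset.sum_sub_distrib]
    ring
  rw [e]
  refine (colN_sub_le _ _ _).trans (add_le_add le_rfl ?_)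
  refine le_trans ?_ (mul_le_mul_right (mul_le_mul_right (colN_le_of_der hl hc hM₂ h₂ hX₂) _) _)
  refine colN_le_of_blkSum (Wgt_neg_left vOne_neg_left lo hi lam)
    (Wgt_neg_right vOne_neg_right lo hi lam) fun l p q => ?_
  have hw := wtSum_pos (lo := lo) (hi := hi) hl l p.2 q.2
  have hv0 := zero_lt_one.trans_le (one_le_vZero p q)
  have hv1 := zero_lt_one.trans_le (one_le_vOne p q)
  have hb := blkSum_nonneg X₂ l p q
  rw [Wgt, Wgt, ← ofReal_norm, ← ENNReal.ofReal_mul (by positivity),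
    ← ENNReal.ofReal_mul (by positivity), ← ENNReal.ofReal_mul (by positivity)]
  refine ENNReal.ofReal_le_ofReal ?_
  have hent : ‖R l p q‖ ≤ (2 * η + ‖ω₁ - ω₂‖ * cut) * blkSum X₂ l p q := by
    have e1 : R l p q = ∑ r ∈ shellOf q, (hamMat M₁ r q - hamMat M₂ r q) * X₂ l p r -
        ∑ r ∈ shellOf p, X₂ l r q * (hamMat M₁ p r - hamMat M₂ p r) +
        ((dotZ ω₁ l - dotZ ω₂ l : ℝ) : ℂ) * X₂ l p q := by
      have e3 : dotHom ω₁ l = (dotZ ω₁ l : ℂ) := rfl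
      have e4 : dotHom ω₂ l = (dotZ ω₂ l : ℂ) := rfl
      simp only [hR, der, lact, ract, fmul, Pi.add_apply, Pi.sub_apply, mul_sub, sub_mul,
        Finset.sum_sub_distrib, e3, e4]
      push_cast
      ring
    have hbq : ∑ r ∈ shellOf q, ‖X₂ l p r‖ ≤ blkSum X₂ l p q :=
      Finset.sum_le_sum fun r _ => Finset.single_le_sum (f := fun p' => ‖X₂ l p' r‖)
        (fun _ _ => norm_nonneg _) (self_mem_shellOf p)
    have hbp : ∑ r ∈ shellOf p, ‖X₂ l r q‖ ≤ blkSum X₂ l p q :=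
      Finset.single_le_sum (f := fun q' => ∑ r ∈ shellOf p, ‖X₂ l r q'‖)
        (fun _ _ => Finset.sum_nonneg fun _ _ => norm_nonneg _) (self_mem_shellOf q)
    have hb1 : ‖X₂ l p q‖ ≤ blkSum X₂ l p q := (Finset.single_le_sum (f := fun r => ‖X₂ l p r‖)
      (fun _ _ => norm_nonneg _) (self_mem_shellOf q)).trans hbq
    have t1 : ‖∑ r ∈ shellOf q, (hamMat M₁ r q - hamMat M₂ r q) * X₂ l p r‖ ≤
        η * blkSum X₂ l p q := by
      refine (norm_sum_le _ _).trans (le_trans ?_ (mul_le_mul_of_nonneg_left hbq hη0))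
      rw [Finset.mul_sum]
      exact Finset.sum_le_sum fun r _ => by
        rw [norm_mul]
        exact mul_le_mul_of_nonneg_right (hη _ _) (norm_nonneg _)
    have t2 : ‖∑ r ∈ shellOf p, X₂ l r q * (hamMat M₁ p r - hamMat M₂ p r)‖ ≤
        η * blkSum X₂ l p q := by
      refine (norm_sum_le _ _).trans (le_trans ?_ (mul_le_mul_of_nonneg_left hbp hη0))
      rw [Finset.mul_sum]
      exact Finset.sum_le_sum fun r _ => by
        rw [norm_mul, mul_comm]
        exact mul_le_mul_of_nonneg_right (hη _ _) (norm_nonneg _)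
    have t3 : ‖((dotZ ω₁ l - dotZ ω₂ l : ℝ) : ℂ) * X₂ l p q‖ ≤
        ‖ω₁ - ω₂‖ * cut * blkSum X₂ l p q := by
      by_cases ha : act cut l p q
      · rw [norm_mul, Complex.norm_real, Real.norm_eq_abs]
        refine mul_le_mul ((abs_dotZ_sub_le l).trans
          (mul_le_mul_of_nonneg_left ha.1 (norm_nonneg _))) hb1 (norm_nonneg _) (by positivity)
      · rw [hX₂ _ _ _ ha]
        simp only [mul_zero, norm_zero]
        positivity
    rw [e1]
    refine (norm_add_le _ _).trans ((add_le_add (norm_sub_le _ _) le_rfl).trans ?_)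
    linarith
  calc vZero p q * wtSum lo hi lam l p.2 q.2 * ‖R l p q‖
      ≤ vOne p q * wtSum lo hi lam l p.2 q.2 *
        ((2 * η + ‖ω₁ - ω₂‖ * cut) * blkSum X₂ l p q) := by
        gcongr
        exact vZero_le_vOne p q
    _ = _ := by ring

theorem colOne_ne_top_of_colN (hlo : (sZero d : ℝ) ≤ lo) {X : FullOp d}
    (h : colN (fun l p q => ENNReal.ofReal (wt l p.2 q.2 ^ lo)) X ≠ ⊤) : colOne X ≠ ⊤ := by
  obtain ⟨S, _, hS⟩ := exists_l2_wt_le d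
  let κ : Bool × ℤ → (Fin d → ℤ) × (Bool × ℤ) → ℝ≥0∞ := fun p r =>
    ENNReal.ofReal (wt r.1 p.2 r.2.2 ^ (-lo))
  have h2 : ∀ p, l2 (κ p) ≤ ENNReal.ofReal S := fun p => hS lo hlo p.2
  refine ne_top_of_le_ne_top (ENNReal.mul_ne_top ENNReal.ofReal_ne_top h)
    (colOne_le_mul_colN (κ := κ) (fun p r => ?_) h2 X)
  simp only [κ]
  rw [← ENNReal.ofReal_mul (Real.rpow_nonneg (wt_pos _ _ _).le _), ← Real.rpow_add (wt_pos _ _ _)]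
  simp

theorem derDomain_of_colN (hlo : (sZero d : ℝ) ≤ lo) (hl : 0 ≤ lam) (hM : IsBlockDiag M)
    (hMc : ∀ p q, ‖hamMat M p q‖ ≤ c * jap q.2) (hc : 0 ≤ c) {X : FullOp d}
    (hX : ∀ l p q, ¬act cut l p q → X l p q = 0) (hcut : 0 ≤ cut)
    (hXn : colN (Wgt vOne lo hi lam) X ≠ ⊤) :
    DerDomain shellOf (hamMat M) (dotHom ω) X := by
  have hjap : ∀ {p r : Bool × ℤ}, r ∈ shellOf p → jap r.2 = jap p.2 := fun {p r} hr => by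
    rw [mem_shellOf] at hr
    rw [← jap_natAbs, hr.2, jap_natAbs]
  have key : ∀ (Y : FullOp d) (t : ℝ), 0 ≤ t →
      (∀ l p q, ‖Y l p q‖ ≤ t * (vOne p q * blkSum X l p q)) → colOne Y ≠ ⊤ := by
    intro Y t ht hY
    refine colOne_ne_top_of_colN hlo (ne_top_of_le_ne_top ?_ (colN_le_of_blkSum
      (W' := Wgt vOne lo hi lam) (X := X) (c := ENNReal.ofReal t)
      (Wgt_neg_left vOne_neg_left lo hi lam) (Wgt_neg_right vOne_neg_right lo hi lam)
      fun l p q => ?_))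
    · exact ENNReal.mul_ne_top ENNReal.ofReal_ne_top (ENNReal.mul_ne_top (by norm_num) hXn)
    · have hw : 0 < wt l p.2 q.2 := wt_pos _ _ _
      have hv1 := zero_lt_one.trans_le (one_le_vOne p q)
      have hb := blkSum_nonneg X l p q
      have hw' := wtSum_pos (lo := lo) (hi := hi) hl l p.2 q.2
      rw [Wgt, ← ofReal_norm, ← ENNReal.ofReal_mul (by positivity),
        ← ENNReal.ofReal_mul (by positivity), ← ENNReal.ofReal_mul (by positivity)]
      refine ENNReal.ofReal_le_ofReal ?_
      calc wt l p.2 q.2 ^ lo * ‖Y l p q‖ ≤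
          wtSum lo hi lam l p.2 q.2 * (t * (vOne p q * blkSum X l p q)) := by
            refine mul_le_mul ?_ (hY l p q) (norm_nonneg _) hw'.le
            exact le_add_of_nonneg_right (mul_nonneg hl (Real.rpow_nonneg hw.le _))
        _ = _ := by ring
  have hbq : ∀ l p q, ∑ r ∈ shellOf q, ‖X l p r‖ ≤ blkSum X l p q := fun l p q =>
    Finset.sum_le_sum fun r _ => Finset.single_le_sum (f := fun p' => ‖X l p' r‖)
      (fun _ _ => norm_nonneg _) (self_mem_shellOf p)
  have hbp : ∀ l p q, ∑ r ∈ shellOf p, ‖X l r q‖ ≤ blkSum X l p q := fun l p q =>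
    Finset.single_le_sum (f := fun q' => ∑ r ∈ shellOf p, ‖X l r q'‖)
      (fun _ _ => Finset.sum_nonneg fun _ _ => norm_nonneg _) (self_mem_shellOf q)
  have hb1 : ∀ l p q, ‖X l p q‖ ≤ blkSum X l p q := fun l p q =>
    (Finset.single_le_sum (f := fun r => ‖X l p r‖)
      (fun _ _ => norm_nonneg _) (self_mem_shellOf q)).trans (hbq l p q)
  have hvb : ∀ l p q, blkSum X l p q ≤ vOne p q * blkSum X l p q := fun l p q =>
    le_mul_of_one_le_left (blkSum_nonneg _ _ _ _) (one_le_vOne _ _)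
  refine ⟨key X 1 zero_le_one fun l p q => ?_, key _ c hc fun l p q => ?_,
    key _ c hc fun l p q => ?_, key _ (‖ω‖ * cut) (by positivity) fun l p q => ?_,
    ENNReal.ofReal c * colN (Wgt vOne lo hi lam) X,
    ENNReal.mul_ne_top ENNReal.ofReal_ne_top hXn, fun l p q r => ?_⟩
  · rw [one_mul]
    exact (hb1 l p q).trans (hvb l p q)
  · refine (norm_sum_le _ _).trans ?_
    calc _ ≤ ∑ r ∈ shellOf q, c * jap q.2 * ‖X l p r‖ := Finset.sum_le_sum fun r _ => by
          rw [norm_mul]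
          exact mul_le_mul_of_nonneg_right (hMc _ _) (norm_nonneg _)
      _ ≤ c * jap q.2 * blkSum X l p q := by
          rw [← Finset.mul_sum]
          exact mul_le_mul_of_nonneg_left (hbq _ _ _) (mul_nonneg hc (jap_pos _).le)
      _ ≤ _ := by
          rw [mul_assoc]
          exact mul_le_mul_of_nonneg_left (mul_le_mul_of_nonneg_right (le_max_right _ _)
            (blkSum_nonneg _ _ _ _)) hc
  · refine (norm_sum_le _ _).trans ?_
    calc _ ≤ ∑ r ∈ shellOf p, c * jap p.2 * ‖X l r q‖ := Finset.sum_le_sum fun r hr => by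
          rw [norm_mul, mul_comm, ← hjap hr]
          exact mul_le_mul_of_nonneg_right (hMc _ _) (norm_nonneg _)
      _ ≤ c * jap p.2 * blkSum X l p q := by
          rw [← Finset.mul_sum]
          exact mul_le_mul_of_nonneg_left (hbp _ _ _) (mul_nonneg hc (jap_pos _).le)
      _ ≤ _ := by
          rw [mul_assoc]
          exact mul_le_mul_of_nonneg_left (mul_le_mul_of_nonneg_right (le_max_left _ _)
            (blkSum_nonneg _ _ _ _)) hc
  · by_cases ha : act cut l p q
    · have h0 := abs_dotZ_sub_le (ω₁ := ω) (ω₂ := 0) l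
      have h1 : dotZ (0 : Freq d) l = 0 := by simp [dotZ]
      rw [h1, sub_zero, sub_zero] at h0
      have e3 : dotHom ω l = (dotZ ω l : ℂ) := rfl
      rw [fmul, norm_mul, e3, Complex.norm_real, Real.norm_eq_abs]
      exact mul_le_mul (h0.trans (mul_le_mul_of_nonneg_left ha.1 (norm_nonneg _)))
        ((hb1 l p q).trans (hvb l p q)) (norm_nonneg _) (by positivity)
    · rw [fmul, hX _ _ _ ha, mul_zero, norm_zero]
      have := blkSum_nonneg X l p q
      have := zero_lt_one.trans_le (one_le_vOne p q)
      positivity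
  · by_cases hr : r ∈ shellOf p
    · have h1 := weight_mul_enorm_le_colN (Wgt vOne lo hi lam) X l r q
      refine le_trans ?_ (mul_le_mul_right h1 _)
      have hw' := wtSum_pos (lo := lo) (hi := hi) hl l r.2 q.2
      have hv1 := zero_lt_one.trans_le (one_le_vOne r q)
      rw [Wgt, ← ofReal_norm, ← ofReal_norm, ← ENNReal.ofReal_mul (by positivity),
        ← ENNReal.ofReal_mul (by positivity)]
      refine ENNReal.ofReal_le_ofReal ?_
      rw [norm_mul, mul_comm]
      have hw1 : 1 ≤ wtSum lo hi lam l r.2 q.2 :=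
        (Real.one_le_rpow (one_le_wt _ _ _) ((Nat.cast_nonneg _).trans hlo)).trans
          (le_add_of_nonneg_right (mul_nonneg hl (Real.rpow_nonneg (wt_pos _ _ _).le _)))
      calc ‖hamMat M p r‖ * ‖X l r q‖ ≤ c * jap r.2 * ‖X l r q‖ :=
            mul_le_mul_of_nonneg_right (hMc _ _) (norm_nonneg _)
        _ = c * (jap r.2 * 1 * ‖X l r q‖) := by ring
        _ ≤ c * (vOne r q * wtSum lo hi lam l r.2 q.2 * ‖X l r q‖) := by
            gcongr
            exact le_max_left _ _
    · rw [hamMat_eq_zero hM _ _ hr, mul_zero, enorm_zero]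
      exact bot_le

end Estimates

/-! ### Lower bounds for the divisors -/

section Divisors

variable {d : ℕ} {M : ℤ → ℤ → ℂ} {ω : Freq d}

theorem mem_spectrum_submatrix {m n : Type*} [Fintype m] [Fintype n] [DecidableEq m]
    [DecidableEq n] (e : m ≃ n) {A : Matrix n n ℂ} {a : ℂ} (h : a ∈ spectrum ℂ A) :
    a ∈ spectrum ℂ (A.submatrix e e) := by
  have := AlgEquiv.spectrum_eq (Matrix.reindexAlgEquiv ℂ ℂ e.symm) A
  rw [← this] at h
  exact h

theorem mem_spectrum_transpose {n : Type*} [Fintype n] [DecidableEq n] {A : Matrix n n ℂ} {a : ℂ}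
    (h : a ∈ spectrum ℂ A) : a ∈ spectrum ℂ A.transpose := by
  rw [spectrum.mem_iff] at h ⊢
  have e : algebraMap ℂ (Matrix n n ℂ) a - A.transpose =
      (algebraMap ℂ (Matrix n n ℂ) a - A).transpose := by
    rw [Matrix.transpose_sub, Matrix.algebraMap_eq_diagonal, Matrix.diagonal_transpose]
  rwa [e, Matrix.isUnit_transpose]

theorem spectrum_hamBlk_false {p : Bool × ℤ} (hp : p.1 = false) {a : ℂ}
    (h : a ∈ spectrum ℂ (hamBlk M p)) :
    a ∈ spectrum ℂ (block M p.2.natAbs p.2.natAbs) := by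
  let e : shell p.2.natAbs ≃ shellOf p :=
    { toFun := fun k => ⟨(false, k), mem_shellOf.2 ⟨hp.symm, mem_shell.1 k.2⟩⟩
      invFun := fun r => ⟨r.1.2, mem_shell.2 (mem_shellOf.1 r.2).2⟩
      left_inv := fun k => rfl
      right_inv := fun r => by
        have := (mem_shellOf.1 r.2).1
        exact Subtype.ext (Prod.ext (this.trans hp).symm rfl) }
  have := mem_spectrum_submatrix e h
  exact this

theorem spectrum_hamBlk_true (hM : ∀ j k, star (M k j) = M j k) {p : Bool × ℤ} (hp : p.1 = true)
    {a : ℂ} (h : a ∈ spectrum ℂ (hamBlk M p)) :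
    -a ∈ spectrum ℂ (block M p.2.natAbs p.2.natAbs) := by
  let e : shell p.2.natAbs ≃ shellOf p :=
    { toFun := fun k => ⟨(true, -k), mem_shellOf.2 ⟨hp.symm, by simpa using mem_shell.1 k.2⟩⟩
      invFun := fun r => ⟨-r.1.2, mem_shell.2 (by simpa using (mem_shellOf.1 r.2).2)⟩
      left_inv := fun k => by simp
      right_inv := fun r => by
        have := (mem_shellOf.1 r.2).1
        exact Subtype.ext (Prod.ext (this.trans hp).symm (by simp)) }
  have h2 := mem_spectrum_submatrix e (mem_spectrum_transpose h)
  have e2 : (hamBlk M p).transpose.submatrix e e = -block M p.2.natAbs p.2.natAbs := by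
    ext r c
    simp only [Matrix.submatrix_apply, Matrix.transpose_apply, hamBlk, Matrix.of_apply, e,
      Equiv.coe_fn_mk, hamMat, block, Matrix.neg_apply, if_true, neg_neg]
    rw [hM]
  rw [e2, ← spectrum.neg_eq, Set.mem_neg] at h2
  exact h2

theorem isGap_of_melnikov (hM : ∀ j k, star (M k j) = M j k) {γ τ N cut : ℝ}
    (hcut : cut ≤ N) (hmel : Melnikov γ τ N M ω)
    (hpos : ∀ (α : ℕ) (a : ℝ), (a : ℂ) ∈ spectrum ℂ (block M α α) →
      γ * jap ((α : ℝ) + α) / N ^ τ ≤ a + a) (hγ : 0 ≤ γ) (hN : 0 ≤ N)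
    {l : Fin d → ℤ} {p q : Bool × ℤ} (ha : act cut l p q) :
    IsGap M (dotZ ω l) p q (gapFun (γ / N ^ τ) p q) := by
  have hN' : 0 ≤ N ^ τ := Real.rpow_nonneg hN τ
  have hone : ∀ x, γ / N ^ τ * 1 ≤ γ * jap x / N ^ τ := fun x => by
    rw [mul_one]
    exact div_le_div_of_nonneg_right (le_mul_of_one_le_right hγ (one_le_jap x)) hN'
  obtain ⟨hl, hn⟩ := ha
  have hl' : len l ≤ N := hl.trans hcut
  have hdiag : ∀ (j : ℕ) (a b : ℝ), (a : ℂ) ∈ spectrum ℂ (block M j j) →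
      (b : ℂ) ∈ spectrum ℂ (block M j j) → γ * jap ((j : ℝ) + j) / N ^ τ ≤ |a + b| := by
    intro j a b h1 h2
    have e1 := hpos _ _ h1
    have e2 := hpos _ _ h2
    have e3 := le_abs_self (a + b)
    linarith
  intro a b hqa hpb
  rcases hp : p.1 with _ | _ <;> rcases hq : q.1 with _ | _ <;>
    simp only [gapFun, hp, hq, if_true, reduceCtorEq, if_false]
  · have h1 := spectrum_hamBlk_false hq hqa
    have h2 := spectrum_hamBlk_false hp hpb
    refine (hone _).trans (hmel l _ _ hl' ?_ a b h1 h2).1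
    exact fun h => hn ⟨h.1, by rw [hp, hq], h.2.symm⟩
  · have h1 := spectrum_hamBlk_true hM hq hqa
    have h2 := spectrum_hamBlk_false hp hpb
    rw [← Complex.ofReal_neg] at h1
    by_cases h0 : l = 0 ∧ p.2.natAbs = q.2.natAbs
    · rw [h0.2] at h2
      have h3 := hdiag _ _ _ h1 h2
      rw [h0.2, h0.1, mul_div_right_comm] at *
      have : dotZ ω (0 : Fin d → ℤ) = 0 := by simp [dotZ]
      rw [this, zero_add, ← abs_neg, neg_sub', sub_neg_eq_add]
      exact h3
    · have h3 := (hmel (-l) q.2.natAbs p.2.natAbs (by rwa [len_neg]) (fun h => h0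
        ⟨neg_eq_zero.1 h.1, h.2.symm⟩) (-a) b h1 h2).2
      have : dotZ ω (-l) = -dotZ ω l := by simp [dotZ]
      rw [this, mul_div_right_comm] at h3
      rw [← abs_neg, add_comm (p.2.natAbs : ℝ)]
      refine h3.trans (le_of_eq (congrArg _ ?_))
      ring
  · have h1 := spectrum_hamBlk_false hq hqa
    have h2 := spectrum_hamBlk_true hM hp hpb
    rw [← Complex.ofReal_neg] at h2
    by_cases h0 : l = 0 ∧ p.2.natAbs = q.2.natAbs
    · rw [h0.2] at h2
      have h3 := hdiag _ _ _ h1 h2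
      rw [h0.2, h0.1, mul_div_right_comm] at *
      have : dotZ ω (0 : Fin d → ℤ) = 0 := by simp [dotZ]
      rw [this, zero_add, sub_eq_add_neg]
      exact h3
    · have h3 := (hmel l q.2.natAbs p.2.natAbs hl' (fun h => h0
        ⟨h.1, h.2.symm⟩) a (-b) h1 h2).2
      rw [mul_div_right_comm] at h3
      rw [add_comm (p.2.natAbs : ℝ)]
      exact h3
  · have h1 := spectrum_hamBlk_true hM hq hqa
    have h2 := spectrum_hamBlk_true hM hp hpb
    rw [← Complex.ofReal_neg] at h1 h2
    have h3 := (hmel l p.2.natAbs q.2.natAbs hl' (fun h => hn ⟨h.1, by rw [hp, hq], h.2⟩)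
      (-b) (-a) h2 h1).1
    refine (hone _).trans (h3.trans (le_of_eq (congrArg _ ?_)))
    ring

open scoped Matrix.Norms.L2Operator in
theorem norm_sub_le_of_mem_spectrum {n : Type*} [Fintype n] [DecidableEq n] [Nonempty n]
    {A : Matrix n n ℂ} {a : ℂ} (h : a ∈ spectrum ℂ A) (c : ℂ) :
    ‖a - c‖ ≤ ‖A - algebraMap ℂ (Matrix n n ℂ) c‖ := by
  have h1 : a - c ∈ spectrum ℂ (A - algebraMap ℂ (Matrix n n ℂ) c) := by
    rw [spectrum.mem_iff] at h ⊢
    rwa [map_sub, sub_sub_sub_cancel_right]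
  exact spectrum.norm_le_norm_of_mem h1

/-- The Fourier multiplier with eigenvalues `(j² + m)^{1/2}`. -/
def sqrtDiag (m : ℝ) : ℤ → ℤ → ℂ := fun j k =>
  if j = k then ((Real.sqrt ((j : ℝ) ^ 2 + m) : ℝ) : ℂ) else 0

theorem sqrt_sub_le_of_mem_spectrum {m e : ℝ} {α : ℕ} (h : blockNorm (M - sqrtDiag m) α α ≤ e)
    {a : ℝ} (ha : (a : ℂ) ∈ spectrum ℂ (block M α α)) : Real.sqrt ((α : ℝ) ^ 2 + m) - e ≤ a := by
  have : Nonempty (shell α) := ⟨⟨α, mem_shell.2 rfl⟩⟩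
  have h1 := norm_sub_le_of_mem_spectrum ha ((Real.sqrt ((α : ℝ) ^ 2 + m) : ℝ) : ℂ)
  have h2 : block M α α - algebraMap ℂ (Matrix (shell α) (shell α) ℂ)
      ((Real.sqrt ((α : ℝ) ^ 2 + m) : ℝ) : ℂ) = block (M - sqrtDiag m) α α := by
    ext r c
    have hr : ((c : ℤ) : ℝ) ^ 2 = (α : ℝ) ^ 2 := by
      rw [← sq_abs, ← Int.cast_abs, ← Nat.cast_natAbs, mem_shell.1 c.2]
    simp only [Matrix.sub_apply, Matrix.algebraMap_matrix_apply, block, Matrix.of_apply,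
      Pi.sub_apply, sqrtDiag, hr, Subtype.ext_iff, eq_comm (a := (c : ℤ))]
    rfl
  rw [h2, ← Complex.ofReal_sub, Complex.norm_real, Real.norm_eq_abs] at h1
  have h3 := (neg_le_abs (a - Real.sqrt ((α : ℝ) ^ 2 + m))).trans (h1.trans h)
  linarith

theorem le_add_of_mem_spectrum {m e γ T : ℝ} (hγ : γ ≤ 1) (hT : 4 ≤ T)
    (hm : 0 < m) (hTm : 1 ≤ T * Real.sqrt m) (he : 2 * e ≤ Real.sqrt m) {α : ℕ}
    (h : blockNorm (M - sqrtDiag m) α α ≤ e) {a : ℝ} (ha : (a : ℂ) ∈ spectrum ℂ (block M α α)) :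
    γ * jap ((α : ℝ) + α) / T ≤ a + a := by
  have h1 := sqrt_sub_le_of_mem_spectrum h ha
  have hT0 : 0 < T := by linarith
  rw [div_le_iff₀ hT0]
  have h2 : γ * jap ((α : ℝ) + α) ≤ jap ((α : ℝ) + α) := mul_le_of_le_one_left (jap_pos _).le hγ
  refine h2.trans ?_
  have h3 : Real.sqrt m ≤ Real.sqrt ((α : ℝ) ^ 2 + m) := Real.sqrt_le_sqrt (by nlinarith [sq_nonneg (α : ℝ)])
  rcases Nat.eq_zero_or_pos α with h0 | h0
  · subst h0
    simp only [Nat.cast_zero, add_zero, jap, abs_zero, max_eq_left zero_le_one]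
    nlinarith [Real.sqrt_nonneg m]
  · have h4 : (1 : ℝ) ≤ α := by exact_mod_cast h0
    have h5 : (α : ℝ) ≤ Real.sqrt ((α : ℝ) ^ 2 + m) := Real.le_sqrt_of_sq_le (by linarith)
    rw [jap, abs_of_nonneg (by positivity), max_eq_right (by linarith)]
    nlinarith

end Divisors

/-! ### Extension of the normal forms to all frequencies -/

section Extension

variable {d : ℕ} {O : Set (Freq d)}

theorem exists_extension_real (f : Freq d → ℝ) {s L : ℝ} (hL0 : 0 ≤ L) (hs0 : 0 ≤ s)
    (hs : ∀ ω ∈ O, |f ω| ≤ s) (hL : ∀ ω₁ ∈ O, ∀ ω₂ ∈ O, |f ω₁ - f ω₂| ≤ L * ‖ω₁ - ω₂‖) :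
    ∃ g : Freq d → ℝ, (∀ ω ∈ O, g ω = f ω) ∧ (∀ ω, |g ω| ≤ s) ∧
      ∀ ω₁ ω₂, |g ω₁ - g ω₂| ≤ L * ‖ω₁ - ω₂‖ := by
  have h1 : LipschitzOnWith L.toNNReal f O := LipschitzOnWith.of_dist_le_mul fun x hx y hy => by
    rw [Real.dist_eq, dist_eq_norm, Real.coe_toNNReal _ hL0]
    exact hL x hx y hy
  obtain ⟨g, hg, hfg⟩ := h1.extend_real
  refine ⟨fun ω => max (-s) (min s (g ω)), fun ω hω => ?_, fun ω => ?_, fun ω₁ ω₂ => ?_⟩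
  · have h2 := abs_le.1 (hs ω hω)
    rw [hfg hω] at h2
    simp only [hfg hω]
    rw [min_eq_right h2.2, max_eq_right h2.1]
  · exact abs_le.2 ⟨le_max_left _ _, max_le (by linarith) (min_le_left _ _)⟩
  · have h2 := hg.dist_le_mul ω₁ ω₂
    rw [Real.dist_eq, dist_eq_norm, Real.coe_toNNReal _ hL0] at h2
    refine le_trans ?_ h2
    simp only [max_comm (-s)]
    refine (abs_max_sub_max_le_abs _ _ _).trans ?_
    rw [min_comm s, min_comm s]
    have := abs_min_sub_min_le_max (g ω₁) s (g ω₂) s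
    simpa using this

theorem exists_extension_complex (f : Freq d → ℂ) {s L : ℝ} (hL0 : 0 ≤ L) (hs0 : 0 ≤ s)
    (hs : ∀ ω ∈ O, ‖f ω‖ ≤ s) (hL : ∀ ω₁ ∈ O, ∀ ω₂ ∈ O, ‖f ω₁ - f ω₂‖ ≤ L * ‖ω₁ - ω₂‖) :
    ∃ g : Freq d → ℂ, (∀ ω ∈ O, g ω = f ω) ∧ (∀ ω, ‖g ω‖ ≤ 2 * s) ∧
      ∀ ω₁ ω₂, ‖g ω₁ - g ω₂‖ ≤ 2 * L * ‖ω₁ - ω₂‖ := by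
  obtain ⟨a, ha, ha', ha''⟩ := exists_extension_real (fun ω => (f ω).re) hL0 hs0
    (fun ω h => (Complex.abs_re_le_norm _).trans (hs ω h))
    (fun ω₁ h₁ ω₂ h₂ => (Complex.abs_re_le_norm (f ω₁ - f ω₂)).trans (hL ω₁ h₁ ω₂ h₂))
  obtain ⟨b, hb, hb', hb''⟩ := exists_extension_real (fun ω => (f ω).im) hL0 hs0
    (fun ω h => (Complex.abs_im_le_norm _).trans (hs ω h))
    (fun ω₁ h₁ ω₂ h₂ => (Complex.abs_im_le_norm (f ω₁ - f ω₂)).trans (hL ω₁ h₁ ω₂ h₂))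
  refine ⟨fun ω => ⟨a ω, b ω⟩, fun ω h => Complex.ext (ha ω h) (hb ω h), fun ω => ?_,
    fun ω₁ ω₂ => ?_⟩
  · refine (Complex.norm_le_abs_re_add_abs_im _).trans ?_
    have := ha' ω
    have := hb' ω
    simp only
    linarith
  · refine (Complex.norm_le_abs_re_add_abs_im _).trans ?_
    have := ha'' ω₁ ω₂
    have := hb'' ω₁ ω₂
    simp only [Complex.sub_re, Complex.sub_im]
    linarith

/-- The norm of a diagonal block, with values in `[0, ∞]`. -/
def eblk (α : ℕ) (A : ℤ → ℤ → ℂ) : ℝ≥0∞ := ENNReal.ofReal (blockNorm A α α)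

theorem blockNorm_diag_le {A : ℤ → ℤ → ℂ} {α : ℕ} {s : ℝ}
    (h : ∀ j k : ℤ, j.natAbs = α → k.natAbs = α → ‖A j k‖ ≤ s) : blockNorm A α α ≤ 4 * s := by
  refine (blockNorm_le A α α).trans ?_
  have h1 := h α α (by simp) (by simp)
  have h2 := h α (-α) (by simp) (by simp)
  have h3 := h (-α) α (by simp) (by simp)
  have h4 := h (-α) (-α) (by simp) (by simp)
  linarith

theorem exists_extension {γ : ℝ} (hγ : 0 < γ) (f : Freq d → ℤ → ℤ → ℂ)
    (hblk : ∀ ω ∈ O, IsBlockDiag (f ω)) (hherm : ∀ ω ∈ O, ∀ j k, star (f ω k j) = f ω j k)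
    (hfin : ∀ α, lipNorm γ O (eblk α) f ≠ ⊤) :
    ∃ g : Freq d → ℤ → ℤ → ℂ, (∀ ω ∈ O, g ω = f ω) ∧ (∀ ω, IsBlockDiag (g ω)) ∧
      (∀ ω j k, star (g ω k j) = g ω j k) ∧
      ∀ (O' : Set (Freq d)) (α : ℕ), lipNorm γ O' (eblk α) g ≤ 8 * lipNorm γ O (eblk α) f := by
  have hS : ∀ α, lipSup O (eblk α) f ≠ ⊤ := fun α => ne_top_of_le_ne_top (hfin α) lipSup_le_lipNorm
  have hL : ∀ α, lipSemi O (eblk α) f ≠ ⊤ := fun α h => hfin α (by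
    rw [lipNorm_eq, h, ENNReal.mul_top (by simpa using hγ), add_top])
  set s : ℕ → ℝ := fun α => (lipSup O (eblk α) f).toReal
  set L : ℕ → ℝ := fun α => (lipSemi O (eblk α) f).toReal
  have hs0 : ∀ α, 0 ≤ s α := fun α => ENNReal.toReal_nonneg
  have hL0 : ∀ α, 0 ≤ L α := fun α => ENNReal.toReal_nonneg
  have bs : ∀ ω ∈ O, ∀ j k : ℤ, j.natAbs = k.natAbs → ‖f ω j k‖ ≤ s j.natAbs := by
    intro ω hω j k hjk
    have h1 := le_lipSup (N := eblk j.natAbs) (f := f) hω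
    rw [eblk, ENNReal.ofReal_le_iff_le_toReal (hS _)] at h1
    refine le_trans ?_ h1
    have := norm_le_blockNorm (f ω) j k
    rwa [← hjk] at this
  have bL : ∀ ω₁ ∈ O, ∀ ω₂ ∈ O, ∀ j k : ℤ, j.natAbs = k.natAbs →
      ‖f ω₁ j k - f ω₂ j k‖ ≤ L j.natAbs * ‖ω₁ - ω₂‖ := by
    intro ω₁ h₁ ω₂ h₂ j k hjk
    by_cases hne : ω₁ = ω₂
    · simp [hne]
    have h1 := le_lipSemi (N := eblk j.natAbs) (f := f) h₁ h₂ hne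
    rw [eblk, ENNReal.ofReal_le_iff_le_toReal (ENNReal.mul_ne_top (hL _) ENNReal.ofReal_ne_top),
      ENNReal.toReal_mul, ENNReal.toReal_ofReal (norm_nonneg _)] at h1
    refine le_trans ?_ h1
    have := norm_le_blockNorm (f ω₁ - f ω₂) j k
    rwa [← hjk] at this
  have ex : ∀ j k : ℤ, ∃ g : Freq d → ℂ, j.natAbs = k.natAbs → (∀ ω ∈ O, g ω = f ω j k) ∧
      (∀ ω, ‖g ω‖ ≤ 2 * s j.natAbs) ∧
      ∀ ω₁ ω₂, ‖g ω₁ - g ω₂‖ ≤ 2 * L j.natAbs * ‖ω₁ - ω₂‖ := by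
    intro j k
    by_cases h : j.natAbs = k.natAbs
    · obtain ⟨g, hg⟩ := exists_extension_complex (O := O) (fun ω => f ω j k) (hL0 j.natAbs)
        (hs0 j.natAbs) (fun ω hω => bs ω hω j k h) (fun ω₁ h₁ ω₂ h₂ => bL ω₁ h₁ ω₂ h₂ j k h)
      exact ⟨g, fun _ => hg⟩
    · exact ⟨0, fun h' => absurd h' h⟩
  choose e he using ex
  let g : Freq d → ℤ → ℤ → ℂ := fun ω j k => if j.natAbs = k.natAbs then
    (if j = k then ((e j j ω).re : ℂ) else if j < k then e j k ω else star (e k j ω)) else 0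
  have hg1 : ∀ ω ∈ O, ∀ j k, g ω j k = f ω j k := by
    intro ω hω j k
    simp only [g]
    split_ifs with h1 h2 h3
    · subst h2
      rw [(he j j rfl).1 ω hω]
      exact Complex.conj_eq_iff_re.1 (hherm ω hω j j)
    · exact (he j k h1).1 ω hω
    · rw [(he k j h1.symm).1 ω hω, hherm ω hω]
    · exact (hblk ω hω j k h1).symm
  have bg : ∀ (α : ℕ) ω (j k : ℤ), j.natAbs = α → k.natAbs = α → ‖g ω j k‖ ≤ 2 * s α := by
    intro α ω j k hj hk
    simp only [g]
    rw [if_pos (hj.trans hk.symm)]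
    split_ifs with h2 h3
    · rw [Complex.norm_real, Real.norm_eq_abs]
      exact (Complex.abs_re_le_norm _).trans (hj ▸ (he j j rfl).2.1 ω)
    · exact hj ▸ (he j k (hj.trans hk.symm)).2.1 ω
    · rw [norm_star]
      exact hk ▸ (he k j (hk.trans hj.symm)).2.1 ω
  have bgL : ∀ (α : ℕ) ω₁ ω₂ (j k : ℤ), j.natAbs = α → k.natAbs = α →
      ‖(g ω₁ - g ω₂) j k‖ ≤ 2 * L α * ‖ω₁ - ω₂‖ := by
    intro α ω₁ ω₂ j k hj hk
    simp only [g, Pi.sub_apply]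
    rw [if_pos (hj.trans hk.symm), if_pos (hj.trans hk.symm)]
    split_ifs with h2 h3
    · rw [← Complex.ofReal_sub, Complex.norm_real, Real.norm_eq_abs, ← Complex.sub_re]
      exact (Complex.abs_re_le_norm _).trans (hj ▸ (he j j rfl).2.2 ω₁ ω₂)
    · exact hj ▸ (he j k (hj.trans hk.symm)).2.2 ω₁ ω₂
    · rw [← star_sub, norm_star]
      exact hk ▸ (he k j (hk.trans hj.symm)).2.2 ω₁ ω₂
  refine ⟨g, fun ω hω => funext fun j => funext fun k => hg1 ω hω j k, fun ω j k h => if_neg h,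
    fun ω j k => ?_, fun O' α => ?_⟩
  · simp only [g, eq_comm (a := k.natAbs), eq_comm (a := k)]
    split_ifs with h1 h2 h3 h4 h5
    · subst h2
      exact Complex.conj_ofReal _
    · exact absurd h3 h4.le.not_gt
    · rfl
    · rw [star_star]
    · exact absurd (lt_trichotomy j k) (by tauto)
    · exact star_zero _
  · rw [lipNorm_eq, lipNorm_eq, mul_add, mul_left_comm]
    refine add_le_add (lipSup_le_iff.2 fun ω _ => ?_)
      (mul_le_mul_right (lipSemi_le_iff.2 fun ω₁ _ ω₂ _ _ => ?_) _)
    · have h1 := blockNorm_diag_le (bg α ω)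
      calc eblk α (g ω) ≤ ENNReal.ofReal (8 * s α) :=
            ENNReal.ofReal_le_ofReal (by linarith)
        _ = 8 * lipSup O (eblk α) f := by
            rw [ENNReal.ofReal_mul (by norm_num), ENNReal.ofReal_toReal (hS α)]
            norm_num
    · have h1 := blockNorm_diag_le (bgL α ω₁ ω₂)
      calc eblk α (g ω₁ - g ω₂) ≤ ENNReal.ofReal (8 * L α * ‖ω₁ - ω₂‖) :=
            ENNReal.ofReal_le_ofReal (by linarith)
        _ = 8 * lipSemi O (eblk α) f * ENNReal.ofReal ‖ω₁ - ω₂‖ := by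
            rw [ENNReal.ofReal_mul (by have := hL0 α; positivity), ENNReal.ofReal_mul (by norm_num),
              ENNReal.ofReal_toReal (hL α)]
            norm_num

/-- The time-independent block diagonal part of the first component. -/
def diagPart (A : BlockOp d) : ℤ → ℤ → ℂ := fun j k =>
  if j.natAbs = k.natAbs then A.1 0 j k else 0

theorem diagPart_sub (A B : BlockOp d) : diagPart (A - B) = diagPart A - diagPart B := by
  funext j k
  simp only [diagPart, Pi.sub_apply, Prod.fst_sub]
  split_ifs <;> simp

theorem isBlockDiag_diagPart (A : BlockOp d) : IsBlockDiag (diagPart A) := fun _ _ h => if_neg h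

theorem star_diagPart {A : BlockOp d} (h : adjOp A.1 = A.1) (j k : ℤ) :
    star (diagPart A k j) = diagPart A j k := by
  simp only [diagPart, eq_comm (a := k.natAbs)]
  split_ifs
  · have := congrFun (congrFun (congrFun h 0) j) k
    simpa [adjOp] using this
  · exact star_zero _

open scoped Matrix.Norms.L2Operator in
theorem eblk_diagPart_le (r : ℝ) (A : BlockOp d) (α : ℕ) :
    eblk α (diagPart A) ≤ ENNReal.ofReal (jap α)⁻¹ * blockOpNorm r 1 0 A := by
  have h1 : block (diagPart A) α α = block (A.1 0) α α := by
    ext r c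
    simp only [block, Matrix.of_apply, diagPart]
    rw [if_pos ((mem_shell.1 c.2).trans (mem_shell.1 r.2).symm)]
  have h2 : block (weight 1 0 A.1 0) α α = ((jap α : ℝ) : ℂ) • block (A.1 0) α α := by
    ext r c
    simp only [block, Matrix.of_apply, weight, Matrix.smul_apply, Real.rpow_one, Real.rpow_zero,
      smul_eq_mul]
    rw [← jap_natAbs, mem_shell.1 r.2]
    simp
  have h3 : blockNorm (weight 1 0 A.1 0) α α = jap α * blockNorm (diagPart A) α α := by
    rw [blockNorm, blockNorm, h1, h2, norm_smul, Complex.norm_real, Real.norm_of_nonneg (jap_pos _).le]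
  have h4 : ENNReal.ofReal (blockNorm (weight 1 0 A.1 0) α α) ≤ blockOpNorm r 1 0 A := by
    have h5 : decayNorm r (weight 1 0 A.1) ≤ blockOpNorm r 1 0 A := by
      rw [blockOpNorm, add_assoc, add_assoc, add_assoc]
      exact le_self_add
    refine le_trans ?_ h5
    rw [decayNorm_eq]
    refine le_trans ?_ (le_iSup _ α)
    refine le_trans ?_ (le_l2 _ ((0 : Fin d → ℤ), α))
    have : wt (0 : Fin d → ℤ) α (α : ℕ) = 1 := by simp [wt, len, jap]
    simp only [this, Real.one_rpow, one_mul]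
    exact le_rfl
  refine le_trans (le_of_eq ?_) (mul_le_mul_right h4 _)
  rw [h3, ← ENNReal.ofReal_mul (inv_nonneg.2 (jap_pos _).le), inv_mul_cancel_left₀ (jap_pos _).ne']
  rfl

theorem lipNorm_diagPart_le {γ : ℝ} (r : ℝ) (A : Freq d → BlockOp d) (α : ℕ) :
    lipNorm γ O (eblk α) (fun ω => diagPart (A ω)) ≤
      ENNReal.ofReal (jap α)⁻¹ * lipN γ O r 1 0 A :=
  lipNorm_le_mul (fun _ _ => eblk_diagPart_le r _ α) fun _ _ _ _ _ => by
    rw [← diagPart_sub]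
    exact eblk_diagPart_le r _ α

end Extension

/-! ### One step of the iteration -/

section Step

variable {d : ℕ} {M : ℤ → ℤ → ℂ} {ω : Freq d}

/-- Restriction of a kernel to a set of indices. -/
def mask (S : (Fin d → ℤ) → Bool × ℤ → Bool × ℤ → Prop) (X : FullOp d) : FullOp d := by
  classical exact fun l p q => if S l p q then X l p q else 0

theorem mask_pos {S : (Fin d → ℤ) → Bool × ℤ → Bool × ℤ → Prop} (X : FullOp d) {l : Fin d → ℤ}
    {p q : Bool × ℤ} (h : S l p q) : mask S X l p q = X l p q := if_pos h

theorem mask_neg {S : (Fin d → ℤ) → Bool × ℤ → Bool × ℤ → Prop} (X : FullOp d) {l : Fin d → ℤ}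
    {p q : Bool × ℤ} (h : ¬S l p q) : mask S X l p q = 0 := if_neg h

theorem mask_sub (S : (Fin d → ℤ) → Bool × ℤ → Bool × ℤ → Prop) (X Y : FullOp d) :
    mask S (X - Y) = mask S X - mask S Y := by
  funext l p q
  by_cases h : S l p q
  · simp [mask_pos _ h]
  · simp [mask_neg _ h]

theorem colN_mask_le (W : (Fin d → ℤ) → Bool × ℤ → Bool × ℤ → ℝ≥0∞)
    (S : (Fin d → ℤ) → Bool × ℤ → Bool × ℤ → Prop) (X : FullOp d) :
    colN W (mask S X) ≤ colN W X :=
  colN_mono fun l p q => by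
    by_cases h : S l p q
    · rw [mask_pos _ h]
    · rw [mask_neg _ h]
      simp

theorem IsHam.mask {S : (Fin d → ℤ) → Bool × ℤ → Bool × ℤ → Prop}
    (h1 : ∀ l p q, S (-l) (flip p) (flip q) ↔ S l p q) (h2 : ∀ l p q, S (-l) q p ↔ S l p q)
    {X : FullOp d} (hX : IsHam X) : IsHam (mask S X) := by
  constructor
  · funext l p q
    have h3 := congrFun (congrFun (congrFun hX.conj l) p) q
    by_cases h : S l p q
    · rw [conjFull, mask_pos _ ((h1 l p q).2 h), Pi.neg_apply, Pi.neg_apply, Pi.neg_apply,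
        mask_pos _ h]
      exact h3
    · rw [conjFull, mask_neg _ (fun h' => h ((h1 l p q).1 h')), Pi.neg_apply, Pi.neg_apply,
        Pi.neg_apply, mask_neg _ h]
      simp
  · funext l p q
    have h3 := congrFun (congrFun (congrFun hX.dag l) p) q
    by_cases h : S l p q
    · rw [WaveKAM.dag, mask_pos _ ((h2 l p q).2 h), mask_pos _ h]
      exact h3
    · rw [WaveKAM.dag, mask_neg _ (fun h' => h ((h2 l p q).1 h')), mask_neg _ h]
      simp

theorem IsHam.add {X Y : FullOp d} (hX : IsHam X) (hY : IsHam Y) : IsHam (X + Y) := by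
  constructor
  · funext l p q
    have h1 := congrFun (congrFun (congrFun hX.conj l) p) q
    have h2 := congrFun (congrFun (congrFun hY.conj l) p) q
    simp only [conjFull, Pi.neg_apply] at h1 h2
    simp only [conjFull, Pi.neg_apply, Pi.add_apply, star_add, h1, h2]
    ring
  · funext l p q
    have h1 := congrFun (congrFun (congrFun hX.dag l) p) q
    have h2 := congrFun (congrFun (congrFun hY.dag l) p) q
    simp only [WaveKAM.dag] at h1 h2
    simp only [WaveKAM.dag, Pi.add_apply, star_add, mul_add, h1, h2]

theorem IsHam.neg {X : FullOp d} (hX : IsHam X) : IsHam (-X) := by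
  constructor
  · funext l p q
    have h1 := congrFun (congrFun (congrFun hX.conj l) p) q
    simp only [conjFull, Pi.neg_apply] at h1
    simp only [conjFull, Pi.neg_apply, star_neg, h1]
  · funext l p q
    have h1 := congrFun (congrFun (congrFun hX.dag l) p) q
    simp only [WaveKAM.dag] at h1
    simp only [WaveKAM.dag, Pi.neg_apply, star_neg, mul_neg, h1]

/-- The indices above the cut-off. -/
def high (cut : ℝ) (l : Fin d → ℤ) (_ _ : Bool × ℤ) : Prop := cut < len l

theorem IsHam.mask_act {cut : ℝ} {X : FullOp d} (hX : IsHam X) : IsHam (WaveKAM.mask (act cut) X) :=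
  hX.mask (fun _ _ _ => act_neg_flip) fun _ _ _ => act_neg_swap

theorem IsHam.mask_high {cut : ℝ} {X : FullOp d} (hX : IsHam X) :
    IsHam (WaveKAM.mask (high cut) X) :=
  hX.mask (fun _ _ _ => by rw [high, high, len_neg]) fun _ _ _ => by rw [high, high, len_neg]

theorem full_sub_mask_act {cut : ℝ} (hcut : 0 ≤ cut) (A : BlockOp d) :
    full A - mask (act cut) (full A) =
      constKer (Fin d → ℤ) (hamMat (diagPart A)) + mask (high cut) (full A) := by
  funext l p q
  simp only [Pi.sub_apply, Pi.add_apply]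
  have hc : ∀ l p q, constKer (Fin d → ℤ) (hamMat (diagPart A)) l p q =
      if l = 0 then hamMat (diagPart A) p q else 0 := fun _ _ _ => by
    by_cases h : l = 0 <;> simp [constKer]
  rw [hc]
  by_cases h1 : len l ≤ cut
  · rw [mask_neg (S := high cut) _ (not_lt.2 h1)]
    by_cases h2 : l = 0 ∧ p.1 = q.1 ∧ p.2.natAbs = q.2.natAbs
    · rw [mask_neg (S := act cut) _ (fun h => h.2 h2), if_pos h2.1, h2.1]
      obtain ⟨_, h3, h4⟩ := h2
      obtain ⟨c, j⟩ := p
      obtain ⟨c', k⟩ := q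
      simp only at h3 h4
      subst h3
      cases c <;> simp [full, hamMat, diagPart, conjOp, h4]
    · rw [mask_pos (S := act cut) _ ⟨h1, h2⟩]
      split_ifs with h3
      · rw [hamMat_eq_zero (isBlockDiag_diagPart A), sub_self, add_zero]
        rw [mem_shellOf]
        exact fun h => h2 ⟨h3, h.1.symm, h.2.symm⟩
      · rw [sub_self, add_zero]
  · have h0 : l ≠ 0 := fun h => h1 (by rw [h]; simpa [len] using hcut)
    rw [mask_pos (S := high cut) _ (not_le.1 h1), mask_neg (S := act cut) _ (fun h => h1 h.1),
      if_neg h0, sub_zero, zero_add]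

theorem constKer_add (h h' : Bool × ℤ → Bool × ℤ → ℂ) :
    constKer (Fin d → ℤ) (h + h') = constKer (Fin d → ℤ) h + constKer (Fin d → ℤ) h' := by
  funext l p q
  by_cases hl : l = 0 <;> simp [constKer, hl]

theorem hamMat_add (M M' : ℤ → ℤ → ℂ) : hamMat (M + M') = hamMat M + hamMat M' := by
  funext p q
  simp only [hamMat, Pi.add_apply, star_add]
  split_ifs <;> ring

/-- Solution of the homological equation in the class of Hamiltonian operator matrices. -/
theorem exists_isHam_der_eq (hM : ∀ j k, star (M k j) = M j k) {cut c : ℝ} (hc : 0 < c)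
    (h : ∀ l p q, act cut l p q → IsGap M (dotZ ω l) p q (gapFun c p q)) {Y : FullOp d}
    (hY : IsHam Y) (hY0 : ∀ l p q, ¬act cut l p q → Y l p q = 0) :
    ∃ U : BlockOp d, IsHam (full U) ∧ (∀ l p q, ¬act cut l p q → full U l p q = 0) ∧
      der shellOf (hamMat M) (dotHom ω) (full U) = (-Complex.I) • Y := by
  obtain ⟨X, hX0, hX⟩ := exists_der_eq hM (gapFun_pos hc) h ((-Complex.I) • Y)
    (fun l p q ha => by simp [hY0 l p q ha])
  have hneg : der shellOf (hamMat M) (dotHom ω) (-X) = -der shellOf (hamMat M) (dotHom ω) X := by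
    funext l p q
    simp only [der, lact, ract, fmul, Pi.add_apply, Pi.sub_apply, Pi.neg_apply, mul_neg, neg_mul,
      Finset.sum_neg_distrib]
    ring
  have h1 : conjFull X = -X := by
    refine eq_of_der_eq hM (gapFun_pos hc) h (fun l p q ha => ?_) (fun l p q ha => ?_) ?_
    · rw [conjFull, hX0 _ _ _ (by rwa [act_neg_flip]), star_zero]
    · simp [hX0 l p q ha]
    · rw [der_conjFull, hneg, hX, conjFull_smul, hY.conj]
      simp
  have h2 : dag X = X := by
    refine eq_of_der_eq hM (gapFun_pos hc) h (fun l p q ha => ?_) hX0 ?_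
    · rw [dag, hX0 _ _ _ (by rwa [act_neg_swap]), star_zero, mul_zero]
    · rw [der_dag hM, hX, dag_smul, hY.dag]
      simp
  have h3 := full_unfull h1
  exact ⟨unfull X, by rw [h3]; exact ⟨h1, h2⟩, by rw [h3]; exact hX0, by rw [h3]; exact hX⟩

theorem lipNorm_sol_le {O : Set (Freq d)} {M : Freq d → ℤ → ℤ → ℂ} {lo hi lam cut c γ : ℝ}
    (hl : 0 ≤ lam) (hc : 0 < c) (hγ : 0 ≤ γ) (hcut : 0 ≤ cut)
    (hherm : ∀ ω ∈ O, ∀ j k, star (M ω k j) = M ω j k)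
    (hgap : ∀ ω ∈ O, ∀ l p q, act cut l p q → IsGap (M ω) (dotZ ω l) p q (gapFun c p q))
    (hlip : ∀ ω₁ ∈ O, ∀ ω₂ ∈ O, ∀ p q,
      ‖hamMat (M ω₁) p q - hamMat (M ω₂) p q‖ ≤ 2 * ‖ω₁ - ω₂‖)
    {X Y : Freq d → FullOp d} (hX : ∀ ω ∈ O, ∀ l p q, ¬act cut l p q → X ω l p q = 0)
    (hXY : ∀ ω ∈ O, der shellOf (hamMat (M ω)) (dotHom ω) (X ω) = (-Complex.I) • Y ω) :
    lipNorm γ O (colN (Wgt vOne lo hi lam)) X ≤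
      ENNReal.ofReal (4 * c⁻¹ + 64 * γ * (c⁻¹) ^ 2 * (4 + cut)) *
        lipNorm γ O (colN (Wgt vZero lo hi lam)) Y := by
  set S := lipSup O (colN (Wgt vZero lo hi lam)) Y
  set L := lipSemi O (colN (Wgt vZero lo hi lam)) Y
  have hI : ‖-Complex.I‖ₑ = 1 := by simp [← ofReal_norm]
  have e1 : ENNReal.ofReal (4 * c⁻¹ + 64 * γ * (c⁻¹) ^ 2 * (4 + cut)) =
      4 * ENNReal.ofReal c⁻¹ + 64 * ENNReal.ofReal γ * ENNReal.ofReal c⁻¹ ^ 2 *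
        ENNReal.ofReal (4 + cut) := by
    have hc' : 0 ≤ c⁻¹ := (inv_pos.2 hc).le
    rw [ENNReal.ofReal_add (by positivity) (by positivity), ENNReal.ofReal_mul (by norm_num),
      ENNReal.ofReal_mul (by positivity), ENNReal.ofReal_mul (by positivity),
      ENNReal.ofReal_mul (by norm_num), ENNReal.ofReal_pow hc']
    norm_num
  have h1 : lipSup O (colN (Wgt vOne lo hi lam)) X ≤ 4 * ENNReal.ofReal c⁻¹ * S := by
    refine lipSup_le_iff.2 fun ω hω => ?_
    refine (colN_le_of_der hl hc (hherm ω hω) (hgap ω hω) (hX ω hω)).trans ?_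
    rw [hXY ω hω, colN_smul, hI, one_mul, ← mul_assoc, mul_comm _ (4 : ℝ≥0∞)]
    exact mul_le_mul_right (le_lipSup hω) _
  have h2 : lipSemi O (colN (Wgt vOne lo hi lam)) X ≤ 4 * ENNReal.ofReal c⁻¹ * L +
      64 * ENNReal.ofReal c⁻¹ ^ 2 * ENNReal.ofReal (4 + cut) * S := by
    refine lipSemi_le_iff.2 fun ω₁ h₁ ω₂ h₂ hne => ?_
    refine (colN_sub_le_of_der hl hc (hherm ω₁ h₁) (hherm ω₂ h₂) (hgap ω₁ h₁) (hgap ω₂ h₂)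
      (hlip ω₁ h₁ ω₂ h₂) hcut (hX ω₁ h₁) (hX ω₂ h₂)).trans ?_
    rw [hXY ω₁ h₁, hXY ω₂ h₂, ← smul_sub, colN_smul, colN_smul, hI, one_mul, one_mul]
    have e2 : 2 * (2 * ‖ω₁ - ω₂‖) + ‖ω₁ - ω₂‖ * cut = (4 + cut) * ‖ω₁ - ω₂‖ := by ring
    rw [e2, ENNReal.ofReal_mul (by positivity)]
    have h3 : colN (Wgt vZero lo hi lam) (Y ω₁ - Y ω₂) ≤ L * ENNReal.ofReal ‖ω₁ - ω₂‖ :=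
      le_lipSemi h₁ h₂ hne
    have h4 : colN (Wgt vZero lo hi lam) (Y ω₂) ≤ S := le_lipSup h₂
    calc _ ≤ ENNReal.ofReal c⁻¹ * (4 * (L * ENNReal.ofReal ‖ω₁ - ω₂‖ +
          ENNReal.ofReal (4 + cut) * ENNReal.ofReal ‖ω₁ - ω₂‖ * (4 * (ENNReal.ofReal c⁻¹ *
            (4 * S))))) := by gcongr
      _ = _ := by ring
  rw [lipNorm_eq, lipNorm_eq, e1]
  calc _ ≤ 4 * ENNReal.ofReal c⁻¹ * S + ENNReal.ofReal γ * (4 * ENNReal.ofReal c⁻¹ * L +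
      64 * ENNReal.ofReal c⁻¹ ^ 2 * ENNReal.ofReal (4 + cut) * S) := by gcongr
    _ = (4 * ENNReal.ofReal c⁻¹ + 64 * ENNReal.ofReal γ * ENNReal.ofReal c⁻¹ ^ 2 *
        ENNReal.ofReal (4 + cut)) * S + 4 * ENNReal.ofReal c⁻¹ * (ENNReal.ofReal γ * L) := by ring
    _ ≤ (4 * ENNReal.ofReal c⁻¹ + 64 * ENNReal.ofReal γ * ENNReal.ofReal c⁻¹ ^ 2 *
        ENNReal.ofReal (4 + cut)) * S + (4 * ENNReal.ofReal c⁻¹ + 64 * ENNReal.ofReal γ *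
          ENNReal.ofReal c⁻¹ ^ 2 * ENNReal.ofReal (4 + cut)) * (ENNReal.ofReal γ * L) := by
        gcongr
        exact le_self_add
    _ = _ := by rw [← mul_add]

theorem exists_step {O : Set (Freq d)} {M : Freq d → ℤ → ℤ → ℂ} {lo hi lam cut c γ : ℝ}
    {C : ℝ≥0∞} (hW : IsModuleWeight (Wgt (d := d) vZero lo hi lam) (Wgt vOne lo hi lam) C)
    (hlo : (sZero d : ℝ) ≤ lo) (hl : 0 ≤ lam) (hc : 0 < c) (hγ : 0 ≤ γ) (hcut : 0 ≤ cut)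
    (hblk : ∀ ω ∈ O, IsBlockDiag (M ω))
    (hherm : ∀ ω ∈ O, ∀ j k, star (M ω k j) = M ω j k)
    (hgap : ∀ ω ∈ O, ∀ l p q, act cut l p q → IsGap (M ω) (dotZ ω l) p q (gapFun c p q))
    (hlip : ∀ ω₁ ∈ O, ∀ ω₂ ∈ O, ∀ p q,
      ‖hamMat (M ω₁) p q - hamMat (M ω₂) p q‖ ≤ 2 * ‖ω₁ - ω₂‖)
    (hgrow : ∀ ω ∈ O, ∃ t : ℝ, 0 ≤ t ∧ ∀ p q, ‖hamMat (M ω) p q‖ ≤ t * jap q.2)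
    {P : Freq d → BlockOp d} (hP : ∀ ω ∈ O, IsHam (full (P ω)))
    {μ θ : ℝ≥0∞} (hμ : lipNorm γ O (colN (Wgt vZero lo hi lam)) (fun ω => full (P ω)) ≤ μ)
    (hμ' : μ ≠ ⊤)
    (hθ : ENNReal.ofReal (4 * c⁻¹ + 64 * γ * (c⁻¹) ^ 2 * (4 + cut)) * μ ≤ θ)
    (hθ' : 2 * C * θ ≤ 1 / 2) :
    ∃ (U P' : Freq d → BlockOp d) (Q : Freq d → FullOp d),
      (∀ ω ∈ O, IsHam (full (U ω))) ∧ (∀ ω ∈ O, IsHam (full (P' ω))) ∧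
      lipNorm γ O (colN (Wgt vOne lo hi lam)) (fun ω => full (U ω)) ≤
        ENNReal.ofReal (4 * c⁻¹ + 64 * γ * (c⁻¹) ^ 2 * (4 + cut)) * μ ∧
      (∀ ω ∈ O, full (P' ω) = mask (high cut) (full (P ω)) + Q ω) ∧
      lipNorm γ O (colN (Wgt vZero lo hi lam)) Q ≤ 2 * (2 * C * θ) * (2 * μ) ∧
      ∀ ω ∈ O, Conjugates ω (U ω) (constOp (M ω) + P ω)
        (constOp (M ω + diagPart (P ω)) + P' ω) := by
  classical
  have exU : ∀ ω, ∃ U : BlockOp d, ω ∈ O → IsHam (full U) ∧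
      (∀ l p q, ¬act cut l p q → full U l p q = 0) ∧
      der shellOf (hamMat (M ω)) (dotHom ω) (full U) =
        (-Complex.I) • mask (act cut) (full (P ω)) := by
    intro ω
    by_cases hω : ω ∈ O
    · obtain ⟨U, hU⟩ := exists_isHam_der_eq (hherm ω hω) hc (hgap ω hω) (hP ω hω).mask_act
        (fun l p q ha => mask_neg _ ha)
      exact ⟨U, fun _ => hU⟩
    · exact ⟨0, fun h => absurd h hω⟩
  choose U hU using exU
  set g : Freq d → FullOp d := fun ω => -mask (act cut) (full (P ω)) with hg
  set u : Freq d → FullOp d := fun ω => (-Complex.I) • full (U ω) with hu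
  set Q : Freq d → FullOp d := fun ω => lieRemainder (u ω) (full (P ω)) (g ω) with hQ
  set P' : Freq d → BlockOp d := fun ω => unfull (mask (high cut) (full (P ω)) + Q ω) with hP'
  have hgHam : ∀ ω ∈ O, IsHam (g ω) := fun ω hω => (hP ω hω).mask_act.neg
  have hQHam : ∀ ω ∈ O, IsHam (Q ω) := fun ω hω =>
    (hU ω hω).1.lieRemainder (hP ω hω) (hgHam ω hω)
  have hsum : ∀ ω ∈ O, IsHam (mask (high cut) (full (P ω)) + Q ω) := fun ω hω =>
    (hP ω hω).mask_high.add (hQHam ω hω)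
  have hfull : ∀ ω ∈ O, full (P' ω) = mask (high cut) (full (P ω)) + Q ω := fun ω hω =>
    full_unfull (hsum ω hω).conj
  have hPm : lipNorm γ O (colN (Wgt vZero lo hi lam)) (fun ω => mask (act cut) (full (P ω))) ≤ μ := by
    refine le_trans ?_ hμ
    have := lipNorm_le_mul (γ := γ) (O := O) (c := 1) (N := colN (Wgt (d := d) vZero lo hi lam))
      (N' := colN (Wgt vZero lo hi lam)) (f := fun ω => mask (act cut) (full (P ω)))
      (g := fun ω => full (P ω)) (fun ω _ => by rw [one_mul]; exact colN_mask_le _ _ _)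
      (fun ω₁ _ ω₂ _ _ => by rw [one_mul, ← mask_sub]; exact colN_mask_le _ _ _)
    rwa [one_mul] at this
  have hUn : lipNorm γ O (colN (Wgt vOne lo hi lam)) (fun ω => full (U ω)) ≤
        ENNReal.ofReal (4 * c⁻¹ + 64 * γ * (c⁻¹) ^ 2 * (4 + cut)) * μ :=
    (lipNorm_sol_le hl hc hγ hcut hherm hgap hlip (fun ω hω => (hU ω hω).2.1)
      (fun ω hω => (hU ω hω).2.2)).trans (mul_le_mul_right hPm _)
  have hUtop : ENNReal.ofReal (4 * c⁻¹ + 64 * γ * (c⁻¹) ^ 2 * (4 + cut)) * μ ≠ ⊤ :=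
    ENNReal.mul_ne_top ENNReal.ofReal_ne_top hμ'
  have hI : ‖-Complex.I‖ₑ = 1 := by simp [← ofReal_norm]
  have hun : lipNorm γ O (colN (Wgt vOne lo hi lam)) u ≤
        ENNReal.ofReal (4 * c⁻¹ + 64 * γ * (c⁻¹) ^ 2 * (4 + cut)) * μ := by
    refine le_trans ?_ hUn
    have := lipNorm_le_mul (γ := γ) (O := O) (c := 1) (N := colN (Wgt (d := d) vOne lo hi lam))
      (N' := colN (Wgt vOne lo hi lam)) (f := u)
      (g := fun ω => full (U ω)) (fun ω _ => by rw [hu, colN_smul, hI])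
      (fun ω₁ _ ω₂ _ _ => by simp only [hu]; rw [← smul_sub, colN_smul, hI])
    rwa [one_mul] at this
  have hgn : lipNorm γ O (colN (Wgt vZero lo hi lam)) g ≤ μ := by
    refine le_trans ?_ hPm
    have := lipNorm_le_mul (γ := γ) (O := O) (c := 1) (N := colN (Wgt (d := d) vZero lo hi lam))
      (N' := colN (Wgt vZero lo hi lam)) (f := g)
      (g := fun ω => mask (act cut) (full (P ω))) (fun ω _ => by rw [hg, colN_neg, one_mul])
      (fun ω₁ _ ω₂ _ _ => by simp only [hg]; rw [neg_sub_neg, ← neg_sub, colN_neg, one_mul])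
    rwa [one_mul] at this
  have hQn : lipNorm γ O (colN (Wgt vZero lo hi lam)) Q ≤ 2 * (2 * C * θ) * (2 * μ) := by
    refine (hW.lipNorm_lieRemainder_le (le_trans (mul_le_mul_right (hun.trans hθ) _) hθ')
      (ne_top_of_le_ne_top hUtop hun) (ne_top_of_le_ne_top hμ' hμ)
      (ne_top_of_le_ne_top hμ' hgn)).trans ?_
    rw [two_mul μ]
    exact mul_le_mul' (mul_le_mul_right (mul_le_mul_right (hun.trans hθ) _) _) (add_le_add hμ hgn)
  refine ⟨U, P', Q, fun ω hω => (hU ω hω).1, fun ω hω => hfull ω hω ▸ hsum ω hω, hUn, hfull, hQn,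
    fun ω hω => ?_⟩
  obtain ⟨t, ht, htM⟩ := hgrow ω hω
  have hUω : colN (Wgt vOne lo hi lam) (full (U ω)) ≠ ⊤ :=
    ne_top_of_le_ne_top (ne_top_of_le_ne_top hUtop hUn) (le_lipNorm (f := fun ω => full (U ω)) hω)
  have hPω : colN (Wgt vZero lo hi lam) (full (P ω)) ≠ ⊤ :=
    ne_top_of_le_ne_top (ne_top_of_le_ne_top hμ' hμ) (le_lipNorm (f := fun ω => full (P ω)) hω)
  have hgω : colN (Wgt vZero lo hi lam) (g ω) ≠ ⊤ :=
    ne_top_of_le_ne_top (ne_top_of_le_ne_top hμ' hgn) (le_lipNorm hω)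
  refine conjugates_of_der (h := hamMat (M ω)) (P := full (P ω)) (g := g ω)
    (fun p q h => hamMat_eq_zero (hblk ω hω) p q h)
    (derDomain_of_colN hlo hl (hblk ω hω) htM ht (hU ω hω).2.1 hcut hUω)
    (ne_top_of_le_ne_top (ENNReal.mul_ne_top hW.ne_top hPω) (hW.bdd _))
    (ne_top_of_le_ne_top (ENNReal.mul_ne_top hW.ne_top hgω) (hW.bdd _)) ?_ ?_ ?_
  · rw [(hU ω hω).2.2, hg]
    simp only [smul_neg, neg_smul]
  · rw [full_add, full_constOp]
  · rw [full_add, full_constOp, hfull ω hω, hamMat_add, constKer_add]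
    have h3 := full_sub_mask_act hcut (P ω)
    have h4 : full (P ω) + g ω = constKer (Fin d → ℤ) (hamMat (diagPart (P ω))) +
        mask (high cut) (full (P ω)) := by
      rw [← h3, hg, sub_eq_add_neg]
    rw [h4, add_assoc, ← add_assoc (constKer _ (hamMat (diagPart (P ω))))]

end Step

/-! ### Quantitative estimates for one step -/

section Quantitative

variable {d : ℕ} {O : Set (Freq d)} {γ : ℝ}

theorem colN_high_le {v : Bool × ℤ → Bool × ℤ → ℝ} (hv : ∀ p q, 0 ≤ v p q) {cut lo hi : ℝ}
    (hcut : 0 < cut) (h : lo ≤ hi) (X : FullOp d) :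
    colN (WR v lo) (mask (high cut) X) ≤ ENNReal.ofReal (cut ^ (lo - hi)) * colN (WR v hi) X :=
  colN_le_mul fun l p q => by
    by_cases hl : high cut l p q
    · rw [mask_pos _ hl, ← mul_assoc, WR, WR, ← ENNReal.ofReal_mul (by positivity)]
      refine mul_le_mul_left (ENNReal.ofReal_le_ofReal ?_) _
      have hw := wt_pos l p.2 q.2
      have h1 : cut ≤ wt l p.2 q.2 := (show cut < len l from hl).le.trans (le_max_right _ _)
      have h2 : wt l p.2 q.2 ^ (lo - hi) ≤ cut ^ (lo - hi) :=
        Real.rpow_le_rpow_of_nonpos hcut h1 (by linarith)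
      calc v p q * wt l p.2 q.2 ^ lo = v p q * (wt l p.2 q.2 ^ (lo - hi) * wt l p.2 q.2 ^ hi) := by
            rw [← Real.rpow_add hw, sub_add_cancel]
        _ ≤ v p q * (cut ^ (lo - hi) * wt l p.2 q.2 ^ hi) := by
            have := hv p q
            gcongr
        _ = _ := by ring
    · rw [mask_neg _ hl]
      simp

theorem lipN_le_of_full_eq {W : (Fin d → ℤ) → Bool × ℤ → Bool × ℤ → ℝ≥0∞} {cut r hi : ℝ}
    {t₁ t₂ : ℝ≥0∞} {P P' : Freq d → BlockOp d} {Q : Freq d → FullOp d}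
    (h1 : ∀ B : BlockOp d,
      colN (WR vZero r) (mask (high cut) (full B)) ≤ t₁ * blockOpNorm hi 1 0 B)
    (h2 : ∀ X : FullOp d, colN (WR vZero r) X ≤ t₂ * colN W X)
    (hfull : ∀ ω ∈ O, full (P' ω) = mask (high cut) (full (P ω)) + Q ω) :
    lipN γ O r 1 0 P' ≤ 40 * t₁ * lipN γ O hi 1 0 P + 40 * t₂ * lipNorm γ O (colN W) Q := by
  have h3 : ∀ (A B : BlockOp d) (X : FullOp d), full A = mask (high cut) (full B) + X →
      blockOpNorm r 1 0 A ≤ 40 * t₁ * blockOpNorm hi 1 0 B + 40 * t₂ * colN W X := by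
    intro A B X h
    refine (blockOpNorm_one_zero_le r A).trans ?_
    rw [h, mul_assoc, mul_assoc, ← mul_add]
    exact mul_le_mul_right ((colN_add_le _ _ _).trans (add_le_add (h1 B) (h2 X))) _
  have h4 := lipNorm_le_add (γ := γ) (O := O) (N := blockOpNorm r 1 0)
    (N₁ := fun B => 40 * t₁ * blockOpNorm hi 1 0 B) (N₂ := fun X => 40 * t₂ * colN W X) (f := P')
    (f₁ := P) (f₂ := Q) (fun ω hω => h3 _ _ _ (hfull ω hω)) (fun ω₁ hω₁ ω₂ hω₂ _ => h3 _ _ _ (by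
      rw [full_sub, full_sub, mask_sub, hfull ω₁ hω₁, hfull ω₂ hω₂]
      abel))
  exact h4.trans (add_le_add (lipNorm_le_mul (fun _ _ => le_rfl) fun _ _ _ _ _ => le_rfl)
    (lipNorm_le_mul (fun _ _ => le_rfl) fun _ _ _ _ _ => le_rfl))

theorem decayNorm_mono {r s : ℝ} (h : r ≤ s) (A : Coef d) : decayNorm r A ≤ decayNorm s A := by
  rw [decayNorm_eq, decayNorm_eq]
  refine iSup_mono fun α => l2_mono fun p => ENNReal.ofReal_le_ofReal ?_
  exact mul_le_mul_of_nonneg_right (Real.rpow_le_rpow_of_exponent_le (one_le_wt _ _ _) h)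
    (blockNorm_nonneg _ _ _)

theorem lipN_mono {r s ρ o : ℝ} (h : r ≤ s) (A : Freq d → BlockOp d) :
    lipN γ O r ρ o A ≤ lipN γ O s ρ o A := by
  have h1 : ∀ B : BlockOp d, blockOpNorm r ρ o B ≤ blockOpNorm s ρ o B := fun B => by
    have h2 := decayNorm_mono (d := d) h
    unfold blockOpNorm
    gcongr <;> exact h2 _
  have := lipNorm_le_mul (γ := γ) (O := O) (c := 1) (N := blockOpNorm r ρ o)
    (N' := blockOpNorm s ρ o) (f := A) (g := A) (fun _ _ => by rw [one_mul]; exact h1 _)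
    (fun _ _ _ _ _ => by rw [one_mul]; exact h1 _)
  rwa [one_mul] at this

/-- The ratio of the Melnikov scale to the cut-off. -/
def cutRatio : ℝ := 40960

theorem solution_factor_le {τ N A a : ℝ} (hγ : 0 < γ) (hτ : 0 < τ) (hN : 200000 ≤ N) (hA : 1 ≤ A) :
    40 * ((4 * (γ / N ^ τ)⁻¹ + 64 * γ * ((γ / N ^ τ)⁻¹) ^ 2 * (4 + N / cutRatio)) *
      (4 * A ^ (-a))) ≤ γ⁻¹ * N ^ (2 * τ + 1) * A ^ (-a) := by
  have hN0 : 0 < N := by linarith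
  set T := N ^ τ with hT
  have hT1 : 1 ≤ T := Real.one_le_rpow (by linarith) hτ.le
  have e1 : N ^ (2 * τ + 1) = T ^ 2 * N := by
    rw [Real.rpow_add hN0, Real.rpow_one, hT, mul_comm 2 τ, Real.rpow_mul hN0.le]
    norm_num
  have hA' : 0 ≤ A ^ (-a) := Real.rpow_nonneg (by linarith) _
  have e2 : 40 * ((4 * (γ / T)⁻¹ + 64 * γ * ((γ / T)⁻¹) ^ 2 * (4 + N / cutRatio)) *
      (4 * A ^ (-a))) = γ⁻¹ * (640 * T + 10240 * T ^ 2 * (4 + N / cutRatio)) * A ^ (-a) := by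
    field_simp
    ring
  rw [e1, e2]
  refine mul_le_mul_of_nonneg_right (mul_le_mul_of_nonneg_left ?_ (inv_pos.2 hγ).le) hA'
  rw [cutRatio]
  have h1 : T ≤ T ^ 2 := by nlinarith
  have h2 : T ^ 2 * 200000 ≤ T ^ 2 * N := mul_le_mul_of_nonneg_left hN (by positivity)
  nlinarith

theorem exists_step_bounds {M : Freq d → ℤ → ℤ → ℂ} {τ hi N A ε C : ℝ} {ϖ : ℝ≥0∞}
    (hW : ∀ lam : ℝ, 0 ≤ lam → IsModuleWeight (Wgt (d := d) vZero (hi - bExp τ) hi lam)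
      (Wgt vOne (hi - bExp τ) hi lam) (ENNReal.ofReal C)) (hC : 1 ≤ C)
    (hlo : (sZero d : ℝ) ≤ hi - bExp τ) (hτ : 0 < τ) (hγ : 0 < γ) (hε : 0 ≤ ε) (hA : 1 ≤ A)
    (hN : 200000 ≤ N) (hAN : 2560 * cutRatio ^ bExp τ * A ≤ N)
    (hx : 40960 * C * (ε * γ⁻¹ * N ^ (2 * τ + 1 + aExp τ)) ≤ A ^ (2 * aExp τ))
    (hblk : ∀ ω ∈ O, IsBlockDiag (M ω))
    (hherm : ∀ ω ∈ O, ∀ j k, star (M ω k j) = M ω j k)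
    (hgap : ∀ ω ∈ O, ∀ l p q, act (N / cutRatio) l p q →
      IsGap (M ω) (dotZ ω l) p q (gapFun (γ / N ^ τ) p q))
    (hlip : ∀ ω₁ ∈ O, ∀ ω₂ ∈ O, ∀ p q,
      ‖hamMat (M ω₁) p q - hamMat (M ω₂) p q‖ ≤ 2 * ‖ω₁ - ω₂‖)
    (hgrow : ∀ ω ∈ O, ∃ t : ℝ, 0 ≤ t ∧ ∀ p q, ‖hamMat (M ω) p q‖ ≤ t * jap q.2)
    {P : Freq d → BlockOp d} (hP : ∀ ω ∈ O, IsHam (full (P ω))) (hϖ : ϖ ≤ ENNReal.ofReal ε)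
    (hhi : lipN γ O hi 1 0 P ≤ ϖ * ENNReal.ofReal A)
    (hlo' : lipN γ O (hi - bExp τ) 1 0 P ≤ ϖ * ENNReal.ofReal (A ^ (-aExp τ))) :
    ∃ U P' : Freq d → BlockOp d,
      (∀ ω ∈ O, IsHam (full (U ω))) ∧ (∀ ω ∈ O, IsHam (full (P' ω))) ∧
      lipN γ O (hi - bExp τ) 1 1 U ≤
        ϖ * ENNReal.ofReal (γ⁻¹ * N ^ (2 * τ + 1) * A ^ (-aExp τ)) ∧
      lipN γ O hi 1 1 U < ⊤ ∧
      lipN γ O hi 1 0 P' ≤ ϖ * ENNReal.ofReal N ∧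
      lipN γ O (hi - bExp τ) 1 0 P' ≤ ϖ * ENNReal.ofReal (N ^ (-aExp τ) / 16) ∧
      ∀ ω ∈ O, Conjugates ω (U ω) (constOp (M ω) + P ω)
        (constOp (M ω + diagPart (P ω)) + P' ω) := by
  have hA0 : 0 < A := by linarith
  have hN0 : 0 < N := by linarith
  have hK : (1 : ℝ) ≤ cutRatio := by norm_num [cutRatio]
  have hK0 : 0 < cutRatio := by linarith
  have ha : 0 < aExp τ := by rw [aExp]; linarith
  have hb : 0 < bExp τ := by rw [bExp]; linarith
  have hle : hi - bExp τ ≤ hi := by linarith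
  have hcut : 0 < N / cutRatio := by positivity
  have hϖtop : ϖ ≠ ⊤ := ne_top_of_le_ne_top ENNReal.ofReal_ne_top hϖ
  set a := aExp τ with ha_def
  set b := bExp τ with hb_def
  have hba : b = a + 1 := rfl
  set lam := A ^ (-b) with hlam
  have hlam0 : 0 < lam := Real.rpow_pos_of_pos hA0 _
  have hAa : 0 < A ^ (-a) := Real.rpow_pos_of_pos hA0 _
  have hNa : 0 < N ^ (-a) := Real.rpow_pos_of_pos hN0 _
  have hlamA : lam * A = A ^ (-a) := by
    rw [hlam]
    nth_rewrite 2 [← Real.rpow_one A]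
    rw [← Real.rpow_add hA0, hba]
    congr 1
    ring
  set μ : ℝ≥0∞ := ϖ * ENNReal.ofReal (4 * A ^ (-a)) with hμ_def
  have hμ : lipNorm γ O (colN (Wgt (d := d) vZero (hi - b) hi lam)) (fun ω => full (P ω)) ≤ μ := by
    refine (lipNorm_full_le _ hlam0.le).trans ?_
    calc _ ≤ 2 * (ϖ * ENNReal.ofReal (A ^ (-a)) + ENNReal.ofReal lam * (ϖ * ENNReal.ofReal A)) := by
          gcongr
      _ = ϖ * (2 * (ENNReal.ofReal (A ^ (-a)) + ENNReal.ofReal lam * ENNReal.ofReal A)) := by ring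
      _ = μ := by
          rw [← ENNReal.ofReal_mul hlam0.le, hlamA, hμ_def, ENNReal.ofReal_mul (by norm_num),
            show ENNReal.ofReal 4 = 4 by norm_num]
          ring
  have hμtop : μ ≠ ⊤ := ENNReal.mul_ne_top hϖtop ENNReal.ofReal_ne_top
  set F := 4 * (γ / N ^ τ)⁻¹ + 64 * γ * ((γ / N ^ τ)⁻¹) ^ 2 * (4 + N / cutRatio) with hF
  have hF0 : 0 ≤ F := by positivity
  have hfac : 40 * (F * (4 * A ^ (-a))) ≤ γ⁻¹ * N ^ (2 * τ + 1) * A ^ (-a) :=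
    solution_factor_le hγ hτ hN hA
  set x := ε * (γ⁻¹ * N ^ (2 * τ + 1) * A ^ (-a)) with hx_def
  have hx0 : 0 ≤ x := by positivity
  have hxx : 40960 * (C * x) ≤ A ^ a * N ^ (-a) := by
    have e1 : N ^ (2 * τ + 1 + a) = N ^ (2 * τ + 1) * N ^ a := Real.rpow_add hN0 _ _
    have e2 : A ^ (2 * a) = A ^ a * A ^ a := by rw [← Real.rpow_add hA0]; congr 1; ring
    have e3 : A ^ (-a) = (A ^ a)⁻¹ := Real.rpow_neg hA0.le _
    have e4 : N ^ (-a) = (N ^ a)⁻¹ := Real.rpow_neg hN0.le _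
    have hA1 : 0 < A ^ a := Real.rpow_pos_of_pos hA0 _
    have hN1 : 0 < N ^ a := Real.rpow_pos_of_pos hN0 _
    rw [e1, e2] at hx
    rw [hx_def, e3, e4, ← div_eq_mul_inv (A ^ a), le_div_iff₀ hN1]
    calc 40960 * (C * (ε * (γ⁻¹ * N ^ (2 * τ + 1) * (A ^ a)⁻¹))) * N ^ a
        = (40960 * C * (ε * γ⁻¹ * (N ^ (2 * τ + 1) * N ^ a))) * (A ^ a)⁻¹ := by ring
      _ ≤ (A ^ a * A ^ a) * (A ^ a)⁻¹ := mul_le_mul_of_nonneg_right hx (inv_pos.2 hA1).le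
      _ = A ^ a := by field_simp
  have hKb : 1 ≤ cutRatio ^ b := Real.one_le_rpow hK hb.le
  have hAN1 : 2560 * A ≤ N := le_trans (by nlinarith) hAN
  have hAaNa : A ^ a * N ^ (-a) ≤ 1 := by
    have h1 : A ^ a ≤ N ^ a := Real.rpow_le_rpow hA0.le (by linarith) ha.le
    rw [Real.rpow_neg hN0.le, ← div_eq_mul_inv, div_le_one (Real.rpow_pos_of_pos hN0 _)]
    exact h1
  have hC0 : 0 < C := by linarith
  have hCx : 40960 * (C * x) ≤ 1 := hxx.trans hAaNa
  have hCx0 : 0 ≤ C * x := by positivity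
  obtain ⟨U, P', Q, hU, hP', hUn, hfull, hQ, hconj⟩ := exists_step (hW lam hlam0.le) hlo hlam0.le
    (c := γ / N ^ τ) (by positivity) hγ.le hcut.le hblk hherm hgap hlip hgrow hP hμ hμtop
    (θ := ENNReal.ofReal x) (by
      calc ENNReal.ofReal F * μ = ϖ * (ENNReal.ofReal F * ENNReal.ofReal (4 * A ^ (-a))) := by
            rw [hμ_def]; ring
        _ ≤ ENNReal.ofReal ε * (ENNReal.ofReal F * ENNReal.ofReal (4 * A ^ (-a))) := by gcongr
        _ = ENNReal.ofReal (ε * (F * (4 * A ^ (-a)))) := by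
            rw [← ENNReal.ofReal_mul hF0, ← ENNReal.ofReal_mul hε]
        _ ≤ ENNReal.ofReal x := by
            refine ENNReal.ofReal_le_ofReal (mul_le_mul_of_nonneg_left (le_trans ?_ hfac) hε)
            have : 0 ≤ F * (4 * A ^ (-a)) := by positivity
            linarith) (by
      rw [mul_assoc, ← ENNReal.ofReal_mul hC0.le, show (2 : ℝ≥0∞) = ENNReal.ofReal 2 by norm_num,
        ← ENNReal.ofReal_mul (by norm_num), show (1 : ℝ≥0∞) / ENNReal.ofReal 2 =
          ENNReal.ofReal (1 / 2) by rw [ENNReal.ofReal_div_of_pos (by norm_num)]; norm_num]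
      exact ENNReal.ofReal_le_ofReal (by linarith))
  have hQ' : lipNorm γ O (colN (Wgt vZero (hi - b) hi lam)) Q ≤
      ϖ * ENNReal.ofReal (32 * (C * x) * A ^ (-a)) := by
    refine hQ.trans (le_of_eq ?_)
    rw [hμ_def]
    have h8 : ENNReal.ofReal (32 * (C * x) * A ^ (-a)) =
        8 * (ENNReal.ofReal C * ENNReal.ofReal x) * ENNReal.ofReal (4 * A ^ (-a)) := by
      rw [← ENNReal.ofReal_mul hC0.le, show (8 : ℝ≥0∞) = ENNReal.ofReal 8 by norm_num,
        ← ENNReal.ofReal_mul (by norm_num), ← ENNReal.ofReal_mul (by positivity)]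
      congr 1
      ring
    rw [h8]
    ring
  have hUlo : lipN γ O (hi - b) 1 1 U ≤
        ϖ * ENNReal.ofReal (γ⁻¹ * N ^ (2 * τ + 1) * A ^ (-a)) := by
    refine (lipN_one_lo_le _ hlam0.le (hi := hi)).trans ((mul_le_mul_right hUn _).trans ?_)
    calc 40 * (ENNReal.ofReal F * μ) = ϖ * (40 * (ENNReal.ofReal F * ENNReal.ofReal (4 * A ^ (-a)))) := by
          rw [hμ_def]; ring
      _ = ϖ * ENNReal.ofReal (40 * (F * (4 * A ^ (-a)))) := by
          rw [← ENNReal.ofReal_mul hF0, ENNReal.ofReal_mul (by norm_num : (0 : ℝ) ≤ 40)]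
          norm_num
      _ ≤ _ := mul_le_mul_right (ENNReal.ofReal_le_ofReal hfac) _
  have hUhi : lipN γ O hi 1 1 U < ⊤ :=
    (lipN_one_hi_le _ hlam0 (lo := hi - b)).trans_lt (ENNReal.mul_lt_top (ENNReal.mul_lt_top (by norm_num)
      ENNReal.ofReal_lt_top) (hUn.trans_lt (ENNReal.mul_lt_top ENNReal.ofReal_lt_top hμtop.lt_top)))
  have hv : ∀ p q, 0 ≤ vZero p q := fun p q => zero_le_one.trans (one_le_vZero p q)
  have hy : 0 ≤ 32 * (C * x) * A ^ (-a) := by positivity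
  have hPhi : lipN γ O hi 1 0 P' ≤ ϖ * ENNReal.ofReal N := by
    refine (lipN_le_of_full_eq (t₁ := 2) (t₂ := ENNReal.ofReal lam⁻¹)
      (W := Wgt vZero (hi - b) hi lam)
      (fun B => (colN_mask_le _ _ _).trans (colN_full_le_blockOpNorm hi B))
      (fun X => colN_WR_hi_le hv hlam0 X) hfull).trans ?_
    calc _ ≤ 40 * 2 * (ϖ * ENNReal.ofReal A) + 40 * ENNReal.ofReal lam⁻¹ *
          (ϖ * ENNReal.ofReal (32 * (C * x) * A ^ (-a))) := by gcongr
      _ = ϖ * (80 * ENNReal.ofReal A + 40 * (ENNReal.ofReal lam⁻¹ *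
          ENNReal.ofReal (32 * (C * x) * A ^ (-a)))) := by ring
      _ = ϖ * ENNReal.ofReal (80 * A + 40 * (lam⁻¹ * (32 * (C * x) * A ^ (-a)))) := by
          generalize 32 * (C * x) * A ^ (-a) = y at hy ⊢
          rw [ENNReal.ofReal_add (by positivity) (by positivity), ENNReal.ofReal_mul (by norm_num),
            ENNReal.ofReal_mul (by norm_num : (0 : ℝ) ≤ 40), ENNReal.ofReal_mul (inv_pos.2 hlam0).le]
          norm_num
      _ ≤ _ := by
          refine mul_le_mul_right (ENNReal.ofReal_le_ofReal ?_) _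
          have e1 : lam⁻¹ * (32 * (C * x) * A ^ (-a)) = 32 * (C * x) * A := by
            rw [← hlamA]
            field_simp
          rw [e1]
          nlinarith
  have hPlo : lipN γ O (hi - b) 1 0 P' ≤ ϖ * ENNReal.ofReal (N ^ (-a) / 16) := by
    refine (lipN_le_of_full_eq (t₁ := ENNReal.ofReal ((N / cutRatio) ^ (-b)) * 2) (t₂ := 1)
      (W := Wgt vZero (hi - b) hi lam) (hi := hi)
      (fun B => (colN_high_le hv hcut hle _).trans (by
        rw [mul_assoc, sub_sub_cancel_left]
        exact mul_le_mul_right (colN_full_le_blockOpNorm hi B) _))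
      (fun X => by rw [one_mul]; exact colN_WR_lo_le hv hlam0.le X) hfull).trans ?_
    calc _ ≤ 40 * (ENNReal.ofReal ((N / cutRatio) ^ (-b)) * 2) * (ϖ * ENNReal.ofReal A) + 40 * 1 *
          (ϖ * ENNReal.ofReal (32 * (C * x) * A ^ (-a))) := by gcongr
      _ = ϖ * (80 * (ENNReal.ofReal ((N / cutRatio) ^ (-b)) * ENNReal.ofReal A) +
          40 * ENNReal.ofReal (32 * (C * x) * A ^ (-a))) := by ring
      _ = ϖ * ENNReal.ofReal (80 * ((N / cutRatio) ^ (-b) * A) +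
          40 * (32 * (C * x) * A ^ (-a))) := by
          generalize 32 * (C * x) * A ^ (-a) = y at hy ⊢
          rw [ENNReal.ofReal_add (by positivity) (by positivity), ENNReal.ofReal_mul (by norm_num),
            ENNReal.ofReal_mul (by norm_num : (0 : ℝ) ≤ 40), ENNReal.ofReal_mul (by positivity)]
          norm_num
      _ ≤ _ := by
          refine mul_le_mul_right (ENNReal.ofReal_le_ofReal ?_) _
          have e1 : (N / cutRatio) ^ (-b) = N ^ (-a) * N⁻¹ * cutRatio ^ b := by
            rw [Real.div_rpow hN0.le hK0.le, Real.rpow_neg hK0.le, div_inv_eq_mul, hba, neg_add,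
              Real.rpow_add hN0, Real.rpow_neg_one]
          have e2 : 80 * ((N / cutRatio) ^ (-b) * A) ≤ N ^ (-a) / 32 := by
            rw [e1]
            calc 80 * (N ^ (-a) * N⁻¹ * cutRatio ^ b * A) =
                N ^ (-a) / 32 * (N⁻¹ * (2560 * cutRatio ^ b * A)) := by ring
              _ ≤ N ^ (-a) / 32 * (N⁻¹ * N) := by gcongr
              _ = N ^ (-a) / 32 := by rw [inv_mul_cancel₀ hN0.ne', mul_one]
          have e3 : 40 * (32 * (C * x) * A ^ (-a)) ≤ N ^ (-a) / 32 := by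
            calc 40 * (32 * (C * x) * A ^ (-a)) = 40960 * (C * x) * A ^ (-a) / 32 := by ring
              _ ≤ A ^ a * N ^ (-a) * A ^ (-a) / 32 := by gcongr
              _ = N ^ (-a) / 32 * (A ^ a * A ^ (-a)) := by ring
              _ = N ^ (-a) / 32 := by
                  rw [← Real.rpow_add hA0, add_neg_cancel, Real.rpow_zero, mul_one]
          linarith
  exact ⟨U, P', hU, hP', hUlo, hUhi, hPhi, hPlo, hconj⟩

end Quantitative

/-! ### The scales -/

section Scales

variable {N₀ : ℕ}

theorem scale_natCast (n : ℕ) : scale N₀ n = (N₀ : ℝ) ^ ((3 / 2 : ℝ) ^ n) := by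
  rw [scale, if_neg (by omega)]
  simp

theorem scale_zero_sub_one : scale N₀ ((0 : ℕ) - 1 : ℤ) = 1 := by
  rw [scale, if_pos (by norm_num)]

theorem scale_succ_sub_one (n : ℕ) : scale N₀ ((n + 1 : ℕ) - 1 : ℤ) = scale N₀ n := by
  congr 1
  push_cast
  ring

theorem scale_succ (n : ℕ) : scale N₀ (n + 1 : ℕ) = scale N₀ n ^ (3 / 2 : ℝ) := by
  rw [scale_natCast, scale_natCast, ← Real.rpow_mul (Nat.cast_nonneg _), pow_succ]

theorem le_scale (h : 1 ≤ N₀) (n : ℕ) : (N₀ : ℝ) ≤ scale N₀ n := by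
  rw [scale_natCast]
  have h1 : (1 : ℝ) ≤ N₀ := by exact_mod_cast h
  calc (N₀ : ℝ) = (N₀ : ℝ) ^ (1 : ℝ) := (Real.rpow_one _).symm
    _ ≤ _ := Real.rpow_le_rpow_of_exponent_le h1 (one_le_pow₀ (by norm_num))

theorem one_le_scale_sub_one (h : 1 ≤ N₀) (n : ℕ) : 1 ≤ scale N₀ (n - 1 : ℤ) := by
  cases n with
  | zero => rw [scale_zero_sub_one]
  | succ n =>
    rw [scale_succ_sub_one]
    exact le_trans (by exact_mod_cast h) (le_scale h n)

theorem mul_scale_sub_one_le {R : ℝ} (hR : 1 ≤ R) (h : R ^ 2 ≤ N₀) (n : ℕ) :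
    R * scale N₀ (n - 1 : ℤ) ≤ scale N₀ n := by
  have h1 : (1 : ℝ) ≤ N₀ := le_trans (by nlinarith) h
  have h1' : 1 ≤ N₀ := by exact_mod_cast h1
  cases n with
  | zero =>
    rw [scale_zero_sub_one, mul_one]
    exact le_trans (by nlinarith) (le_scale h1' 0)
  | succ n =>
    rw [scale_succ_sub_one, scale_succ]
    have h2 := le_scale h1' n
    set S := scale N₀ n
    have hS : 0 < S := by linarith
    have h3 : R ≤ S ^ (1 / 2 : ℝ) := by
      rw [← Real.sqrt_eq_rpow]
      exact Real.le_sqrt_of_sq_le (h.trans h2)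
    calc R * S ≤ S ^ (1 / 2 : ℝ) * S ^ (1 : ℝ) := by
          rw [Real.rpow_one]
          exact mul_le_mul_of_nonneg_right h3 hS.le
      _ = S ^ (3 / 2 : ℝ) := by rw [← Real.rpow_add hS]; norm_num

theorem two_pow_le_scale_sub_one (h : 4 ≤ N₀) (n : ℕ) : (2 : ℝ) ^ n ≤ scale N₀ (n - 1 : ℤ) := by
  induction n with
  | zero => rw [scale_zero_sub_one, pow_zero]
  | succ n ih =>
    rw [scale_succ_sub_one, pow_succ']
    refine le_trans (mul_le_mul_of_nonneg_left ih zero_le_two) (mul_scale_sub_one_le one_le_two ?_ n)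
    have : (4 : ℝ) ≤ N₀ := by exact_mod_cast h
    linarith

theorem scale_rpow_neg_le (h : 4 ≤ N₀) (n : ℕ) {a : ℝ} (ha : 1 ≤ a) :
    scale N₀ (n - 1 : ℤ) ^ (-a) ≤ (1 / 2 : ℝ) ^ n := by
  have h1 := two_pow_le_scale_sub_one h n
  have h2 : (1 : ℝ) ≤ scale N₀ (n - 1 : ℤ) := one_le_scale_sub_one (by omega) n
  have h3 : (0 : ℝ) < 2 ^ n := by positivity
  calc _ ≤ scale N₀ (n - 1 : ℤ) ^ (-1 : ℝ) := Real.rpow_le_rpow_of_exponent_le h2 (by linarith)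
    _ = (scale N₀ (n - 1 : ℤ))⁻¹ := Real.rpow_neg_one _
    _ ≤ (2 ^ n)⁻¹ := inv_anti₀ h3 h1
    _ = _ := by rw [one_div, inv_pow]

theorem smallness_scale {τ x : ℝ} (hτ : 0 < τ) (h : 1 ≤ N₀) (hx0 : 0 ≤ x)
    (hx : x * (N₀ : ℝ) ^ (2 * τ + 1 + aExp τ) ≤ 1) (n : ℕ) :
    x * scale N₀ n ^ (2 * τ + 1 + aExp τ) ≤ scale N₀ (n - 1 : ℤ) ^ (2 * aExp τ) := by
  have h1 : (1 : ℝ) ≤ N₀ := by exact_mod_cast h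
  cases n with
  | zero =>
    rw [scale_zero_sub_one, Real.one_rpow, scale_natCast, pow_zero, Real.rpow_one]
    exact hx
  | succ n =>
    rw [scale_succ_sub_one, scale_succ]
    have h2 := le_scale h n
    set S := scale N₀ n
    have hS : 1 ≤ S := by linarith
    have h3 : 1 ≤ (N₀ : ℝ) ^ (2 * τ + 1 + aExp τ) :=
      Real.one_le_rpow h1 (by rw [aExp]; linarith)
    have h4 : x ≤ 1 := by nlinarith
    rw [← Real.rpow_mul (by linarith)]
    have h5 : S ^ (3 / 2 * (2 * τ + 1 + aExp τ)) ≤ S ^ (2 * aExp τ) :=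
      Real.rpow_le_rpow_of_exponent_le hS (by rw [aExp]; linarith)
    have h6 : 0 ≤ S ^ (3 / 2 * (2 * τ + 1 + aExp τ)) := Real.rpow_nonneg (by linarith) _
    nlinarith

end Scales

/-! ### The initial normal form and its perturbations -/

section NormalForms

variable {d : ℕ} {B : Set (Freq d)} {γ m ε C₀ : ℝ} {κ : ℤ → Freq d → ℝ}
  {D : Freq d → ℤ → ℤ → ℂ}

theorem isBlockDiag_initialDiag (m : ℝ) (k : ℤ → ℝ) : IsBlockDiag (initialDiag m k) :=
  fun i j h => if_neg fun h' => h (by rw [h'])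

theorem star_initialDiag (m : ℝ) (k : ℤ → ℝ) (i j : ℤ) :
    star (initialDiag m k j i) = initialDiag m k i j := by
  simp only [initialDiag, eq_comm (a := j)]
  split_ifs with h
  · rw [h]
    exact Complex.conj_ofReal _
  · exact star_zero _

theorem IsBlockDiag.add {M M' : ℤ → ℤ → ℂ} (h : IsBlockDiag M) (h' : IsBlockDiag M') :
    IsBlockDiag (M + M') := fun i j hij => by
  rw [Pi.add_apply, Pi.add_apply, h i j hij, h' i j hij, add_zero]

theorem norm_hamMat_le {M : ℤ → ℤ → ℂ} {η : ℝ} (hη : 0 ≤ η) (p q : Bool × ℤ)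
    (h : ∀ j k : ℤ, k.natAbs = q.2.natAbs → ‖M j k‖ ≤ η) : ‖hamMat M p q‖ ≤ η := by
  rw [hamMat]
  split_ifs
  · rw [norm_neg, norm_star]
    exact h _ _ (by simp)
  · exact h _ _ rfl
  · simpa using hη

theorem hamMat_sub (M M' : ℤ → ℤ → ℂ) (p q : Bool × ℤ) :
    hamMat M p q - hamMat M' p q = hamMat (M - M') p q := by
  simp only [hamMat, Pi.sub_apply, star_sub]
  split_ifs <;> ring

theorem norm_apply_le_of_blk {M : ℤ → ℤ → ℂ} {s : ℝ} (hs : 0 ≤ s) (hM : IsBlockDiag M)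
    (h : ∀ α, eblk α M ≤ ENNReal.ofReal s) (j k : ℤ) : ‖M j k‖ ≤ s := by
  by_cases hjk : j.natAbs = k.natAbs
  · have h1 := norm_le_blockNorm M j k
    rw [← hjk] at h1
    exact h1.trans ((ENNReal.ofReal_le_ofReal_iff hs).1 (h j.natAbs))
  · rw [hM j k hjk, norm_zero]
    exact hs

theorem sub_le_of_lipNorm_le {E : Type*} [Sub E] {N : E → ℝ≥0∞} {f : Freq d → E} {t : ℝ}
    (hγ : 0 < γ) (h : lipNorm γ B N f ≤ ENNReal.ofReal t) {ω₁ ω₂ : Freq d}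
    (h₁ : ω₁ ∈ B) (h₂ : ω₂ ∈ B) (hne : ω₁ ≠ ω₂) :
    N (f ω₁ - f ω₂) ≤ ENNReal.ofReal (t * γ⁻¹ * ‖ω₁ - ω₂‖) := by
  have h3 : ENNReal.ofReal γ * lipSemi B N f ≤ ENNReal.ofReal t := le_trans (by
    rw [lipNorm_eq]
    exact le_add_self) h
  have h4 : lipSemi B N f ≤ ENNReal.ofReal (t * γ⁻¹) := by
    rw [ENNReal.ofReal_mul' (inv_pos.2 hγ).le, ENNReal.ofReal_inv_of_pos hγ, ← div_eq_mul_inv,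
      ENNReal.le_div_iff_mul_le (Or.inl (by simpa using hγ)) (Or.inl ENNReal.ofReal_ne_top), mul_comm]
    exact h3
  rw [ENNReal.ofReal_mul' (norm_nonneg _)]
  exact (le_lipSemi h₁ h₂ hne).trans (mul_le_mul_left h4 _)

theorem norm_initialDiag_sub_le {k : ℤ → ℝ} {s : ℝ} (hk : ∀ j, |k j| ≤ s) (i j : ℤ) :
    ‖(initialDiag m k - sqrtDiag m) i j‖ ≤ s := by
  have hs : 0 ≤ s := (abs_nonneg _).trans (hk 0)
  simp only [Pi.sub_apply, initialDiag, sqrtDiag]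
  split_ifs
  · rw [← Complex.ofReal_sub, Complex.norm_real, Real.norm_eq_abs, add_sub_cancel_left]
    exact hk i
  · simpa using hs

theorem norm_normalForm_sub_le (hε : 0 ≤ ε) (hC₀ : 0 ≤ C₀)
    (hκ : ∀ j : ℤ, lipNorm γ B (fun x : ℝ => ENNReal.ofReal |x|) (κ j) ≤ ENNReal.ofReal (C₀ * ε))
    (hD : ∀ ω ∈ B, IsBlockDiag (D ω)) (hDn : ∀ α, lipNorm γ B (eblk α) D ≤ ENNReal.ofReal (3 * ε))
    {ω : Freq d} (hω : ω ∈ B) (i j : ℤ) :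
    ‖(initialDiag m (fun j => κ j ω) + D ω - sqrtDiag m) i j‖ ≤ (C₀ + 3) * ε := by
  have h1 := norm_initialDiag_sub_le (m := m) (k := fun j => κ j ω) (s := C₀ * ε)
    (fun j => (ENNReal.ofReal_le_ofReal_iff (by positivity)).1
      ((le_lipNorm (N := fun x : ℝ => ENNReal.ofReal |x|) (f := κ j) hω).trans (hκ j))) i j
  have h2 := norm_apply_le_of_blk (s := 3 * ε) (by positivity) (hD ω hω)
    (fun α => (le_lipNorm hω).trans (hDn α)) i j
  rw [add_sub_right_comm]
  refine (norm_add_le _ _).trans ?_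
  linarith

theorem blockNorm_normalForm_sub_le (hε : 0 ≤ ε) (hC₀ : 0 ≤ C₀)
    (hκ : ∀ j : ℤ, lipNorm γ B (fun x : ℝ => ENNReal.ofReal |x|) (κ j) ≤ ENNReal.ofReal (C₀ * ε))
    (hD : ∀ ω ∈ B, IsBlockDiag (D ω)) (hDn : ∀ α, lipNorm γ B (eblk α) D ≤ ENNReal.ofReal (3 * ε))
    {ω : Freq d} (hω : ω ∈ B) (α : ℕ) :
    blockNorm (initialDiag m (fun j => κ j ω) + D ω - sqrtDiag m) α α ≤ 4 * ((C₀ + 3) * ε) :=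
  blockNorm_diag_le fun j k _ _ => norm_normalForm_sub_le hε hC₀ hκ hD hDn hω j k

theorem norm_hamMat_normalForm_le (hε : 0 ≤ ε) (hC₀ : 0 ≤ C₀)
    (hκ : ∀ j : ℤ, lipNorm γ B (fun x : ℝ => ENNReal.ofReal |x|) (κ j) ≤ ENNReal.ofReal (C₀ * ε))
    (hD : ∀ ω ∈ B, IsBlockDiag (D ω)) (hDn : ∀ α, lipNorm γ B (eblk α) D ≤ ENNReal.ofReal (3 * ε))
    {ω : Freq d} (hω : ω ∈ B) : ∃ t : ℝ, 0 ≤ t ∧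
    ∀ p q, ‖hamMat (initialDiag m (fun j => κ j ω) + D ω) p q‖ ≤ t * jap q.2 := by
  have hs : 0 ≤ (C₀ + 3) * ε := by positivity
  refine ⟨1 + |m| + (C₀ + 3) * ε, by positivity, fun p q => norm_hamMat_le
    (mul_nonneg (by positivity) (jap_pos _).le) p q fun j k hk => ?_⟩
  have h1 := norm_normalForm_sub_le (m := m) hε hC₀ hκ hD hDn hω j k
  have hj := one_le_jap (q.2 : ℝ)
  have h2 : ‖sqrtDiag m j k‖ ≤ (1 + |m|) * jap q.2 := by
    rw [sqrtDiag]
    split_ifs with h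
    · rw [Complex.norm_real, Real.norm_of_nonneg (Real.sqrt_nonneg _)]
      refine Real.sqrt_le_iff.2 ⟨by positivity, ?_⟩
      have h3 : |(j : ℝ)| ≤ jap q.2 := by
        rw [← jap_natAbs, ← hk, ← h, jap_natAbs]
        exact abs_le_jap _
      have h4 : (j : ℝ) ^ 2 ≤ jap q.2 ^ 2 := by
        rw [← sq_abs]
        exact pow_le_pow_left₀ (abs_nonneg _) h3 2
      have h5 := le_abs_self m
      have h6 := abs_nonneg m
      have h7 : |m| ≤ |m| * jap q.2 ^ 2 := le_mul_of_one_le_right h6 (one_le_pow₀ hj)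
      nlinarith [sq_nonneg (|m| * jap q.2)]
    · rw [norm_zero]
      positivity
  have h3 : (initialDiag m (fun j => κ j ω) + D ω) j k =
      (initialDiag m (fun j => κ j ω) + D ω - sqrtDiag m) j k + sqrtDiag m j k := by
    simp
  rw [h3]
  refine (norm_add_le _ _).trans ?_
  nlinarith

theorem norm_hamMat_normalForm_sub_le (hγ : 0 < γ) (hε : 0 ≤ ε) (hC₀ : 0 ≤ C₀)
    (hκ : ∀ j : ℤ, lipNorm γ B (fun x : ℝ => ENNReal.ofReal |x|) (κ j) ≤ ENNReal.ofReal (C₀ * ε))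
    (hD : ∀ ω ∈ B, IsBlockDiag (D ω)) (hDn : ∀ α, lipNorm γ B (eblk α) D ≤ ENNReal.ofReal (3 * ε))
    (hsmall : (C₀ + 3) * (ε * γ⁻¹) ≤ 1) {ω₁ ω₂ : Freq d}
    (h₁ : ω₁ ∈ B) (h₂ : ω₂ ∈ B) (p q : Bool × ℤ) :
    ‖hamMat (initialDiag m (fun j => κ j ω₁) + D ω₁) p q -
      hamMat (initialDiag m (fun j => κ j ω₂) + D ω₂) p q‖ ≤ 2 * ‖ω₁ - ω₂‖ := by
  by_cases hne : ω₁ = ω₂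
  · simp [hne]
  rw [hamMat_sub]
  have hg : 0 ≤ ε * γ⁻¹ := mul_nonneg hε (inv_pos.2 hγ).le
  refine norm_hamMat_le (by positivity) p q fun j k _ => ?_
  have e1 : initialDiag m (fun j => κ j ω₁) + D ω₁ - (initialDiag m (fun j => κ j ω₂) + D ω₂) =
      (initialDiag m (fun j => κ j ω₁) - initialDiag m (fun j => κ j ω₂)) + (D ω₁ - D ω₂) := by
    abel
  have e2 : ‖(initialDiag m (fun j => κ j ω₁) - initialDiag m (fun j => κ j ω₂)) j k‖ ≤
      C₀ * ε * γ⁻¹ * ‖ω₁ - ω₂‖ := by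
    have hγ' := (inv_pos.2 hγ).le
    simp only [Pi.sub_apply, initialDiag]
    split_ifs
    · rw [← Complex.ofReal_sub, Complex.norm_real, Real.norm_eq_abs, add_sub_add_left_eq_sub]
      exact (ENNReal.ofReal_le_ofReal_iff (by positivity)).1
        (sub_le_of_lipNorm_le hγ (hκ j) h₁ h₂ hne)
    · rw [sub_zero, norm_zero]
      positivity
  have hγ' := (inv_pos.2 hγ).le
  have e3 := norm_apply_le_of_blk (s := 3 * ε * γ⁻¹ * ‖ω₁ - ω₂‖) (by positivity)
    (M := D ω₁ - D ω₂) (fun i j hij => by simp [hD ω₁ h₁ i j hij, hD ω₂ h₂ i j hij])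
    (fun α => sub_le_of_lipNorm_le hγ (hDn α) h₁ h₂ hne) j k
  rw [e1]
  refine (norm_add_le _ _).trans ((add_le_add e2 e3).trans ?_)
  have := norm_nonneg (ω₁ - ω₂)
  nlinarith

end NormalForms

/-! ### The iteration -/

section Iteration

variable {d : ℕ}

open scoped Matrix.Norms.L2Operator in
theorem eblk_add_le (α : ℕ) (A A' : ℤ → ℤ → ℂ) : eblk α (A + A') ≤ eblk α A + eblk α A' := by
  rw [eblk, eblk, eblk, ← ENNReal.ofReal_add (blockNorm_nonneg _ _ _) (blockNorm_nonneg _ _ _)]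
  exact ENNReal.ofReal_le_ofReal (norm_add_le (block A α α) (block A' α α))

/-- The data of the iteration: the correction to the initial normal form, the perturbation and the
set of frequencies. -/
structure KamState (d : ℕ) where
  corr : Freq d → ℤ → ℤ → ℂ
  pert : Freq d → BlockOp d
  set : Set (Freq d)

/-- The properties of the `n`-th state that are preserved by the iteration. -/
structure KamInv (B : Set (Freq d)) (γ τ hi ε : ℝ) (ϖ : ℝ≥0∞) (N₀ n : ℕ) (σ : KamState d) :
    Prop where
  sub : σ.set ⊆ B
  base : n = 0 → σ.set = B
  blk : ∀ ω ∈ B, IsBlockDiag (σ.corr ω)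
  herm : ∀ ω ∈ B, ∀ j k, star (σ.corr ω k j) = σ.corr ω j k
  lip : ∀ α, lipNorm γ B (eblk α) σ.corr ≤ ENNReal.ofReal ((3 - 2 * (1 / 2 : ℝ) ^ n) * ε)
  ham : ∀ ω ∈ σ.set, IsHam (full (σ.pert ω))
  high_le : lipN γ σ.set hi 1 0 σ.pert ≤ ϖ * ENNReal.ofReal (scale N₀ (n - 1 : ℤ))
  low_le : lipN γ σ.set (hi - bExp τ) 1 0 σ.pert ≤
    ϖ * ENNReal.ofReal (scale N₀ (n - 1 : ℤ) ^ (-aExp τ) * if n = 0 then 1 else 1 / 16)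

theorem KamInv.low_le_of_one_le {B : Set (Freq d)} {γ τ hi ε : ℝ} {ϖ : ℝ≥0∞} {N₀ n : ℕ} {σ : KamState d}
    (h : KamInv B γ τ hi ε ϖ N₀ n σ) (hN₀ : 1 ≤ N₀) : lipN γ σ.set (hi - bExp τ) 1 0 σ.pert ≤
    ϖ * ENNReal.ofReal (scale N₀ (n - 1 : ℤ) ^ (-aExp τ)) := by
  refine h.low_le.trans (mul_le_mul_right (ENNReal.ofReal_le_ofReal ?_) _)
  have h1 : 0 ≤ scale N₀ (n - 1 : ℤ) ^ (-aExp τ) :=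
    Real.rpow_nonneg (zero_le_one.trans (one_le_scale_sub_one hN₀ n)) _
  split_ifs <;> linarith

theorem KamInv.exists_corr {B : Set (Freq d)} {γ τ hi ε : ℝ} {ϖ : ℝ≥0∞} {N₀ n : ℕ}
    {σ : KamState d} (h : KamInv B γ τ hi ε ϖ N₀ n σ) (hN₀ : 1 ≤ N₀) (hγ : 0 < γ) (hε : 0 ≤ ε)
    (hϖ : ϖ ≤ ENNReal.ofReal ε) :
    ∃ E : Freq d → ℤ → ℤ → ℂ, (∀ ω ∈ σ.set, E ω = diagPart (σ.pert ω)) ∧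
      (∀ ω ∈ B, IsBlockDiag (E ω)) ∧ (∀ ω ∈ B, ∀ j k, star (E ω k j) = E ω j k) ∧
      ∀ α : ℕ, lipNorm γ B (eblk α) E ≤
        ENNReal.ofReal (scale N₀ (n - 1 : ℤ) ^ (-aExp τ) * ε * (jap α)⁻¹) := by
  have hA : 0 ≤ scale N₀ (n - 1 : ℤ) ^ (-aExp τ) :=
    Real.rpow_nonneg (zero_le_one.trans (one_le_scale_sub_one hN₀ n)) _
  have hstar : ∀ ω ∈ σ.set, ∀ j k, star (diagPart (σ.pert ω) k j) = diagPart (σ.pert ω) j k :=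
    fun ω hω => star_diagPart ((isHam_full_iff _).1 (h.ham ω hω)).1
  have key : ∀ (t : ℝ), 0 ≤ t → ∀ α : ℕ, lipN γ σ.set (hi - bExp τ) 1 0 σ.pert ≤
      ϖ * ENNReal.ofReal (scale N₀ (n - 1 : ℤ) ^ (-aExp τ) * t) →
      lipNorm γ σ.set (eblk α) (fun ω => diagPart (σ.pert ω)) ≤
        ENNReal.ofReal (scale N₀ (n - 1 : ℤ) ^ (-aExp τ) * ε * (jap α)⁻¹ * t) := by
    intro t ht α hlo
    refine (lipNorm_diagPart_le (hi - bExp τ) σ.pert α).trans ?_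
    have hj := (inv_pos.2 (jap_pos α)).le
    calc _ ≤ ENNReal.ofReal (jap α)⁻¹ * (ENNReal.ofReal ε *
          ENNReal.ofReal (scale N₀ (n - 1 : ℤ) ^ (-aExp τ) * t)) := by
          gcongr
          exact hlo.trans (mul_le_mul_left hϖ _)
      _ = _ := by
          rw [← ENNReal.ofReal_mul hε, ← ENNReal.ofReal_mul hj]
          congr 1
          ring
  by_cases hn : n = 0
  · have hB := h.base hn
    refine ⟨fun ω => diagPart (σ.pert ω), fun _ _ => rfl, fun ω _ => isBlockDiag_diagPart _,
      fun ω hω => hstar ω (hB ▸ hω), fun α => ?_⟩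
    have := key 1 zero_le_one α (by simpa [hn] using h.low_le)
    rw [hB, mul_one] at this
    exact this
  · have key' : ∀ α : ℕ, lipNorm γ σ.set (eblk α) (fun ω => diagPart (σ.pert ω)) ≤
        ENNReal.ofReal (scale N₀ (n - 1 : ℤ) ^ (-aExp τ) * ε * (jap α)⁻¹ * (1 / 16)) := fun α =>
      key (1 / 16) (by norm_num) α (by simpa [hn] using h.low_le)
    obtain ⟨E, h1, h2, h3, h4⟩ := exists_extension hγ (O := σ.set) (fun ω => diagPart (σ.pert ω))
      (fun ω _ => isBlockDiag_diagPart _) hstar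
      (fun α => ne_top_of_le_ne_top ENNReal.ofReal_ne_top (key' α))
    refine ⟨E, h1, fun ω _ => h2 ω, fun ω _ => h3 ω, fun α => (h4 B α).trans
      ((mul_le_mul_right (key' α) _).trans ?_)⟩
    have hj := (inv_pos.2 (jap_pos α)).le
    rw [show (8 : ℝ≥0∞) = ENNReal.ofReal 8 by norm_num, ← ENNReal.ofReal_mul (by norm_num)]
    refine ENNReal.ofReal_le_ofReal ?_
    have : 0 ≤ scale N₀ (n - 1 : ℤ) ^ (-aExp τ) * ε * (jap α)⁻¹ := by positivity
    linarith

theorem KamInv.exists_succ {B : Set (Freq d)} {γ τ hi ε m C₀ C : ℝ} {ϖ : ℝ≥0∞} {N₀ n : ℕ}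
    {κ : ℤ → Freq d → ℝ} {σ : KamState d} (h : KamInv B γ τ hi ε ϖ N₀ n σ)
    (hW : ∀ lam : ℝ, 0 ≤ lam → IsModuleWeight (Wgt (d := d) vZero (hi - bExp τ) hi lam)
      (Wgt vOne (hi - bExp τ) hi lam) (ENNReal.ofReal C)) (hC : 1 ≤ C)
    (hlo : (sZero d : ℝ) ≤ hi - bExp τ) (hτ : 0 < τ) (hm : 0 < m) (hγ : 0 < γ) (hγ1 : γ < 1)
    (hε : 0 ≤ ε) (hC₀ : 0 ≤ C₀)
    (hκ : ∀ j : ℤ, lipNorm γ B (fun x : ℝ => ENNReal.ofReal |x|) (κ j) ≤ ENNReal.ofReal (C₀ * ε))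
    (hϖ : ϖ ≤ ENNReal.ofReal ε) (hN₀ : (200000 : ℝ) ≤ N₀)
    (hN₁ : (2560 * cutRatio ^ bExp τ) ^ 2 ≤ N₀) (hN₂ : 4 ≤ (N₀ : ℝ) ^ τ)
    (hN₃ : 1 ≤ (N₀ : ℝ) ^ τ * Real.sqrt m) (hs₁ : (C₀ + 3) * (ε * γ⁻¹) ≤ 1)
    (hs₂ : 8 * (C₀ + 3) * (ε * γ⁻¹) ≤ Real.sqrt m)
    (hs₃ : 40960 * C * (ε * γ⁻¹) * (N₀ : ℝ) ^ (2 * τ + 1 + aExp τ) ≤ 1) :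
    ∃ (σ' : KamState d) (U : Freq d → BlockOp d), KamInv B γ τ hi ε ϖ N₀ (n + 1) σ' ∧
      σ'.set = {ω | ω ∈ σ.set ∧
        Melnikov γ τ (scale N₀ n) (initialDiag m (fun j => κ j ω) + σ.corr ω) ω} ∧
      (∀ ω ∈ σ'.set, IsHam (full (U ω))) ∧
      lipN γ σ'.set (hi - bExp τ) 1 1 U ≤ ϖ * ENNReal.ofReal (γ⁻¹ * scale N₀ n ^ (2 * τ + 1) *
        scale N₀ (n - 1 : ℤ) ^ (-aExp τ)) ∧
      lipN γ σ'.set hi 1 1 U < ⊤ ∧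
      (∀ ω ∈ σ'.set, Conjugates ω (U ω)
        (constOp (initialDiag m (fun j => κ j ω) + σ.corr ω) + σ.pert ω)
        (constOp (initialDiag m (fun j => κ j ω) + σ'.corr ω) + σ'.pert ω)) ∧
      ∀ α : ℕ, lipNorm γ B (eblk α) (fun ω => σ'.corr ω - σ.corr ω) ≤
        ENNReal.ofReal (scale N₀ (n - 1 : ℤ) ^ (-aExp τ) * ε * (jap α)⁻¹) := by
  have hN1 : 4 ≤ N₀ := by
    have : (4 : ℝ) ≤ N₀ := by linarith
    exact_mod_cast this
  have hN1' : 1 ≤ N₀ := by omega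
  have hscale := le_scale hN1' n
  have hKb : 1 ≤ cutRatio ^ bExp τ :=
    Real.one_le_rpow (by norm_num [cutRatio]) (by rw [bExp, aExp]; linarith)
  have hγi : 1 ≤ γ⁻¹ := (one_le_inv₀ hγ).2 hγ1.le
  have hεγ : ε ≤ ε * γ⁻¹ := le_mul_of_one_le_right hε hγi
  obtain ⟨E, hE, hEb, hEh, hEn⟩ := h.exists_corr hN1' hγ hε hϖ
  set O : Set (Freq d) := {ω | ω ∈ σ.set ∧
    Melnikov γ τ (scale N₀ n) (initialDiag m (fun j => κ j ω) + σ.corr ω) ω} with hO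
  have hOσ : O ⊆ σ.set := fun ω hω => hω.1
  have hOB : O ⊆ B := hOσ.trans h.sub
  have hDn : ∀ α, lipNorm γ B (eblk α) σ.corr ≤ ENNReal.ofReal (3 * ε) := fun α =>
    (h.lip α).trans (ENNReal.ofReal_le_ofReal (mul_le_mul_of_nonneg_right
      (by have : (0 : ℝ) < (1 / 2 : ℝ) ^ n := by positivity
          linarith) hε))
  have hNτ : (N₀ : ℝ) ^ τ ≤ scale N₀ n ^ τ :=
    Real.rpow_le_rpow (Nat.cast_nonneg _) hscale hτ.le
  have hherm : ∀ ω ∈ B, ∀ j k, star ((initialDiag m (fun j => κ j ω) + σ.corr ω) k j) =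
      (initialDiag m (fun j => κ j ω) + σ.corr ω) j k := fun ω hω j k => by
    rw [Pi.add_apply, Pi.add_apply, Pi.add_apply, Pi.add_apply, star_add, star_initialDiag,
      h.herm ω hω]
  have hcutle : scale N₀ n / cutRatio ≤ scale N₀ n :=
    div_le_self (by linarith) (by norm_num [cutRatio])
  obtain ⟨U, P', hU, hP', hUlo, hUhi, hPhi, hPlo, hconj⟩ := exists_step_bounds
    (M := fun ω => initialDiag m (fun j => κ j ω) + σ.corr ω) (O := O) (N := scale N₀ n)
    (A := scale N₀ (n - 1 : ℤ)) (P := σ.pert) hW hC hlo hτ hγ hε (one_le_scale_sub_one hN1' n)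
    (by linarith) (mul_scale_sub_one_le (by linarith) hN₁ n) (by
      have := smallness_scale hτ hN1' (by positivity) hs₃ n
      rw [← mul_assoc (40960 * C)]
      exact this)
    (fun ω hω => (isBlockDiag_initialDiag _ _).add (h.blk ω (hOB hω)))
    (fun ω hω => hherm ω (hOB hω))
    (fun ω hω l p q ha => isGap_of_melnikov (hherm ω (hOB hω)) hcutle hω.2
      (fun α a haα => le_add_of_mem_spectrum hγ1.le (hN₂.trans hNτ) hm
        (hN₃.trans (mul_le_mul_of_nonneg_right hNτ (Real.sqrt_nonneg m))) (by nlinarith)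
        (blockNorm_normalForm_sub_le hε hC₀ hκ h.blk hDn (hOB hω) α) haα) hγ.le (by linarith) ha)
    (fun ω₁ h₁ ω₂ h₂ p q => norm_hamMat_normalForm_sub_le hγ hε hC₀ hκ h.blk hDn hs₁
      (hOB h₁) (hOB h₂) p q)
    (fun ω hω => norm_hamMat_normalForm_le hε hC₀ hκ h.blk hDn (hOB hω))
    (fun ω hω => h.ham ω (hOσ hω)) hϖ ((lipNorm_mono_set hOσ).trans h.high_le)
    ((lipNorm_mono_set hOσ).trans (h.low_le_of_one_le hN1'))
  refine ⟨⟨fun ω => σ.corr ω + E ω, P', O⟩, U, ⟨hOB, fun h => absurd h (Nat.succ_ne_zero n),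
    fun ω hω => (h.blk ω hω).add (hEb ω hω), fun ω hω j k => ?_, fun α => ?_, hP', ?_, ?_⟩, rfl, hU,
    hUlo, hUhi, fun ω hω => ?_, fun α => ?_⟩
  · simp only [Pi.add_apply, star_add, h.herm ω hω, hEh ω hω]
  · have h1 := lipNorm_le_add (γ := γ) (O := B) (N := eblk α) (N₁ := eblk α) (N₂ := eblk α)
      (f := fun ω => σ.corr ω + E ω) (f₁ := σ.corr) (f₂ := E) (fun ω _ => eblk_add_le α _ _)
      (fun ω₁ _ ω₂ _ _ => by
        rw [add_sub_add_comm]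
        exact eblk_add_le α _ _)
    refine h1.trans ((add_le_add (h.lip α) (hEn α)).trans ?_)
    have hA0 : 0 ≤ scale N₀ (n - 1 : ℤ) ^ (-aExp τ) :=
      Real.rpow_nonneg (zero_le_one.trans (one_le_scale_sub_one hN1' n)) _
    have h2 : scale N₀ (n - 1 : ℤ) ^ (-aExp τ) ≤ (1 / 2 : ℝ) ^ n :=
      scale_rpow_neg_le hN1 n (by rw [aExp]; linarith)
    have h3 : scale N₀ (n - 1 : ℤ) ^ (-aExp τ) * ε * (jap α)⁻¹ ≤ (1 / 2 : ℝ) ^ n * ε :=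
      (mul_le_of_le_one_right (by positivity) (inv_le_one_of_one_le₀ (one_le_jap _))).trans
        (mul_le_mul_of_nonneg_right h2 hε)
    have h4 : (1 / 2 : ℝ) ^ n ≤ 1 := pow_le_one₀ (by norm_num) (by norm_num)
    have hj := (inv_pos.2 (jap_pos α)).le
    rw [← ENNReal.ofReal_add (mul_nonneg (by linarith) hε) (by positivity)]
    refine ENNReal.ofReal_le_ofReal ?_
    rw [pow_succ]
    linarith
  · rw [scale_succ_sub_one]
    exact hPhi
  · rw [scale_succ_sub_one, if_neg (Nat.succ_ne_zero n), mul_one_div]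
    exact hPlo
  · have := hconj ω hω
    rw [← hE ω (hOσ hω), add_assoc] at this
    exact this
  · refine le_trans (le_of_eq ?_) (hEn α)
    congr 1
    funext ω
    exact add_sub_cancel_left _ _

end Iteration

end

end WaveKAM

theorem theorem5p1 (d : ℕ) (hd : 1 ≤ d) (m : ℝ) (hm : 0 < m) (s τ C₀ : ℝ) (hτ : 0 < τ)
    (hC₀ : 0 ≤ C₀) :
    ∃ Nbar : ℕ, ∀ N₀ : ℕ, Nbar ≤ N₀ → ∃ δ₀ : ℝ, 0 < δ₀ ∧ δ₀ < 1 ∧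
    ∀ τ₀ sr γ ε : ℝ, 0 < τ₀ → sr = s - τ₀ - 11 → (WaveKAM.sZero d : ℝ) < sr - WaveKAM.bExp τ →
    0 < γ → γ < 1 → 0 ≤ ε →
    ∀ (κ : ℤ → WaveKAM.Freq d → ℝ) (P₀ : WaveKAM.Freq d → WaveKAM.BlockOp d),
    (∀ j : ℤ, WaveKAM.lipNorm γ (WaveKAM.baseSet d γ τ₀) (fun x : ℝ => ENNReal.ofReal |x|) (κ j)
      ≤ ENNReal.ofReal (C₀ * ε)) →
    WaveKAM.MemLipN γ (WaveKAM.baseSet d γ τ₀) sr 1 0 P₀ →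
    WaveKAM.lipN γ (WaveKAM.baseSet d γ τ₀) sr 1 0 P₀ ≤ ENNReal.ofReal ε →
    ε * γ⁻¹ ≤ δ₀ →
    ∃ (M : ℕ → WaveKAM.Freq d → ℤ → ℤ → ℂ) (P U : ℕ → WaveKAM.Freq d → WaveKAM.BlockOp d),
      -- the iteration starts from the given equation
      (∀ ω ∈ WaveKAM.baseSet d γ τ₀, M 0 ω = WaveKAM.initialDiag m (fun j => κ j ω)) ∧
      (∀ ω ∈ WaveKAM.baseSet d γ τ₀, P 0 ω = P₀ ω) ∧
      -- the generators
      (∀ n : ℕ, 1 ≤ n →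
        WaveKAM.MemLipN γ (WaveKAM.freqSet d γ τ₀ τ N₀ M n) sr 1 1 (U n) ∧
        WaveKAM.lipN γ (WaveKAM.freqSet d γ τ₀ τ N₀ M n) (sr - WaveKAM.bExp τ) 1 1 (U n)
          ≤ WaveKAM.lipN γ (WaveKAM.baseSet d γ τ₀) sr 1 0 P₀ *
            ENNReal.ofReal (γ⁻¹ * WaveKAM.scale N₀ (n - 1) ^ (2 * τ + 1)
              * WaveKAM.scale N₀ (n - 2) ^ (-WaveKAM.aExp τ)) ∧
        ∀ ω ∈ WaveKAM.freqSet d γ τ₀ τ N₀ M n,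
          WaveKAM.Conjugates ω (U n ω) (WaveKAM.constOp (M (n - 1) ω) + P (n - 1) ω)
            (WaveKAM.constOp (M n ω) + P n ω)) ∧
      -- the normal forms
      (∀ n : ℕ, ∀ ω ∈ WaveKAM.baseSet d γ τ₀,
        WaveKAM.IsBlockDiag (M n ω) ∧ ∀ j : ℕ, (WaveKAM.block (M n ω) j j).IsHermitian) ∧
      (∀ n : ℕ, 1 ≤ n → ∀ j : ℕ,
        WaveKAM.lipNorm γ (WaveKAM.baseSet d γ τ₀)
            (fun A : ℤ → ℤ → ℂ => ENNReal.ofReal (WaveKAM.blockNorm A j j))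
            (fun ω => M n ω - M (n - 1) ω)
          ≤ ENNReal.ofReal (WaveKAM.scale N₀ (n - 2) ^ (-WaveKAM.aExp τ) * ε
              * (WaveKAM.jap j)⁻¹)) ∧
      -- the perturbations
      (∀ n : ℕ,
        WaveKAM.MemLipN γ (WaveKAM.freqSet d γ τ₀ τ N₀ M n) sr 1 0 (P n) ∧
        WaveKAM.lipN γ (WaveKAM.freqSet d γ τ₀ τ N₀ M n) sr 1 0 (P n)
          ≤ WaveKAM.lipN γ (WaveKAM.baseSet d γ τ₀) sr 1 0 P₀ *
            ENNReal.ofReal (WaveKAM.scale N₀ (n - 1)) ∧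
        WaveKAM.lipN γ (WaveKAM.freqSet d γ τ₀ τ N₀ M n) (sr - WaveKAM.bExp τ) 1 0 (P n)
          ≤ WaveKAM.lipN γ (WaveKAM.baseSet d γ τ₀) sr 1 0 P₀ *
            ENNReal.ofReal (WaveKAM.scale N₀ (n - 1) ^ (-WaveKAM.aExp τ))) := by
  obtain ⟨C, hC, hW⟩ := WaveKAM.exists_isModuleWeight d s
  have hsm : 0 < Real.sqrt m := Real.sqrt_pos.2 hm
  obtain ⟨Nbar, hNbar⟩ := exists_nat_ge (200000 + (4 + (Real.sqrt m)⁻¹) ^ τ⁻¹ +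
    (2560 * WaveKAM.cutRatio ^ WaveKAM.bExp τ) ^ 2)
  refine ⟨Nbar, fun N₀ hN₀ => ?_⟩
  have hroot : 0 ≤ (4 + (Real.sqrt m)⁻¹) ^ τ⁻¹ := by positivity
  have hN : 200000 + (4 + (Real.sqrt m)⁻¹) ^ τ⁻¹ +
      (2560 * WaveKAM.cutRatio ^ WaveKAM.bExp τ) ^ 2 ≤ N₀ := hNbar.trans (by exact_mod_cast hN₀)
  have hsq := sq_nonneg (2560 * WaveKAM.cutRatio ^ WaveKAM.bExp τ)
  have hN₁ : (200000 : ℝ) ≤ N₀ := by linarith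
  have hN₂ : (2560 * WaveKAM.cutRatio ^ WaveKAM.bExp τ) ^ 2 ≤ N₀ := by linarith
  have hNτ : 4 + (Real.sqrt m)⁻¹ ≤ (N₀ : ℝ) ^ τ := by
    have h1 := Real.rpow_le_rpow hroot
      (show (4 + (Real.sqrt m)⁻¹) ^ τ⁻¹ ≤ (N₀ : ℝ) by linarith) hτ.le
    rwa [← Real.rpow_mul (by positivity), inv_mul_cancel₀ hτ.ne', Real.rpow_one] at h1
  have hN₃ : 4 ≤ (N₀ : ℝ) ^ τ := le_trans (by linarith [inv_pos.2 hsm]) hNτ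
  have hN₄ : 1 ≤ (N₀ : ℝ) ^ τ * Real.sqrt m := by
    calc (1 : ℝ) = (Real.sqrt m)⁻¹ * Real.sqrt m := (inv_mul_cancel₀ hsm.ne').symm
      _ ≤ _ := mul_le_mul_of_nonneg_right (by linarith) hsm.le
  set R : ℝ := 2 + 8 * (C₀ + 3) + 8 * (C₀ + 3) / Real.sqrt m +
    40960 * C * (N₀ : ℝ) ^ (2 * τ + 1 + WaveKAM.aExp τ) with hR
  have t1 : 0 ≤ 8 * (C₀ + 3) / Real.sqrt m := by positivity
  have t2 : 0 ≤ 40960 * C * (N₀ : ℝ) ^ (2 * τ + 1 + WaveKAM.aExp τ) := by positivity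
  have hR2 : 2 ≤ R := by linarith
  have hR0 : 0 < R := by linarith
  refine ⟨R⁻¹, inv_pos.2 hR0, inv_lt_one_of_one_lt₀ (by linarith), ?_⟩
  intro τ₀ sr γ ε hτ₀ hsr hs0 hγ hγ1 hε κ P₀ hκ hP₀ hP₀ε hsmall
  have hsmall' : ∀ t, t ≤ R → t * (ε * γ⁻¹) ≤ 1 := fun t ht => by
    have h0 : 0 ≤ ε * γ⁻¹ := by positivity
    calc t * (ε * γ⁻¹) ≤ R * R⁻¹ := mul_le_mul ht hsmall h0 hR0.le
      _ = 1 := mul_inv_cancel₀ hR0.ne'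
  have hs₁ : (C₀ + 3) * (ε * γ⁻¹) ≤ 1 := hsmall' _ (by linarith)
  have hs₂ : 8 * (C₀ + 3) * (ε * γ⁻¹) ≤ Real.sqrt m := by
    have h1 := hsmall' (8 * (C₀ + 3) / Real.sqrt m) (by linarith)
    rwa [div_mul_eq_mul_div, div_le_one hsm] at h1
  have hs₃ : 40960 * C * (ε * γ⁻¹) * (N₀ : ℝ) ^ (2 * τ + 1 + WaveKAM.aExp τ) ≤ 1 := by
    have h1 := hsmall' (40960 * C * (N₀ : ℝ) ^ (2 * τ + 1 + WaveKAM.aExp τ)) (by linarith)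
    calc _ = _ := by ring
      _ ≤ 1 := h1
  have hN₅ : 1 ≤ N₀ := by
    have : (1 : ℝ) ≤ N₀ := by linarith
    exact_mod_cast this
  set B := WaveKAM.baseSet d γ τ₀
  set ϖ := WaveKAM.lipN γ B sr 1 0 P₀
  have ha : 0 < WaveKAM.aExp τ := by rw [WaveKAM.aExp]; linarith
  have hb : 0 < WaveKAM.bExp τ := by rw [WaveKAM.bExp]; linarith
  have hϖtop : ϖ < ⊤ := hP₀.2
  have hstart : WaveKAM.KamInv B γ τ sr ε ϖ N₀ 0 ⟨0, P₀, B⟩ := by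
    refine ⟨le_rfl, fun _ => rfl, fun _ _ _ _ _ => rfl, fun _ _ _ _ => star_zero _, fun α => ?_,
      fun ω hω => ((WaveKAM.memN_iff _).1 (hP₀.1 ω hω)).1, ?_, ?_⟩
    · have h0 : WaveKAM.eblk α 0 = 0 := by
        have := WaveKAM.blockNorm_diag_le (A := 0) (α := α) (s := 0) (fun j k _ _ => by simp)
        rw [WaveKAM.eblk, ENNReal.ofReal_eq_zero]
        linarith
      have h1 : WaveKAM.lipNorm γ B (WaveKAM.eblk α) (0 : WaveKAM.Freq d → ℤ → ℤ → ℂ) ≤ 0 := by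
        have := WaveKAM.lipNorm_le_mul (γ := γ) (O := B) (c := 0) (N := WaveKAM.eblk α)
          (N' := WaveKAM.eblk α) (f := (0 : WaveKAM.Freq d → ℤ → ℤ → ℂ))
          (g := (0 : WaveKAM.Freq d → ℤ → ℤ → ℂ)) (fun _ _ => by simp [h0])
          (fun _ _ _ _ _ => by simp [h0])
        rwa [zero_mul] at this
      exact h1.trans bot_le
    · rw [WaveKAM.scale_zero_sub_one, ENNReal.ofReal_one, mul_one]
    · rw [WaveKAM.scale_zero_sub_one, if_pos rfl, Real.one_rpow, mul_one, ENNReal.ofReal_one,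
        mul_one]
      exact WaveKAM.lipN_mono (by linarith) P₀
  have hstep : ∀ (n : ℕ) (σ : {σ : WaveKAM.KamState d // WaveKAM.KamInv B γ τ sr ε ϖ N₀ n σ}), _ :=
    fun n σ => σ.2.exists_succ (m := m) (κ := κ) (fun lam hlam =>
      hW (sr - WaveKAM.bExp τ) sr lam hs0.le (by linarith) (by linarith) hlam) hC hs0.le hτ hm hγ
      hγ1 hε hC₀ hκ hP₀ε hN₁ hN₂ hN₃ hN₄ hs₁ hs₂ hs₃
  choose next gen hnext hset hgen hgenlo hgenhi hconj hcorr using hstep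
  let seq : ∀ n : ℕ, {σ : WaveKAM.KamState d // WaveKAM.KamInv B γ τ sr ε ϖ N₀ n σ} := fun n =>
    Nat.rec ⟨_, hstart⟩ (fun n σ => ⟨next n σ, hnext n σ⟩) n
  have hfreq : ∀ n, WaveKAM.freqSet d γ τ₀ τ N₀ (fun n ω =>
      WaveKAM.initialDiag m (fun j => κ j ω) + (seq n).1.corr ω) n = (seq n).1.set := by
    intro n
    induction n with
    | zero => rfl
    | succ n ih =>
      rw [WaveKAM.freqSet, ih]
      exact (hset n (seq n)).symm
  refine ⟨fun n ω => WaveKAM.initialDiag m (fun j => κ j ω) + (seq n).1.corr ω,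
    fun n => (seq n).1.pert, fun n => gen (n - 1) (seq (n - 1)), fun ω _ => add_zero _,
    fun ω _ => rfl, fun n hn => ?_, fun n ω hω => ⟨?_, fun j => ?_⟩, fun n hn j => ?_, fun n => ?_⟩
  · obtain ⟨n, rfl⟩ : ∃ k, n = k + 1 := ⟨n - 1, by omega⟩
    rw [hfreq]
    have e1 : ((n + 1 : ℕ) : ℤ) - 1 = n := by push_cast; ring
    have e2 : ((n + 1 : ℕ) : ℤ) - 2 = n - 1 := by push_cast; ring
    rw [e1, e2, Nat.add_sub_cancel]
    refine ⟨⟨fun ω hω => (WaveKAM.memN_iff _).2 ⟨hgen n (seq n) ω hω,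
      (WaveKAM.le_lipNorm hω).trans_lt (hgenhi n (seq n))⟩, hgenhi n (seq n)⟩,
      hgenlo n (seq n), fun ω hω => hconj n (seq n) ω hω⟩
  · exact (WaveKAM.isBlockDiag_initialDiag _ _).add ((seq n).2.blk ω hω)
  · refine Matrix.IsHermitian.ext fun r c => ?_
    simp only [WaveKAM.block, Matrix.of_apply, Pi.add_apply, star_add, WaveKAM.star_initialDiag,
      (seq n).2.herm ω hω]
  · obtain ⟨n, rfl⟩ : ∃ k, n = k + 1 := ⟨n - 1, by omega⟩
    have e2 : ((n + 1 : ℕ) : ℤ) - 2 = n - 1 := by push_cast; ring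
    rw [e2, Nat.add_sub_cancel]
    refine le_trans (le_of_eq ?_) (hcorr n (seq n) j)
    change WaveKAM.lipNorm γ B (WaveKAM.eblk j) _ = _
    congr 1
    funext ω
    exact add_sub_add_left_eq_sub _ _ _
  · rw [hfreq]
    have h1 : WaveKAM.lipN γ (seq n).1.set sr 1 0 (seq n).1.pert < ⊤ :=
      (seq n).2.high_le.trans_lt (ENNReal.mul_lt_top hϖtop ENNReal.ofReal_lt_top)
    exact ⟨⟨fun ω hω => (WaveKAM.memN_iff _).2 ⟨(seq n).2.ham ω hω,
      (WaveKAM.le_lipNorm hω).trans_lt h1⟩, h1⟩, (seq n).2.high_le,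
      (seq n).2.low_le_of_one_le hN₅⟩
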